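/- **Setting.** Let $\mathcal H$ be a separable real Hilbert space (of finite or infinite dimension) and $(\mathbf x,y)\sim\mathcal D$ a random pair in $\mathcal H\times\mathbb R$ with $\mathbb E[y^2]<\infty$. Put $L(\mathbf w)=\frac12\mathbb E[(y-\langle\mathbf w,\mathbf x\rangle)^2]$, let $\mathbf w^*$ minimize $L$, and let $\mathcal E(\mathbf w)=L(\mathbf w)-L(\mathbf w^*)$. Let $\mathcal Q_d,\mathcal Q_l,\mathcal Q_p,\mathcal Q_a,\mathcal Q_o$ be independent random quantization operations for features (in $\mathcal H$), labels (in $\mathbb R$), parameters (in $\mathcal H$), activations and output gradients (both in $\mathbb R^B$), with fresh independent randomness at every use; features and labels are quantized example by example. Each is unbiased, $\mathbb E[\mathcal Q_i(\mathbf u)\mid\mathbf u]=\mathbf u$, and $\epsilon_i$-multiplicative, $\mathbb E[(\mathcal Q_i(\mathbf u)-\mathbf u)(\mathcal Q_i(\mathbf u)-\mathbf u)^\top\mid\mathbf u]=\epsilon_i\mathbf u\mathbf u^\top$ for all $\mathbf u$, with $0\le\epsilon_i\le M$. For $t=1,\dots,N$, let $(\mathbf X_t,\mathbf y_t)$ be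 independent batches of $B\ge1$ i.i.d. examples from $\mathcal D$, and let $\mathbf w_0=\mathbf 0$, $$\mathbf w_t=\mathbf w_{t-1}+\frac{\gamma}{B}\,\mathcal Q_d(\mathbf X_t)^\top\mathcal Q_o\Big(\mathcal Q_l(\mathbf y_t)-\mathcal Q_a\big(\mathcal Q_d(\mathbf X_t)\mathcal Q_p(\mathbf w_{t-1})\big)\Big),\qquad \overline{\mathbf w}_N=\frac1N\sum_{t=0}^{N-1}\mathbf w_t\quad(N\ge1).$$ **Assumptions.** Let $\mathbf x^{(q)}=\mathcal Q_d(\mathbf x)$, $y^{(q)}=\mathcal Q_l(y)$, $\mathbf H=\mathbb E[\mathbf x\mathbf x^\top]$, $\mathbf H^{(q)}=\mathbb E[\mathbf x^{(q)}{\mathbf x^{(q)}}^\top]$, let $\mathbf w^{(q)*}$ minimize $\mathbb E[(y^{(q)}-\langle\mathbf w,\mathbf x^{(q)}\rangle)^2]$, and let $\xi=y^{(q)}-\langle\mathbf w^{(q)*},\mathbf x^{(q)}\rangle$. Assume that $\mathrm{tr}\,\mathbf H$ and $\mathrm{tr}\,\mathbf H^{(q)}$ are finite; that for some $\alpha_B>0$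 and every positive semidefinite $\mathbf A$, $\mathbb E[\mathbf x^{(q)}{\mathbf x^{(q)}}^\top\mathbf A\,\mathbf x^{(q)}{\mathbf x^{(q)}}^\top]\preceq\alpha_B\,\mathrm{tr}(\mathbf H^{(q)}\mathbf A)\,\mathbf H^{(q)}$; and that for some $\sigma>0$, $\mathbb E[\xi^2\mathbf x^{(q)}{\mathbf x^{(q)}}^\top]\preceq\sigma^2\mathbf H^{(q)}$ (the expectations on the left being finite). Let $\mathbf H=\sum_i\lambda_i\mathbf v_i\mathbf v_i^\top$ be an eigendecomposition with $\lambda_1\ge\lambda_2\ge\dots\geq 0$, let $\lambda_1^{(q)}\ge\lambda_2^{(q)}\ge\cdots$ be the eigenvalues of $\mathbf H^{(q)}$, and let $k^*=\max\{k:\lambda^{(q)}_k\ge\frac1{N\gamma}\}$ (with $k^*=0$ if there is no such $k$). Write $\|\mathbf w\|_{\mathbf A}^2=\mathbf w^\top\mathbf A\mathbf w$, $\mathbf I_{0:k}=\sum_{i\le k}\mathbf v_i\mathbf v_i^\top$, $\mathbf H_{0:k}^{-1}=\sum_{i\le k}\lambda_i^{-1}\mathbf v_i\mathbf v_i^\top$,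 $\mathbf H_{k:\infty}=\sum_{i>k}\lambda_i\mathbf v_i\mathbf v_i^\top$, and $$C_\epsilon=(1+\epsilon_d)\big(1+2\epsilon_p+4\epsilon_o(1+\epsilon_a)(1+\epsilon_p)+2\epsilon_a(1+\epsilon_p)\big).$$ **Theorem.** For every $M$ there is a constant $C>0$ that depends on $M$ only, such that in the above setting, if $0<\gamma<\frac{1}{\alpha_BC_\epsilon\mathrm{tr}(\mathbf H)}$, then $\mathcal E(\overline{\mathbf w}_N)$ is integrable and $$\mathbb E[\mathcal E(\overline{\mathbf w}_N)]\le C\,(\mathrm{ApproxErr}+\mathrm{VarErr}+\mathrm{BiasErr}),$$ where $$\mathrm{ApproxErr}=\|\mathbf w^*\|_{\mathbf H}^2\,\epsilon_d+\epsilon_l,\qquad \mathrm{BiasErr}=\frac1{\gamma^2N^2}\|\mathbf w^*\|^2_{\mathbf H_{0:k^*}^{-1}}+\|\mathbf w^*\|^2_{\mathbf H_{k^*:\infty}},$$ $$\mathrm{VarErr}=\Big(\frac{k^*}N+N\gamma^2\sum_{i>k^*}\lambda_i^2\Big)\cdot\frac{\frac{\sigma^2}B+\alpha_B\Big((\epsilon_o+\epsilon_a+\epsilon_p)\|\mathbf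 w^*\|_{\mathbf H}^2+\frac{\|\mathbf w^*\|^2_{\mathbf I_{0:k^*}}}{N\gamma}+\|\mathbf w^*\|^2_{\mathbf H_{k^*:\infty}}\Big)}{1-\gamma\alpha_BC_\epsilon\mathrm{tr}(\mathbf H)}.$$ -/

import Mathlib

open MeasureTheory ProbabilityTheory InnerProductSpace
open scoped RealInnerProductSpace

universe u v

noncomputable section

namespace QuantizedSGD

/-! ### Operators on a Hilbert space -/

section Operators

variable {E : Type*} [NormedAddCommGroup E] [InnerProductSpace ℝ E]

/-- The second moment operator `𝔼[X Xᵀ]` of a random vector `X`. -/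
def secondMoment {Ω : Type*} [MeasurableSpace Ω] (μ : Measure Ω) (X : Ω → E) : E →L[ℝ] E :=
  ∫ ω, rankOne ℝ (X ω) (X ω) ∂μ

/-- A fixed Hilbert basis of `E`. -/
def stdBasis (E : Type*) [NormedAddCommGroup E] [InnerProductSpace ℝ E] [CompleteSpace E] :
    HilbertBasis (exists_hilbertBasis ℝ E).choose ℝ E :=
  (exists_hilbertBasis ℝ E).choose_spec.choose

/-- The trace `∑ᵢ ⟨bᵢ, A bᵢ⟩` of an operator. It is only used for trace class operators, for which
the sum converges absolutely and does not depend on the Hilbert basis. -/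
def opTrace [CompleteSpace E] (A : E →L[ℝ] E) : ℝ :=
  ∑' i, ⟪stdBasis E i, A (stdBasis E i)⟫

/-- The squared seminorm `‖w‖²_A = wᵀ A w`. -/
def sqNorm (A : E →L[ℝ] E) (w : E) : ℝ := ⟪w, A w⟫

/-- `A = ∑ᵢ λᵢ vᵢ vᵢᵀ` is the eigendecomposition of the positive operator `A`, with the eigenvalues
in non-increasing order. If `A` has finite rank, then the sequence of eigenvalues is continued by
zeros, and nothing is required of the corresponding vectors `vᵢ`. -/
structure IsEigendecomposition (A : E →L[ℝ] E) (lam : ℕ → ℝ) (v : ℕ → E) : Prop where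
  nonneg : ∀ i, 0 ≤ lam i
  antitone : Antitone lam
  orthonormal : Orthonormal ℝ (fun i : {i : ℕ // lam i ≠ 0} => v i)
  hasSum : ∀ w, HasSum (fun i => (lam i * ⟪v i, w⟫) • v i) (A w)

/-- The operator `∑_{i ≤ k} cᵢ vᵢ vᵢᵀ` over the first `k` eigenvectors. The sequences are indexed
from `0`, so the first `k` eigenvectors are `v 0, …, v (k - 1)`. -/
def headOp (c : ℕ → ℝ) (v : ℕ → E) (k : ℕ) : E →L[ℝ] E :=
  ∑ i ∈ Finset.range k, c i • rankOne ℝ (v i) (v i)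

/-- The operator `∑_{i > k} cᵢ vᵢ vᵢᵀ` over all eigenvectors after the first `k`. -/
def tailOp (c : ℕ → ℝ) (v : ℕ → E) (k : ℕ) : E →L[ℝ] E :=
  ∑' i, c (k + i) • rankOne ℝ (v (k + i)) (v (k + i))

/-- `max {k : λ_k ≥ τ}` for a non-increasing sequence of eigenvalues `λ_1 = lam 0, λ_2 = lam 1, …`
(and `0` if no eigenvalue is `≥ τ`). -/
def effectiveDim (lam : ℕ → ℝ) (τ : ℝ) : ℕ :=
  sSup {k : ℕ | ∀ i < k, τ ≤ lam i}

end Operators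

/-! ### Stochastic quantization -/

/-- A stochastic quantization operation on `V`: the quantized value of `u` is the random vector
`toFun s u`, where the random seed `s` is drawn from `law` independently of everything else. -/
structure Quantizer (V : Type*) [MeasurableSpace V] where
  Seed : Type
  [measurableSpaceSeed : MeasurableSpace Seed]
  law : Measure Seed
  [isProbabilityMeasure_law : IsProbabilityMeasure law]
  toFun : Seed → V → V
  measurable_toFun : Measurable (fun p : Seed × V => toFun p.1 p.2)

attribute [instance] Quantizer.measurableSpaceSeed Quantizer.isProbabilityMeasure_law

section Quantizers

variable {V : Type*} [NormedAddCommGroup V] [InnerProductSpace ℝ V] [MeasurableSpace V]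

/-- The quantization is unbiased: `𝔼[Q(u) | u] = u` for every `u`. -/
def Quantizer.IsUnbiased (Q : Quantizer V) : Prop :=
  ∀ u, Integrable (fun s => Q.toFun s u) Q.law ∧ ∫ s, Q.toFun s u ∂Q.law = u

/-- The quantization is `ε`-multiplicative: `𝔼[(Q(u) - u)(Q(u) - u)ᵀ | u] = ε u uᵀ` for every
`u`. -/
def Quantizer.IsMultiplicative (Q : Quantizer V) (ε : ℝ) : Prop :=
  ∀ u, MemLp (fun s => Q.toFun s u - u) 2 Q.law ∧
    secondMoment Q.law (fun s => Q.toFun s u - u) = ε • rankOne ℝ u u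

end Quantizers

variable {E : Type*} [NormedAddCommGroup E] [InnerProductSpace ℝ E] [MeasurableSpace E]
  {B : ℕ}

/-- The covariance `H = 𝔼[x xᵀ]`. -/
def covH (D : Measure (E × ℝ)) : E →L[ℝ] E := secondMoment D (fun z => z.1)

/-- The population risk `L(w) = ½ 𝔼[(y - ⟨w, x⟩)²]`. -/
def risk (D : Measure (E × ℝ)) (w : E) : ℝ := (1 / 2) * ∫ z, (z.2 - ⟪w, z.1⟫) ^ 2 ∂D

/-- The quantizers of data features (`d`), labels (`l`), parameters (`p`), activations (`a`) and
output gradients (`o`). Features and labels are quantized example by example, activations and output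
gradients as vectors in `ℝ^B`. -/
structure Quantizers (E : Type*) [MeasurableSpace E] (B : ℕ) where
  d : Quantizer E
  l : Quantizer ℝ
  p : Quantizer E
  a : Quantizer (EuclideanSpace ℝ (Fin B))
  o : Quantizer (EuclideanSpace ℝ (Fin B))

namespace Quantizers

variable (Q : Quantizers E B)

/-- All five quantizers are unbiased. -/
def IsUnbiased : Prop :=
  Q.d.IsUnbiased ∧ Q.l.IsUnbiased ∧ Q.p.IsUnbiased ∧ Q.a.IsUnbiased ∧ Q.o.IsUnbiased

/-- One example `(x, y)`, with the seeds of the quantizations of `x` and of `y`. -/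
abbrev Sample : Type _ := (E × ℝ) × (Q.d.Seed × Q.l.Seed)

/-- The law of an example: `(x, y) ∼ D`, with independent seeds. -/
def sampleLaw (D : Measure (E × ℝ)) : Measure Q.Sample := D.prod (Q.d.law.prod Q.l.law)

/-- The quantized feature vector `x^(q) = Q_d(x)`. -/
def xq (z : Q.Sample) : E := Q.d.toFun z.2.1 z.1.1

/-- The quantized label `y^(q) = Q_l(y)`. -/
def yq (z : Q.Sample) : ℝ := Q.l.toFun z.2.2 z.1.2

/-! ### The data model -/

/-- The covariance `H^(q) = 𝔼[x^(q) x^(q)ᵀ]` of the quantized features. -/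
def covHq (D : Measure (E × ℝ)) : E →L[ℝ] E := secondMoment (Q.sampleLaw D) Q.xq

/-- The risk `𝔼[(y^(q) - ⟨w, x^(q)⟩)²]` on quantized data. -/
def riskq (D : Measure (E × ℝ)) (w : E) : ℝ :=
  ∫ z, (Q.yq z - ⟪w, Q.xq z⟫) ^ 2 ∂(Q.sampleLaw D)

/-- The data have finite second moments: `tr H = 𝔼‖x‖²` and `tr H^(q) = 𝔼‖x^(q)‖²` are finite, and
so is `𝔼 y²`. -/
def FiniteCovariance (D : Measure (E × ℝ)) : Prop :=
  MemLp (fun z : E × ℝ => z.1) 2 D ∧ MemLp Q.xq 2 (Q.sampleLaw D) ∧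
    MemLp (fun z : E × ℝ => z.2) 2 D

/-- The fourth moment condition: the fourth moment of `x^(q)` is finite, and
`𝔼[x^(q) x^(q)ᵀ A x^(q) x^(q)ᵀ] ≼ α tr(H^(q) A) H^(q)` for every positive semidefinite `A`. -/
def FourthMoment [CompleteSpace E] (D : Measure (E × ℝ)) (α : ℝ) : Prop :=
  MemLp Q.xq 4 (Q.sampleLaw D) ∧
    ∀ A : E →L[ℝ] E, A.IsPositive →
      ∫ z, rankOne ℝ (Q.xq z) (Q.xq z) ∘L A ∘L rankOne ℝ (Q.xq z) (Q.xq z) ∂(Q.sampleLaw D) ≤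
        (α * opTrace (Q.covHq D ∘L A)) • Q.covHq D

/-- The noise condition: `𝔼[ξ² x^(q) x^(q)ᵀ] ≼ σ² H^(q)` for the noise
`ξ = y^(q) - ⟨wq, x^(q)⟩`. -/
def NoiseCondition (D : Measure (E × ℝ)) (wq : E) (σ : ℝ) : Prop :=
  MemLp (fun z => (Q.yq z - ⟪wq, Q.xq z⟫) • Q.xq z) 2 (Q.sampleLaw D) ∧
    ∫ z, (Q.yq z - ⟪wq, Q.xq z⟫) ^ 2 • rankOne ℝ (Q.xq z) (Q.xq z) ∂(Q.sampleLaw D) ≤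
      σ ^ 2 • Q.covHq D

/-! ### Quantized SGD -/

/-- The randomness of one iteration: `B` examples with the seeds of their quantizations, and the seeds
of the quantizations of the parameter, the activation and the output gradient. -/
abbrev Step : Type _ := (Fin B → Q.Sample) × (Q.p.Seed × Q.a.Seed × Q.o.Seed)

/-- The law of the randomness of one iteration: all components are independent. -/
def stepLaw (D : Measure (E × ℝ)) : Measure Q.Step :=
  (Measure.pi fun _ : Fin B => Q.sampleLaw D).prod (Q.p.law.prod (Q.a.law.prod Q.o.law))

/-- The activation `Q_d(X) Q_p(w) ∈ ℝ^B`. -/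
def activation (w : E) (z : Q.Step) : EuclideanSpace ℝ (Fin B) :=
  WithLp.toLp 2 fun i => ⟪Q.xq (z.1 i), Q.p.toFun z.2.1 w⟫

/-- The output gradient `Q_l(y) - Q_a(Q_d(X) Q_p(w)) ∈ ℝ^B`. -/
def outputGradient (w : E) (z : Q.Step) : EuclideanSpace ℝ (Fin B) :=
  WithLp.toLp 2 (fun i => Q.yq (z.1 i)) - Q.a.toFun z.2.2.1 (Q.activation w z)

/-- One iteration `w + γ (1/B) Q_d(X)ᵀ Q_o(Q_l(y) - Q_a(Q_d(X) Q_p(w)))`. -/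
def sgdStep (γ : ℝ) (w : E) (z : Q.Step) : E :=
  w + (γ * (1 / (B : ℝ))) •
    ∑ i, Q.o.toFun z.2.2.2 (Q.outputGradient w z) i • Q.xq (z.1 i)

/-- The iterates `w_t`, started at `w_0 = 0`; the step from `w_t` to `w_{t+1}` uses `z t`. -/
def iterate (γ : ℝ) (z : ℕ → Q.Step) : ℕ → E
  | 0 => 0
  | t + 1 => Q.sgdStep γ (iterate γ z t) (z t)

/-- The averaged iterate `(1/N) ∑_{t < N} w_t`. -/
def average (γ : ℝ) (N : ℕ) (z : ℕ → Q.Step) : E :=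
  (1 / (N : ℝ)) • ∑ t ∈ Finset.range N, Q.iterate γ z t

end Quantizers

/-- `C_ε = (1 + ε_d)(1 + 2ε_p + 4ε_o(1 + ε_a)(1 + ε_p) + 2ε_a(1 + ε_p))`. -/
def stepConst (εd εp εa εo : ℝ) : ℝ :=
  (1 + εd) * (1 + 2 * εp + 4 * εo * (1 + εa) * (1 + εp) + 2 * εa * (1 + εp))

end QuantizedSGD

end

open QuantizedSGD

set_option linter.unusedSectionVars false

namespace QuantizedSGD

/-! Write H_q and w_q for the covariance and the optimum on quantized data. Multiplicative
quantization of the features only rescales the covariance, H_q = (1 + ε_d) H (`covHq_eq_smul`), and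
unbiasedness gives H_q w_q = H w* (`covHq_optimum`). Hence H and H_q share eigenvectors, and ‖w_q -
w*‖²_H ≤ ε_d ‖w*‖²_H (`optimum_relations`), which is the approximation error.

The remaining error w_t - w_q is split by coupling: u_t is SGD run on the same quantized batches,
but with exact labels ⟨w_q, x⟩ and no further quantization. The bias part is u_t - w_q and the
variance part is w_t - u_t. Both have conditional mean contracted by I - γ H_q, and conditional
variance in direction a at most γ² ⟨a, H_q a⟩ s_t for a scalar noise level s_t, up to a term of mean
zero (`DriftProcess`). For the bias part, s_t is α times its own expected energy in the
H_q-seminorm. For the variance part, s_t collects its own energy, the energy of the bias part,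
‖w_q‖² in the H_q-seminorm, and σ²/B (`momentsLE_sgdStep`). The correlation of the noise ξ with the
features need not vanish, but it enters linearly in the variance part, whose mean is zero.

In an eigendirection v_i with eigenvalue μ_i of H_q the drift is multiplication by 1 - γ μ_i. With
G_i = ∑_{s < N} (1 - γ μ_i)^s, one scalar recursion, applied first to the energies and then to the
correlations with the running sum, bounds the second moment of ⟨v_i, ∑ V_t⟩ by 2 G_i² (⟨v_i, x₀⟩² +
γ² μ_i ∑ s_t) (`sq_sum_eigenvector_le`). Since G_i ≤ 1/(γ μ_i) and G_i ≤ N, using the first bound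
for i ≤ k and the second for i > k produces the head and tail terms (`geom_head_tail`). This works
for every cut k, in particular for k*.

It remains to bound ∑ s_t, which involves the unknown energies. `sum_quadratic_le` bounds the sum of
the energies by an initial term plus γ T ∑ s_t with T = tr H_q, and the stepsize condition says
exactly that γ α K T < 1 for K = C_ε / (1 + ε_d). The energies can thus be absorbed, at the price of
a single factor 1 / (1 - γ α K T) (`noise_le`). -/

/-! ### Moment bounds of real random variables -/

/-- `f` is square integrable with mean `m` and second moment at most `s`. -/
structure MomentsLE {Ω : Type*} [MeasurableSpace Ω] (f : Ω → ℝ) (μ : Measure Ω) (m s : ℝ) :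
    Prop where
  memLp : MemLp f 2 μ
  mean : ∫ ω, f ω ∂μ = m
  sq_le : ∫ ω, f ω ^ 2 ∂μ ≤ s

namespace MomentsLE

variable {Ω S T : Type*} [MeasurableSpace Ω] [MeasurableSpace S] [MeasurableSpace T]
  {μ : Measure Ω} {f : Ω → ℝ} {m s : ℝ}

theorem integrable [IsFiniteMeasure μ] (h : MomentsLE f μ m s) : Integrable f μ :=
  h.memLp.integrable (by norm_num)

theorem mono (h : MomentsLE f μ m s) {s' : ℝ} (hs : s ≤ s') : MomentsLE f μ m s' :=
  ⟨h.memLp, h.mean, h.sq_le.trans hs⟩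

theorem affine [IsProbabilityMeasure μ] (h : MomentsLE f μ m s) (r c : ℝ) :
    MomentsLE (fun ω => r + c * f ω) μ (r + c * m) (r ^ 2 + 2 * r * c * m + c ^ 2 * s) := by
  have hi := h.integrable
  have hsq := h.memLp.integrable_sq
  refine ⟨(memLp_const r).add (h.memLp.const_mul c), ?_, ?_⟩
  · rw [integral_add (integrable_const _) (hi.const_mul _), integral_const_mul, h.mean]
    simp
  · have : ∀ ω, (r + c * f ω) ^ 2 = r ^ 2 + 2 * r * c * f ω + c ^ 2 * f ω ^ 2 := fun ω => by ring
    simp_rw [this]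
    rw [integral_add (f := fun ω => r ^ 2 + 2 * r * c * f ω)
        ((integrable_const _).add (hi.const_mul _)) (hsq.const_mul _),
      integral_add (integrable_const _) (hi.const_mul _), integral_const_mul, integral_const_mul,
      h.mean]
    have := mul_le_mul_of_nonneg_left h.sq_le (sq_nonneg c)
    simpa using this

/-- Moment bounds on a product space from the moments of the sections. -/
theorem prod {μ : Measure S} {ν : Measure T} [IsProbabilityMeasure μ] [IsProbabilityMeasure ν]
    {f : S × T → ℝ} {ψ φ : S → ℝ} (hf : Measurable f)
    (h : ∀ a, MomentsLE (fun b => f (a, b)) ν (ψ a) (φ a)) (hφ : Integrable φ μ) :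
    MomentsLE f (μ.prod ν) (∫ a, ψ a ∂μ) (∫ a, φ a ∂μ) := by
  have hsq : Integrable (fun p => f p ^ 2) (μ.prod ν) := by
    rw [integrable_prod_iff (hf.pow_const 2).aestronglyMeasurable]
    refine ⟨.of_forall fun a => (h a).memLp.integrable_sq, ?_⟩
    refine hφ.mono' (hf.pow_const 2).norm.stronglyMeasurable.integral_prod_right.aestronglyMeasurable
      (.of_forall fun a => ?_)
    simp only [norm_pow, Real.norm_eq_abs, sq_abs]
    rw [abs_of_nonneg (integral_nonneg fun _ => sq_nonneg _)]
    exact (h a).sq_le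
  have hL : MemLp f 2 (μ.prod ν) :=
    (memLp_two_iff_integrable_sq hf.aestronglyMeasurable).2 hsq
  refine ⟨hL, ?_, ?_⟩
  · rw [integral_prod _ (hL.integrable (by norm_num))]
    simp_rw [fun a => (h a).mean]
  · rw [integral_prod _ hsq]
    exact integral_mono hsq.integral_prod_left hφ fun a => (h a).sq_le

/-- Moment bounds of a function of two independent random variables. -/
theorem comp_indep {P : Measure Ω} [IsProbabilityMeasure P] {ν : Measure T}
    [IsProbabilityMeasure ν] {X : Ω → S} {Z : Ω → T} (hX : Measurable X) (hZ : HasLaw Z ν P)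
    (hXZ : IndepFun X Z P) {f : S × T → ℝ} {ψ φ : S → ℝ} (hf : Measurable f)
    (h : ∀ a, MomentsLE (fun b => f (a, b)) ν (ψ a) (φ a)) (hψm : Measurable ψ)
    (hφm : Measurable φ) (hφ : Integrable (fun ω => φ (X ω)) P) :
    MomentsLE (fun ω => f (X ω, Z ω)) P (∫ ω, ψ (X ω) ∂P) (∫ ω, φ (X ω) ∂P) := by
  have : IsProbabilityMeasure (P.map X) := Measure.isProbabilityMeasure_map hX.aemeasurable
  have hmap : P.map (fun ω => (X ω, Z ω)) = (P.map X).prod ν := by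
    rw [hXZ.map_prod_eq_prod_map_map hX.aemeasurable hZ.aemeasurable, hZ.map_eq]
  have hpair : AEMeasurable (fun ω => (X ω, Z ω)) P := hX.aemeasurable.prodMk hZ.aemeasurable
  have hφ' : Integrable φ (P.map X) :=
    (integrable_map_measure hφm.aestronglyMeasurable hX.aemeasurable).2 hφ
  have key := MomentsLE.prod (μ := P.map X) hf h hφ'
  rw [integral_map hX.aemeasurable hψm.aestronglyMeasurable,
    integral_map hX.aemeasurable hφm.aestronglyMeasurable, ← hmap] at key
  refine ⟨?_, ?_, ?_⟩
  · exact (memLp_map_measure_iff hf.aestronglyMeasurable hpair).1 key.memLp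
  · rw [← key.mean, integral_map hpair hf.aestronglyMeasurable]
  · refine le_trans (le_of_eq ?_) key.sq_le
    rw [integral_map hpair (hf.pow_const 2).aestronglyMeasurable]

/-- A function of two independent random variables may be replaced by its conditional mean when
it is tested against a function of the first one. -/
theorem integral_mul_comp_indep {P : Measure Ω} [IsProbabilityMeasure P] {ν : Measure T}
    [IsProbabilityMeasure ν] {X : Ω → S} {Z : Ω → T} (hX : Measurable X) (hZ : HasLaw Z ν P)
    (hXZ : IndepFun X Z P) {f : S × T → ℝ} {ψ φ : S → ℝ} (hf : Measurable f)
    (h : ∀ a, MomentsLE (fun b => f (a, b)) ν (ψ a) (φ a)) (hψm : Measurable ψ)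
    (hφm : Measurable φ) (hφ : Integrable (fun ω => φ (X ω)) P)
    {G : S → ℝ} (hGm : Measurable G) (hG : MemLp (fun ω => G (X ω)) 2 P) :
    ∫ ω, G (X ω) * f (X ω, Z ω) ∂P = ∫ ω, G (X ω) * ψ (X ω) ∂P := by
  have : IsProbabilityMeasure (P.map X) := Measure.isProbabilityMeasure_map hX.aemeasurable
  have hmap : P.map (fun ω => (X ω, Z ω)) = (P.map X).prod ν := by
    rw [hXZ.map_prod_eq_prod_map_map hX.aemeasurable hZ.aemeasurable, hZ.map_eq]
  have hpair : AEMeasurable (fun ω => (X ω, Z ω)) P := hX.aemeasurable.prodMk hZ.aemeasurable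
  have hGf : Measurable (fun p : S × T => G p.1 * f p) := (hGm.comp measurable_fst).mul hf
  have hI : Integrable (fun p : S × T => G p.1 * f p) ((P.map X).prod ν) := by
    rw [← hmap, integrable_map_measure hGf.aestronglyMeasurable hpair]
    exact hG.integrable_mul (comp_indep hX hZ hXZ hf h hψm hφm hφ).memLp
  calc ∫ ω, G (X ω) * f (X ω, Z ω) ∂P
      = ∫ p, G p.1 * f p ∂((P.map X).prod ν) := by
        rw [← hmap, integral_map hpair hGf.aestronglyMeasurable]
    _ = ∫ a, G a * ψ a ∂(P.map X) := by
        rw [integral_prod _ hI]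
        congr with a
        simp only [integral_const_mul, (h a).mean]
    _ = _ := integral_map hX.aemeasurable (hGm.mul hψm).aestronglyMeasurable

/-- Affine functions of a sum of independent copies. -/
theorem pi_sum {ν : Measure T} [IsProbabilityMeasure ν] {f : T → ℝ} {m s : ℝ}
    (h : MomentsLE f ν m s) (B : ℕ) (r c : ℝ) :
    MomentsLE (fun z : Fin B → T => r + c * ∑ i, f (z i)) (Measure.pi fun _ => ν)
      (r + c * (B * m)) ((r + c * (B * m)) ^ 2 + c ^ 2 * (B * s)) := by
  have hcoord : ∀ i : Fin B, MemLp (fun z : Fin B → T => f (z i)) 2 (Measure.pi fun _ => ν) :=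
    fun i => h.memLp.comp_measurePreserving (measurePreserving_eval (fun _ => ν) i)
  have hL : MemLp (fun z : Fin B → T => ∑ i, f (z i)) 2 (Measure.pi fun _ => ν) :=
    memLp_finsetSum _ fun i _ => hcoord i
  have hmean : ∫ z : Fin B → T, ∑ i, f (z i) ∂(Measure.pi fun _ => ν) = B * m := by
    rw [integral_finsetSum _ fun i _ => (hcoord i).integrable (by norm_num)]
    have : ∀ i : Fin B, ∫ z : Fin B → T, f (z i) ∂(Measure.pi fun _ => ν) = m := fun i => by
      have hmp := measurePreserving_eval (fun _ : Fin B => ν) i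
      have := integral_map (μ := Measure.pi fun _ : Fin B => ν) hmp.measurable.aemeasurable
        (f := f) (by rw [hmp.map_eq]; exact h.memLp.aestronglyMeasurable)
      rw [hmp.map_eq, h.mean] at this
      exact this.symm
    simp [this]
  have hvar := variance_sum_pi (μ := fun _ : Fin B => ν) (X := fun _ => f) fun _ => h.memLp
  -- Variances of independent copies add, so apart from the squared mean the growth is linear in B;
  -- this is the source of σ²/B.
  have hv : ∫ z : Fin B → T, (∑ i, f (z i)) ^ 2 ∂(Measure.pi fun _ => ν) ≤
      (B * m) ^ 2 + B * s := by
    rw [variance_eq_sub (by simpa [Finset.sum_fn] using hL)] at hvar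
    have hle : Var[f; ν] ≤ s := (variance_le_expectation_sq h.memLp.aestronglyMeasurable).trans
      h.sq_le
    have h2 : (B : ℝ) * Var[f; ν] ≤ B * s := mul_le_mul_of_nonneg_left hle (Nat.cast_nonneg _)
    simp only [Pi.pow_apply, Finset.sum_apply, hmean, Finset.sum_const, Finset.card_univ,
      Fintype.card_fin, nsmul_eq_mul] at hvar
    linarith
  have := MomentsLE.affine ⟨hL, hmean, hv⟩ r c
  refine this.mono (le_of_eq ?_)
  ring

end MomentsLE

/-! ### Independence along a Markov chain -/

/-- The state at time t is a function of the Z j with j < t only, and the σ-algebra of these is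
independent of Z t. -/
theorem chain_measurable_indepFun {S T Ω : Type*} [MeasurableSpace S] [MeasurableSpace T]
    [MeasurableSpace Ω] {P : Measure Ω} [IsProbabilityMeasure P] {step : S × T → S}
    (hstep : Measurable step) {Z : ℕ → Ω → T} (hZ : ∀ t, Measurable (Z t)) (hind : iIndepFun Z P)
    {X : ℕ → Ω → S} (s₀ : S) (h0 : ∀ ω, X 0 ω = s₀) (hX : ∀ t ω, X (t + 1) ω = step (X t ω, Z t ω))
    (t : ℕ) : Measurable (X t) ∧ IndepFun (X t) (Z t) P := by
  have hle : ∀ t, MeasurableSpace.comap (Z t) inferInstance ≤ ‹MeasurableSpace Ω› :=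
    fun t => (hZ t).comap_le
  have hpast : ∀ t, Measurable[⨆ j ∈ Set.Iio t, MeasurableSpace.comap (Z j) inferInstance] (X t) := by
    intro t
    induction t with
    | zero =>
      rw [show X 0 = fun _ => s₀ from funext h0]
      exact measurable_const
    | succ t ih =>
      rw [show X (t + 1) = fun ω => step (X t ω, Z t ω) from funext (hX t)]
      refine hstep.comp (Measurable.prodMk ?_ ?_)
      · refine ih.mono ?_ le_rfl
        exact biSup_mono fun j hj => lt_trans hj (Nat.lt_succ_self t)
      · refine Measurable.mono (comap_measurable (Z t)) ?_ le_rfl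
        exact le_biSup (fun j => MeasurableSpace.comap (Z j) inferInstance)
          (show t ∈ Set.Iio (t + 1) from Nat.lt_succ_self t)
  have hple : (⨆ j ∈ Set.Iio t, MeasurableSpace.comap (Z j) inferInstance) ≤
      ‹MeasurableSpace Ω› := iSup₂_le fun j _ => hle j
  refine ⟨(hpast t).mono hple le_rfl, ?_⟩
  have hi := indep_iSup_of_disjoint hle hind (S := Set.Iio t) (T := {t}) (by simp)
  rw [IndepFun_iff_Indep]
  refine indep_of_indep_of_le_left (indep_of_indep_of_le_right hi ?_) (hpast t).comap_le
  simp

/-! ### A scalar recursion -/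

/-- Unrolling the recursion gives a truncated convolution of h with the powers of ρ, and h ≥ 0
allows it to be completed to the full product. No sign is needed for g, which later includes
correlations. -/
theorem sum_le_geom_mul_sum {ρ : ℝ} (hρ : 0 ≤ ρ) (N : ℕ) :
    ∀ (g h : ℕ → ℝ), (∀ t, 0 ≤ h t) → g 0 ≤ h 0 →
      (∀ t, g (t + 1) ≤ ρ * g t + h (t + 1)) →
      ∑ t ∈ Finset.range N, g t ≤ (∑ s ∈ Finset.range N, ρ ^ s) * ∑ t ∈ Finset.range N, h t := by
  induction N with
  | zero => simp
  | succ N ih =>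
    intro g h hh h0 hs
    have hih := ih g h hh h0 hs
    have h1 : ∑ t ∈ Finset.range N, g (t + 1) ≤
        ρ * ∑ t ∈ Finset.range N, g t + ∑ t ∈ Finset.range N, h (t + 1) := by
      rw [Finset.mul_sum, ← Finset.sum_add_distrib]
      exact Finset.sum_le_sum fun t _ => hs t
    have h2 : ∑ t ∈ Finset.range (N + 1), h t = ∑ t ∈ Finset.range N, h (t + 1) + h 0 :=
      Finset.sum_range_succ' _ _
    have h3 : ∑ t ∈ Finset.range N, h t ≤ ∑ t ∈ Finset.range (N + 1), h t :=
      Finset.sum_le_sum_of_subset_of_nonneg (Finset.range_mono (Nat.le_succ N)) fun t _ _ => hh t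
    have h4 : ∑ s ∈ Finset.range (N + 1), ρ ^ s = ρ * ∑ s ∈ Finset.range N, ρ ^ s + 1 := by
      rw [Finset.sum_range_succ', Finset.mul_sum]
      simp [pow_succ, mul_comm]
    have hG : 0 ≤ ∑ s ∈ Finset.range N, ρ ^ s := Finset.sum_nonneg fun _ _ => pow_nonneg hρ _
    rw [Finset.sum_range_succ' g, h4]
    have h5 := mul_le_mul_of_nonneg_left (hih.trans (mul_le_mul_of_nonneg_left h3 hG)) hρ
    linarith

/-! ### Second moment operators -/

section SecondMoment

variable {E : Type*} [NormedAddCommGroup E] [InnerProductSpace ℝ E]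
  {Ω : Type*} [MeasurableSpace Ω] {μ : Measure Ω} {X : Ω → E}

theorem continuous_rankOne_self : Continuous fun x : E => rankOne ℝ x x := by
  simp_rw [rankOne_def']
  have h1 : Continuous fun x : E => ContinuousLinearMap.toSpanSingleton ℝ x :=
    (ContinuousLinearMap.toSpanSingletonCLE (𝕜 := ℝ) (E := E)).continuous
  exact h1.clm_comp (innerSL ℝ).continuous

theorem memLp_inner {p : ENNReal} (hX : MemLp X p μ) (a : E) : MemLp (fun ω => ⟪a, X ω⟫) p μ :=
  hX.const_inner a

theorem memLp_inner' {p : ENNReal} (hX : MemLp X p μ) (a : E) : MemLp (fun ω => ⟪X ω, a⟫) p μ :=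
  hX.inner_const a

theorem integrable_mul_of_memLp {f g : Ω → ℝ} (hf : MemLp f 2 μ) (hg : MemLp g 2 μ) :
    Integrable (fun ω => f ω * g ω) μ := hf.integrable_mul hg

theorem integrable_rankOne_self (hX : MemLp X 2 μ) :
    Integrable (fun ω => rankOne ℝ (X ω) (X ω)) μ := by
  refine (hX.integrable_norm_pow (by norm_num)).mono'
    (continuous_rankOne_self.comp_aestronglyMeasurable hX.aestronglyMeasurable)
    (.of_forall fun ω => ?_)
  simp [pow_two]

variable [CompleteSpace E]

theorem inner_integral_operator {T : Ω → E →L[ℝ] E} (hT : Integrable T μ) (a b : E) :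
    ⟪a, (∫ ω, T ω ∂μ) b⟫ = ∫ ω, ⟪a, T ω b⟫ ∂μ := by
  rw [ContinuousLinearMap.integral_apply hT, ← integral_inner (hT.apply_continuousLinearMap b)]

theorem inner_secondMoment (hX : MemLp X 2 μ) (a b : E) :
    ⟪a, secondMoment μ X b⟫ = ∫ ω, ⟪a, X ω⟫ * ⟪X ω, b⟫ ∂μ := by
  rw [secondMoment, inner_integral_operator (integrable_rankOne_self hX)]
  congr with ω
  simp [inner_smul_right, mul_comm]

theorem inner_secondMoment_self (hX : MemLp X 2 μ) (a : E) :
    ⟪a, secondMoment μ X a⟫ = ∫ ω, ⟪a, X ω⟫ ^ 2 ∂μ := by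
  rw [inner_secondMoment hX]
  congr with ω
  rw [real_inner_comm a, pow_two]

theorem inner_secondMoment_comm (hX : MemLp X 2 μ) (a b : E) :
    ⟪a, secondMoment μ X b⟫ = ⟪secondMoment μ X a, b⟫ := by
  rw [real_inner_comm b, inner_secondMoment hX, inner_secondMoment hX]
  congr with ω
  rw [real_inner_comm a, real_inner_comm b, mul_comm]

theorem inner_secondMoment_self_nonneg (hX : MemLp X 2 μ) (a : E) :
    0 ≤ ⟪a, secondMoment μ X a⟫ := by
  rw [inner_secondMoment_self hX]
  exact integral_nonneg fun _ => sq_nonneg _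

/-- The trace of `A ∘ a aᵀ`. -/
theorem opTrace_comp_rankOne (A : E →L[ℝ] E) (a : E) :
    opTrace (A ∘L rankOne ℝ a a) = ⟪a, A a⟫ := by
  rw [opTrace, ← (stdBasis E).tsum_inner_mul_inner a (A a)]
  congr with i
  simp [inner_smul_right]

end SecondMoment

/-! ### Least squares -/

section LeastSquares

variable {E : Type*} [NormedAddCommGroup E] [InnerProductSpace ℝ E]
  {Ω : Type*} [MeasurableSpace Ω] {μ : Measure Ω} {X : Ω → E} {Y : Ω → ℝ}

theorem memLp_residual (hX : MemLp X 2 μ) (hY : MemLp Y 2 μ) (w : E) :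
    MemLp (fun ω => Y ω - ⟪w, X ω⟫) 2 μ := hY.sub (memLp_inner hX w)

theorem integral_residual_add_sq (hX : MemLp X 2 μ) (hY : MemLp Y 2 μ) (w a : E) :
    ∫ ω, (Y ω - ⟪w + a, X ω⟫) ^ 2 ∂μ = ∫ ω, (Y ω - ⟪w, X ω⟫) ^ 2 ∂μ
      - 2 * ∫ ω, (Y ω - ⟪w, X ω⟫) * ⟪X ω, a⟫ ∂μ + ∫ ω, ⟪a, X ω⟫ ^ 2 ∂μ := by
  have h1 := (memLp_residual hX hY w).integrable_sq
  have h2 : Integrable (fun ω => (Y ω - ⟪w, X ω⟫) * ⟪X ω, a⟫) μ :=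
    (memLp_residual hX hY w).integrable_mul (memLp_inner' hX a)
  have h3 := (memLp_inner hX a).integrable_sq
  have h12 : Integrable (fun ω => (Y ω - ⟪w, X ω⟫) ^ 2 - 2 * ((Y ω - ⟪w, X ω⟫) * ⟪X ω, a⟫)) μ :=
    h1.sub (h2.const_mul 2)
  rw [← integral_const_mul, ← integral_sub h1 (h2.const_mul 2), ← integral_add h12 h3]
  congr with ω
  rw [inner_add_left, real_inner_comm a]
  ring

theorem eq_zero_of_forall_quadratic_nonneg {b c : ℝ} (h : ∀ t : ℝ, 0 ≤ c * t ^ 2 - 2 * b * t) :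
    b = 0 := by
  -- The minimizer b / c, with the denominator enlarged so that it is positive for every real c.
  have h2 := h (b / (|c| + 1))
  have hc : 0 < |c| + 1 := by positivity
  have : c * (b / (|c| + 1)) ^ 2 - 2 * b * (b / (|c| + 1)) =
      (b / (|c| + 1)) ^ 2 * (c - 2 * (|c| + 1)) := by
    field_simp
  rw [this] at h2
  have h3 : c - 2 * (|c| + 1) < 0 := by linarith [le_abs_self c, abs_nonneg c]
  by_contra hb
  have h4 : 0 < (b / (|c| + 1)) ^ 2 := by positivity
  nlinarith

/-- Along the line w₀ + t a the risk is a quadratic polynomial in t with its minimum at t = 0, so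
its linear coefficient vanishes. -/
theorem normal_equation (hX : MemLp X 2 μ) (hY : MemLp Y 2 μ) {w₀ : E}
    (hmin : ∀ w, ∫ ω, (Y ω - ⟪w₀, X ω⟫) ^ 2 ∂μ ≤ ∫ ω, (Y ω - ⟪w, X ω⟫) ^ 2 ∂μ) (a : E) :
    ∫ ω, (Y ω - ⟪w₀, X ω⟫) * ⟪X ω, a⟫ ∂μ = 0 := by
  refine eq_zero_of_forall_quadratic_nonneg (c := ∫ ω, ⟪a, X ω⟫ ^ 2 ∂μ) fun t => ?_
  have h := hmin (w₀ + t • a)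
  rw [integral_residual_add_sq hX hY] at h
  simp only [inner_smul_left, inner_smul_right, conj_trivial, mul_pow, mul_left_comm _ t] at h
  rw [integral_const_mul, integral_const_mul] at h
  linarith

end LeastSquares

/-! ### Moments of a quantizer -/

section Quantizer

variable {V : Type*} [NormedAddCommGroup V] [InnerProductSpace ℝ V] [MeasurableSpace V]
  [CompleteSpace V] {Q : Quantizer V} {ε : ℝ}

/-- Unbiasedness removes the mixed terms, and the covariance ε u uᵀ has the same shape as the
squared mean. A linear functional of Q(u) therefore has second moments depending on u only through
that functional, which lets the bounds pass through nested quantizers. -/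
theorem Quantizer.integral_inner_mul_inner (hu : Q.IsUnbiased) (hm : Q.IsMultiplicative ε)
    (u a b : V) :
    ∫ s, ⟪a, Q.toFun s u⟫ * ⟪Q.toFun s u, b⟫ ∂Q.law = (1 + ε) * (⟪a, u⟫ * ⟪u, b⟫) := by
  obtain ⟨hL, hS⟩ := hm u
  have h1 := inner_secondMoment hL a b
  rw [hS] at h1
  have hi : ∀ c : V, ∫ s, ⟪c, Q.toFun s u - u⟫ ∂Q.law = 0 := fun c => by
    rw [integral_inner (hL.integrable (by norm_num)), integral_sub (hu u).1 (integrable_const _),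
      (hu u).2]
    simp
  have hI : ∀ c : V, Integrable (fun s => ⟪c, Q.toFun s u - u⟫) Q.law := fun c =>
    (memLp_inner hL c).integrable (by norm_num)
  have hP : Integrable (fun s => ⟪a, Q.toFun s u - u⟫ * ⟪Q.toFun s u - u, b⟫) Q.law :=
    (memLp_inner hL a).integrable_mul (memLp_inner' hL b)
  have h2 : ∀ s, ⟪a, Q.toFun s u⟫ * ⟪Q.toFun s u, b⟫ =
      ⟪a, Q.toFun s u - u⟫ * ⟪Q.toFun s u - u, b⟫ + (⟪a, u⟫ * ⟪b, Q.toFun s u - u⟫ +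
        (⟪u, b⟫ * ⟪a, Q.toFun s u - u⟫ + ⟪a, u⟫ * ⟪u, b⟫)) := fun s => by
    rw [real_inner_comm _ b]
    simp only [inner_sub_left, inner_sub_right]
    ring
  have hA : Integrable (fun s => ⟪u, b⟫ * ⟪a, Q.toFun s u - u⟫ + ⟪a, u⟫ * ⟪u, b⟫) Q.law :=
    ((hI a).const_mul _).add (integrable_const _)
  have hB : Integrable (fun s => ⟪a, u⟫ * ⟪b, Q.toFun s u - u⟫ +
      (⟪u, b⟫ * ⟪a, Q.toFun s u - u⟫ + ⟪a, u⟫ * ⟪u, b⟫)) Q.law := ((hI b).const_mul _).add hA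
  simp_rw [h2]
  rw [integral_add hP hB, integral_add ((hI b).const_mul _) hA,
    integral_add ((hI a).const_mul _) (integrable_const _), integral_const_mul, integral_const_mul,
    hi, hi, ← h1]
  simp [inner_smul_right]
  ring

theorem Quantizer.momentsLE (hu : Q.IsUnbiased) (hm : Q.IsMultiplicative ε) (u c : V) :
    MomentsLE (fun s => ⟪c, Q.toFun s u⟫) Q.law ⟪c, u⟫ ((1 + ε) * ⟪c, u⟫ ^ 2) := by
  have hL : MemLp (fun s => Q.toFun s u) 2 Q.law := by
    have := (hm u).1.add (memLp_const u)
    refine this.congr_norm (this.aestronglyMeasurable.congr ?_) ?_ <;>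
    exact .of_forall fun s => by simp
  refine ⟨memLp_inner hL c, ?_, le_of_eq ?_⟩
  · rw [integral_inner (hu u).1, (hu u).2]
  · rw [pow_two ⟪c, u⟫]
    conv_rhs => rw [← real_inner_comm c u]
    have := Q.integral_inner_mul_inner hu hm u c c
    simp_rw [real_inner_comm c, ← pow_two] at this
    rw [this, real_inner_comm c, pow_two]

end Quantizer

/-! ### Quantized data: covariance, optimum and moments of one sample -/

namespace Quantizers

section Measurable

variable {E : Type*} [MeasurableSpace E] {B : ℕ} (Q : Quantizers E B)

theorem measurable_xq : Measurable Q.xq :=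
  Q.d.measurable_toFun.comp (measurable_snd.fst.prodMk measurable_fst.fst)

theorem measurable_yq : Measurable Q.yq :=
  Q.l.measurable_toFun.comp (measurable_snd.snd.prodMk measurable_fst.snd)

end Measurable

variable {E : Type*} [NormedAddCommGroup E] [InnerProductSpace ℝ E] [CompleteSpace E]
  [MeasurableSpace E] {B : ℕ} {Q : Quantizers E B} {D : Measure (E × ℝ)} [IsProbabilityMeasure D]

instance isProbabilityMeasure_sampleLaw : IsProbabilityMeasure (Q.sampleLaw D) := by
  unfold sampleLaw; infer_instance

instance isProbabilityMeasure_stepLaw : IsProbabilityMeasure (Q.stepLaw D) := by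
  unfold stepLaw; infer_instance

theorem memLp_yq {εl : ℝ} (hu : Q.l.IsUnbiased) (hm : Q.l.IsMultiplicative εl)
    (hy : MemLp (fun z : E × ℝ => z.2) 2 D) : MemLp Q.yq 2 (Q.sampleLaw D) := by
  have hsec : ∀ z : E × ℝ, MomentsLE (fun s : Q.d.Seed × Q.l.Seed => Q.yq (z, s))
      (Q.d.law.prod Q.l.law) z.2 ((1 + εl) * z.2 ^ 2) := fun z => by
    have h := Q.l.momentsLE hu hm z.2 1
    simp only [RCLike.inner_apply, conj_trivial, mul_one] at h
    have hp := measurePreserving_snd (μ := Q.d.law) (ν := Q.l.law)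
    refine ⟨h.memLp.comp_measurePreserving hp, ?_, ?_⟩
    · have := integral_fun_snd (μ := Q.d.law) (ν := Q.l.law) (fun s => Q.l.toFun s z.2)
      simpa [h.mean, yq] using this
    · have := integral_fun_snd (μ := Q.d.law) (ν := Q.l.law) (fun s => Q.l.toFun s z.2 ^ 2)
      refine le_trans (le_of_eq ?_) h.sq_le
      simpa [yq] using this
  exact (MomentsLE.prod Q.measurable_yq hsec (hy.integrable_sq.const_mul _)).memLp

/-- The covariance of the quantized features is `H^(q) = (1 + ε_d) H`. -/
theorem inner_covHq {εd : ℝ} (hD : Q.FiniteCovariance D) (hu : Q.d.IsUnbiased)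
    (hm : Q.d.IsMultiplicative εd) (a b : E) :
    ⟪a, Q.covHq D b⟫ = (1 + εd) * ⟪a, covH D b⟫ := by
  rw [covHq, covH, inner_secondMoment hD.2.1, inner_secondMoment hD.1, sampleLaw,
    integral_prod _ (integrable_mul_of_memLp (memLp_inner hD.2.1 a) (memLp_inner' hD.2.1 b)),
    ← integral_const_mul]
  congr with z
  have := integral_fun_fst (μ := Q.d.law) (ν := Q.l.law)
    (fun s => ⟪a, Q.d.toFun s z.1⟫ * ⟪Q.d.toFun s z.1, b⟫)
  rw [Q.d.integral_inner_mul_inner hu hm] at this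
  simpa [xq] using this

theorem covHq_eq_smul {εd : ℝ} (hD : Q.FiniteCovariance D) (hu : Q.d.IsUnbiased)
    (hm : Q.d.IsMultiplicative εd) : Q.covHq D = (1 + εd) • covH D := by
  ext b
  refine ext_inner_left ℝ fun a => ?_
  rw [inner_covHq hD hu hm]
  simp [inner_smul_right]

theorem integral_yq_mul_inner_xq (hD : Q.FiniteCovariance D) (hy : MemLp Q.yq 2 (Q.sampleLaw D))
    (hd : Q.d.IsUnbiased) (hl : Q.l.IsUnbiased) (a : E) :
    ∫ z, Q.yq z * ⟪Q.xq z, a⟫ ∂(Q.sampleLaw D) = ∫ z, z.2 * ⟪z.1, a⟫ ∂D := by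
  rw [sampleLaw, integral_prod _ (integrable_mul_of_memLp hy (memLp_inner' hD.2.1 a))]
  congr with z
  have h1 : ∫ s, ⟪Q.d.toFun s z.1, a⟫ ∂Q.d.law = ⟪z.1, a⟫ := by
    simp_rw [real_inner_comm a]
    rw [integral_inner (hd z.1).1, (hd z.1).2]
  have h2 := integral_prod_mul (μ := Q.d.law) (ν := Q.l.law)
    (fun s => ⟪Q.d.toFun s z.1, a⟫) (fun s => Q.l.toFun s z.2)
  rw [h1, (hl z.2).2] at h2
  rw [mul_comm, ← h2]
  congr with s
  rw [mul_comm]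
  rfl

/-- The optima on raw and on quantized data satisfy `H^(q) w^(q)* = H w*`. -/
theorem covHq_optimum (hD : Q.FiniteCovariance D) (hy : MemLp Q.yq 2 (Q.sampleLaw D))
    (hd : Q.d.IsUnbiased) (hl : Q.l.IsUnbiased) {wstar wqstar : E}
    (h : ∀ w, risk D wstar ≤ risk D w) (hq : ∀ w, Q.riskq D wqstar ≤ Q.riskq D w) :
    Q.covHq D wqstar = covH D wstar := by
  refine ext_inner_left ℝ fun a => ?_
  -- The normal equations express H w* and H_q w_q through 𝔼[y x] and its quantized analogue; these
  -- agree because the seeds of feature and label are independent and both quantizers are unbiased.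
  have h1 := normal_equation hD.1 hD.2.2 (w₀ := wstar)
    (fun w => by simpa [risk] using h w) a
  have h2 := normal_equation hD.2.1 hy (w₀ := wqstar) hq a
  have e1 : ∫ z : E × ℝ, (z.2 - ⟪wstar, z.1⟫) * ⟪z.1, a⟫ ∂D =
      ∫ z, z.2 * ⟪z.1, a⟫ ∂D - ⟪wstar, covH D a⟫ := by
    rw [covH, inner_secondMoment hD.1, ← integral_sub (integrable_mul_of_memLp hD.2.2 (memLp_inner' hD.1 a))
      (integrable_mul_of_memLp (memLp_inner hD.1 _) (memLp_inner' hD.1 a))]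
    congr with z
    ring
  have e2 : ∫ z, (Q.yq z - ⟪wqstar, Q.xq z⟫) * ⟪Q.xq z, a⟫ ∂(Q.sampleLaw D) =
      ∫ z, Q.yq z * ⟪Q.xq z, a⟫ ∂(Q.sampleLaw D) - ⟪wqstar, Q.covHq D a⟫ := by
    rw [covHq, inner_secondMoment hD.2.1, ← integral_sub (integrable_mul_of_memLp hy (memLp_inner' hD.2.1 a))
      (integrable_mul_of_memLp (memLp_inner hD.2.1 _) (memLp_inner' hD.2.1 a))]
    congr with z
    ring
  rw [integral_yq_mul_inner_xq hD hy hd hl] at e2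
  have s1 : ⟪a, covH D wstar⟫ = ⟪wstar, covH D a⟫ := by
    rw [covH, inner_secondMoment_comm hD.1, real_inner_comm]
  have s2 : ⟪a, Q.covHq D wqstar⟫ = ⟪wqstar, Q.covHq D a⟫ := by
    rw [covHq, inner_secondMoment_comm hD.2.1, real_inner_comm]
  linarith

/-- The excess risk is `½ ‖w - w*‖²_H`. -/
theorem risk_sub_risk (hD : Q.FiniteCovariance D) {wstar : E}
    (h : ∀ w, risk D wstar ≤ risk D w) (w : E) :
    risk D w - risk D wstar = 1 / 2 * ⟪w - wstar, covH D (w - wstar)⟫ := by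
  have h1 := normal_equation hD.1 hD.2.2 (w₀ := wstar)
    (fun w => by simpa [risk] using h w) (w - wstar)
  have h2 := integral_residual_add_sq hD.1 hD.2.2 wstar (w - wstar)
  rw [add_sub_cancel] at h2
  rw [risk, risk, h2, h1, covH, inner_secondMoment_self hD.1]
  ring

variable (Q) in
/-- The moments of the quantized features `x` and of the noise `ξ = y - ⟨w₀, x⟩` that enter the
analysis of one iteration. -/
structure SampleMoments (D : Measure (E × ℝ)) (w₀ : E) (α σ : ℝ) : Prop where
  feature : ∀ a b, MomentsLE (fun z => ⟪a, Q.xq z⟫ * ⟪Q.xq z, b⟫) (Q.sampleLaw D)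
    ⟪a, Q.covHq D b⟫ (α * (⟪a, Q.covHq D a⟫ * ⟪b, Q.covHq D b⟫))
  noise : ∀ a, MomentsLE (fun z => (Q.yq z - ⟪w₀, Q.xq z⟫) * ⟪a, Q.xq z⟫) (Q.sampleLaw D)
    0 (σ ^ 2 * ⟪a, Q.covHq D a⟫)
  correlation : ∀ a, ∃ g : E, ∀ b,
    ∫ z, ((Q.yq z - ⟪w₀, Q.xq z⟫) * ⟪a, Q.xq z⟫) * (⟪a, Q.xq z⟫ * ⟪Q.xq z, b⟫) ∂(Q.sampleLaw D) =
      ⟪g, b⟫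

theorem sampleMoments (hD : Q.FiniteCovariance D) (hy : MemLp Q.yq 2 (Q.sampleLaw D)) {w₀ : E}
    {α σ : ℝ} (hq : ∀ w, Q.riskq D w₀ ≤ Q.riskq D w) (hα : Q.FourthMoment D α)
    (hσ : Q.NoiseCondition D w₀ σ) : Q.SampleMoments D w₀ α σ := by
  obtain ⟨h4, hA⟩ := hα
  obtain ⟨hN, hNle⟩ := hσ
  have hxm := hD.2.1.aestronglyMeasurable
  have h442 : ENNReal.HolderTriple 4 4 2 :=
    .of_toReal ⟨by norm_num, by norm_num, by norm_num⟩
  have hprod : ∀ a b, MemLp (fun z => ⟪a, Q.xq z⟫ * ⟪Q.xq z, b⟫) 2 (Q.sampleLaw D) := fun a b =>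
    (memLp_inner' h4 b).mul (memLp_inner h4 a)
  have hnoise : ∀ a, MemLp (fun z => (Q.yq z - ⟪w₀, Q.xq z⟫) * ⟪a, Q.xq z⟫) 2 (Q.sampleLaw D) :=
    fun a => by simpa [inner_smul_right] using memLp_inner hN a
  refine ⟨fun a b => ⟨hprod a b, (inner_secondMoment hD.2.1 a b).symm, ?_⟩,
    fun a => ⟨hnoise a, ?_, ?_⟩, fun a => ?_⟩
  · have hI : Integrable (fun z => rankOne ℝ (Q.xq z) (Q.xq z) ∘L rankOne ℝ b b ∘L
        rankOne ℝ (Q.xq z) (Q.xq z)) (Q.sampleLaw D) := by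
      refine ((h4.integrable_norm_pow (by norm_num)).const_mul (‖b‖ * ‖b‖)).mono' ?_
        (.of_forall fun z => ?_)
      · have hc : Continuous fun x : E => rankOne ℝ x x ∘L rankOne ℝ b b ∘L rankOne ℝ x x :=
          continuous_rankOne_self.clm_comp (continuous_const.clm_comp continuous_rankOne_self)
        exact hc.comp_aestronglyMeasurable hxm
      · refine (ContinuousLinearMap.opNorm_comp_le _ _).trans ?_
        refine (mul_le_mul_of_nonneg_left (ContinuousLinearMap.opNorm_comp_le _ _)
          (norm_nonneg _)).trans (le_of_eq ?_)
        simp only [norm_rankOne]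
        ring
    -- Only A = b bᵀ is needed: tested on a, the left side is 𝔼[⟨a, x⟩² ⟨x, b⟩²], and tr(H_q b bᵀ) =
    -- ⟨b, H_q b⟩.
    have h1 := ((ContinuousLinearMap.le_def _ _).1 (hA (rankOne ℝ b b)
      (isPositive_rankOne_self b))).inner_nonneg_right a
    rw [sub_apply, inner_sub_right, inner_integral_operator hI,
      opTrace_comp_rankOne] at h1
    simp only [smul_apply, inner_smul_right, ContinuousLinearMap.comp_apply,
      rankOne_apply] at h1
    refine le_trans (le_of_eq ?_) (le_trans (sub_nonneg.1 h1) (le_of_eq (by ring)))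
    congr with z
    rw [real_inner_comm (Q.xq z) a, real_inner_comm b (Q.xq z)]
    ring
  · have := normal_equation hD.2.1 hy hq a
    simpa only [real_inner_comm a] using this
  · have hI : Integrable (fun z => (Q.yq z - ⟪w₀, Q.xq z⟫) ^ 2 • rankOne ℝ (Q.xq z) (Q.xq z))
        (Q.sampleLaw D) := by
      refine (integrable_rankOne_self hN).congr (.of_forall fun z => ?_)
      simp [smul_smul, pow_two]
    have h1 := ((ContinuousLinearMap.le_def _ _).1 hNle).inner_nonneg_right a
    rw [sub_apply, inner_sub_right, inner_integral_operator hI] at h1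
    simp only [smul_apply, inner_smul_right, rankOne_apply] at h1
    refine le_trans (le_of_eq ?_) (sub_nonneg.1 h1)
    congr with z
    rw [real_inner_comm (Q.xq z) a]
    ring
  -- The representing vector is g = 𝔼[⟨a, x⟩² ξ x], a Bochner integral of a product of two square
  -- integrable factors.
  · have hI : Integrable (fun z => ⟪a, Q.xq z⟫ ^ 2 •
        ((Q.yq z - ⟪w₀, Q.xq z⟫) • Q.xq z)) (Q.sampleLaw D) := by
      have h2 : MemLp (fun z => ⟪a, Q.xq z⟫ ^ 2) 2 (Q.sampleLaw D) := by
        simpa only [real_inner_comm a, pow_two] using hprod a a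
      exact memLp_one_iff_integrable.1 (hN.smul h2)
    refine ⟨∫ z, ⟪a, Q.xq z⟫ ^ 2 • ((Q.yq z - ⟪w₀, Q.xq z⟫) • Q.xq z) ∂(Q.sampleLaw D),
      fun b => ?_⟩
    rw [real_inner_comm, ← integral_inner hI]
    congr with z
    rw [inner_smul_right, inner_smul_right, real_inner_comm b]
    ring

end Quantizers

/-- Cauchy–Schwarz, with no gain from independence. It serves the feature sums, whose mean is in
general nonzero, so that order B² is unavoidable. -/
theorem MomentsLE.pi_sum_sq_le {T : Type*} [MeasurableSpace T] {ν : Measure T}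
    [IsProbabilityMeasure ν] {f : T → ℝ} {m s : ℝ} (h : MomentsLE f ν m s) (B : ℕ) :
    MomentsLE (fun z : Fin B → T => ∑ i, f (z i)) (Measure.pi fun _ => ν) (B * m) (B ^ 2 * s) := by
  have h1 := h.pi_sum B 0 1
  simp only [zero_add, one_mul] at h1
  refine ⟨h1.memLp, h1.mean, ?_⟩
  have hcoord : ∀ i : Fin B, Integrable (fun z : Fin B → T => f (z i) ^ 2)
      (Measure.pi fun _ => ν) := fun i =>
    (h.memLp.comp_measurePreserving (measurePreserving_eval (fun _ => ν) i)).integrable_sq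
  have hval : ∀ i : Fin B, ∫ z : Fin B → T, f (z i) ^ 2 ∂(Measure.pi fun _ => ν) =
      ∫ z, f z ^ 2 ∂ν := fun i => by
    have hmp := measurePreserving_eval (fun _ : Fin B => ν) i
    have := integral_map (μ := Measure.pi fun _ : Fin B => ν) hmp.measurable.aemeasurable
      (f := fun z => f z ^ 2) (by rw [hmp.map_eq]; exact h.memLp.aestronglyMeasurable.pow 2)
    rw [hmp.map_eq] at this
    exact this.symm
  calc ∫ z : Fin B → T, (∑ i, f (z i)) ^ 2 ∂(Measure.pi fun _ => ν)
      ≤ ∫ z : Fin B → T, B * ∑ i, f (z i) ^ 2 ∂(Measure.pi fun _ => ν) := by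
        refine integral_mono h1.memLp.integrable_sq
          ((integrable_finsetSum _ fun i _ => hcoord i).const_mul _) fun z => ?_
        simpa using sq_sum_le_card_mul_sum_sq (s := (Finset.univ : Finset (Fin B)))
          (f := fun i => f (z i))
    _ = B ^ 2 * ∫ z, f z ^ 2 ∂ν := by
        rw [integral_const_mul, integral_finsetSum _ fun i _ => hcoord i]
        simp [hval]
        ring
    _ ≤ _ := mul_le_mul_of_nonneg_left h.sq_le (by positivity)

/-! ### One iteration: the noiseless step and the quantization noise -/

namespace Quantizers

variable {E : Type*} [NormedAddCommGroup E] [InnerProductSpace ℝ E]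
  [MeasurableSpace E] {B : ℕ}

/-- One iteration of SGD on the quantized data without label noise and without quantization of the
parameters, activations and output gradients. -/
noncomputable def noiselessStep (Q : Quantizers E B) (γ : ℝ) (w₀ u : E) (d : Fin B → Q.Sample) : E :=
  u + (γ * (1 / (B : ℝ))) • ∑ i, ⟪Q.xq (d i), w₀ - u⟫ • Q.xq (d i)

section Measurability

variable [BorelSpace E] [SecondCountableTopology E] (Q : Quantizers E B)

theorem measurable_sgdStep (γ : ℝ) : Measurable fun p : E × Q.Step => Q.sgdStep γ p.1 p.2 := by
  have hx : ∀ i, Measurable fun p : E × Q.Step => Q.xq (p.2.1 i) := fun i =>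
    Q.measurable_xq.comp ((measurable_pi_apply i).comp measurable_snd.fst)
  have hy : ∀ i, Measurable fun p : E × Q.Step => Q.yq (p.2.1 i) := fun i =>
    Q.measurable_yq.comp ((measurable_pi_apply i).comp measurable_snd.fst)
  have hp : Measurable fun p : E × Q.Step => Q.p.toFun p.2.2.1 p.1 :=
    Q.p.measurable_toFun.comp (measurable_snd.snd.fst.prodMk measurable_fst)
  have hact : Measurable fun p : E × Q.Step => Q.activation p.1 p.2 :=
    (WithLp.measurable_toLp 2 _).comp (measurable_pi_lambda _ fun i => (hx i).inner hp)
  have ha : Measurable fun p : E × Q.Step => Q.a.toFun p.2.2.2.1 (Q.activation p.1 p.2) :=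
    Q.a.measurable_toFun.comp (measurable_snd.snd.snd.fst.prodMk hact)
  have hg : Measurable fun p : E × Q.Step => Q.outputGradient p.1 p.2 :=
    ((WithLp.measurable_toLp 2 _).comp (measurable_pi_lambda _ hy)).sub ha
  have ho : Measurable fun p : E × Q.Step =>
      Q.o.toFun p.2.2.2.2 (Q.outputGradient p.1 p.2) :=
    Q.o.measurable_toFun.comp (measurable_snd.snd.snd.snd.prodMk hg)
  have hoi : ∀ i, Measurable fun p : E × Q.Step =>
      Q.o.toFun p.2.2.2.2 (Q.outputGradient p.1 p.2) i := fun i =>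
    (measurable_pi_apply i).comp ((WithLp.measurable_ofLp 2 _).comp ho)
  exact measurable_fst.add
    ((Finset.measurable_sum _ fun i _ => (hoi i).smul (hx i)).const_smul _)

theorem measurable_noiselessStep (γ : ℝ) (w₀ : E) :
    Measurable fun p : E × (Fin B → Q.Sample) => Q.noiselessStep γ w₀ p.1 p.2 := by
  have hx : ∀ i, Measurable fun p : E × (Fin B → Q.Sample) => Q.xq (p.2 i) := fun i =>
    Q.measurable_xq.comp ((measurable_pi_apply i).comp measurable_snd)
  exact measurable_fst.add ((Finset.measurable_sum _ fun i _ =>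
    ((hx i).inner (measurable_const.sub measurable_fst)).smul (hx i)).const_smul _)

end Measurability

variable [CompleteSpace E] {Q : Quantizers E B} {εp εa εo : ℝ}

/-- The moments of `⟨b, Q_o(Y - Q_a(A))⟩` for fixed `Y` and `A`. -/
theorem momentsLE_gradient (hau : Q.a.IsUnbiased) (ham : Q.a.IsMultiplicative εa)
    (hou : Q.o.IsUnbiased) (hom : Q.o.IsMultiplicative εo) (hεo : 0 ≤ εo)
    (b Y A : EuclideanSpace ℝ (Fin B)) :
    MomentsLE (fun s : Q.a.Seed × Q.o.Seed => ⟪b, Q.o.toFun s.2 (Y - Q.a.toFun s.1 A)⟫)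
      (Q.a.law.prod Q.o.law) (⟪b, Y⟫ - ⟪b, A⟫)
      ((1 + εo) * ((⟪b, Y⟫ - ⟪b, A⟫) ^ 2 + εa * ⟪b, A⟫ ^ 2)) := by
  have ha := (Q.a.momentsLE hau ham A b).affine ⟪b, Y⟫ (-1)
  have heq : (fun s => ⟪b, Y⟫ + -1 * ⟪b, Q.a.toFun s A⟫) =
      fun s => ⟪b, Y - Q.a.toFun s A⟫ := by
    ext s
    rw [inner_sub_right]
    ring
  rw [heq] at ha
  have hga : Measurable fun s : Q.a.Seed × Q.o.Seed => Q.a.toFun s.1 A :=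
    Q.a.measurable_toFun.comp (measurable_fst.prodMk measurable_const)
  have hm : Measurable fun s : Q.a.Seed × Q.o.Seed =>
      ⟪b, Q.o.toFun s.2 (Y - Q.a.toFun s.1 A)⟫ :=
    measurable_const.inner
      (Q.o.measurable_toFun.comp (measurable_snd.prodMk (measurable_const.sub hga)))
  have key := MomentsLE.prod (μ := Q.a.law) (ν := Q.o.law) hm
    (fun sa => Q.o.momentsLE hou hom (Y - Q.a.toFun sa A) b) (ha.memLp.integrable_sq.const_mul _)
  refine ⟨key.memLp, ?_, key.sq_le.trans ?_⟩
  · rw [key.mean, ha.mean]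
    ring
  · rw [integral_const_mul]
    refine mul_le_mul_of_nonneg_left (ha.sq_le.trans (le_of_eq ?_)) (by linarith)
    ring

variable [BorelSpace E] [SecondCountableTopology E]

/-- The moments of a linear combination of the quantized output gradients for fixed data. -/
theorem momentsLE_sum_outputGradient (hpu : Q.p.IsUnbiased) (hpm : Q.p.IsMultiplicative εp)
    (hau : Q.a.IsUnbiased) (ham : Q.a.IsMultiplicative εa)
    (hou : Q.o.IsUnbiased) (hom : Q.o.IsMultiplicative εo) (hεa : 0 ≤ εa) (hεo : 0 ≤ εo)
    (w : E) (d : Fin B → Q.Sample) (β : Fin B → ℝ) :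
    MomentsLE (fun s : Q.p.Seed × Q.a.Seed × Q.o.Seed =>
        ∑ i, β i * Q.o.toFun s.2.2 (Q.outputGradient w (d, s)) i)
      (Q.p.law.prod (Q.a.law.prod Q.o.law))
      (∑ i, β i * (Q.yq (d i) - ⟪Q.xq (d i), w⟫))
      ((1 + εo) * ((∑ i, β i * (Q.yq (d i) - ⟪Q.xq (d i), w⟫)) ^ 2 +
        (εp + εa * (1 + εp)) * (∑ i, β i * ⟪Q.xq (d i), w⟫) ^ 2)) := by
  have hinner : ∀ y : EuclideanSpace ℝ (Fin B), ⟪WithLp.toLp 2 β, y⟫ = ∑ i, β i * y i := fun y => by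
    simp [PiLp.inner_apply, mul_comm]
  set b : EuclideanSpace ℝ (Fin B) := WithLp.toLp 2 β
  set Y : EuclideanSpace ℝ (Fin B) := WithLp.toLp 2 fun i => Q.yq (d i)
  set c : E := ∑ i, β i • Q.xq (d i)
  have hc : ∀ e : E, ⟪c, e⟫ = ∑ i, β i * ⟪Q.xq (d i), e⟫ := fun e => by
    simp [c, sum_inner, inner_smul_left]
  -- The combination of activations is a single linear functional c of the quantized parameter, so
  -- the directional moment bound of `Q.p` applies.
  have hact : ∀ s, ⟪b, Q.activation w (d, s)⟫ = ⟪c, Q.p.toFun s.1 w⟫ := fun s => by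
    rw [hinner, hc]
    rfl
  have hY : ∑ i, β i * (Q.yq (d i) - ⟪Q.xq (d i), w⟫) = ⟪b, Y⟫ - ⟪c, w⟫ := by
    rw [hinner, hc, ← Finset.sum_sub_distrib]
    exact Finset.sum_congr rfl fun i _ => mul_sub _ _ _
  rw [hY, ← hc w]
  have hp := Q.p.momentsLE hpu hpm w c
  have hp' := hp.affine ⟪b, Y⟫ (-1)
  have heq : (fun s => ⟪b, Y⟫ + -1 * ⟪c, Q.p.toFun s w⟫) =
      fun s => ⟪b, Y⟫ - ⟪c, Q.p.toFun s w⟫ := by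
    ext s
    ring
  rw [heq] at hp'
  have hm : Measurable fun s : Q.p.Seed × Q.a.Seed × Q.o.Seed =>
      ∑ i, β i * Q.o.toFun s.2.2 (Q.outputGradient w (d, s)) i := by
    have hpm : Measurable fun s : Q.p.Seed × Q.a.Seed × Q.o.Seed => Q.p.toFun s.1 w :=
      Q.p.measurable_toFun.comp (measurable_fst.prodMk measurable_const)
    have hactm : Measurable fun s : Q.p.Seed × Q.a.Seed × Q.o.Seed => Q.activation w (d, s) :=
      (WithLp.measurable_toLp 2 _).comp (measurable_pi_lambda
        (fun (s : Q.p.Seed × Q.a.Seed × Q.o.Seed) i => ⟪Q.xq (d i), Q.p.toFun s.1 w⟫)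
        fun i => Measurable.inner measurable_const hpm)
    have ham : Measurable fun s : Q.p.Seed × Q.a.Seed × Q.o.Seed =>
        Q.a.toFun s.2.1 (Q.activation w (d, s)) :=
      Q.a.measurable_toFun.comp (measurable_snd.fst.prodMk hactm)
    have hgm : Measurable fun s : Q.p.Seed × Q.a.Seed × Q.o.Seed =>
        Q.outputGradient w (d, s) := ham.const_sub Y
    have hom : Measurable fun s : Q.p.Seed × Q.a.Seed × Q.o.Seed =>
        Q.o.toFun s.2.2 (Q.outputGradient w (d, s)) :=
      Q.o.measurable_toFun.comp (measurable_snd.snd.prodMk hgm)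
    exact Finset.measurable_sum _ fun i _ => ((measurable_pi_apply i).comp
      ((WithLp.measurable_ofLp 2 _).comp hom)).const_mul _
  have hint : Integrable (fun s => (1 + εo) * ((⟪b, Y⟫ - ⟪c, Q.p.toFun s w⟫) ^ 2 +
      εa * ⟪c, Q.p.toFun s w⟫ ^ 2)) Q.p.law :=
    (hp'.memLp.integrable_sq.add (hp.memLp.integrable_sq.const_mul _)).const_mul _
  have key := MomentsLE.prod (μ := Q.p.law) (ν := Q.a.law.prod Q.o.law) hm
    (ψ := fun s => ⟪b, Y⟫ - ⟪c, Q.p.toFun s w⟫) (fun sp => by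
      have h := momentsLE_gradient hau ham hou hom hεo b Y
        (WithLp.toLp 2 fun i => ⟪Q.xq (d i), Q.p.toFun sp w⟫)
      have e : ⟪b, (WithLp.toLp 2 fun i => ⟪Q.xq (d i), Q.p.toFun sp w⟫ :
          EuclideanSpace ℝ (Fin B))⟫ = ⟪c, Q.p.toFun sp w⟫ := by rw [hinner, hc]
      rw [e] at h
      simp only [hinner] at h ⊢
      exact h) hint
  refine ⟨key.memLp, ?_, key.sq_le.trans ?_⟩
  · rw [key.mean, hp'.mean]
    ring
  · rw [integral_const_mul, integral_add hp'.memLp.integrable_sq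
      (hp.memLp.integrable_sq.const_mul _), integral_const_mul]
    refine mul_le_mul_of_nonneg_left ?_ (by linarith)
    have h1 := hp'.sq_le
    have h2 := mul_le_mul_of_nonneg_left hp.sq_le hεa
    linarith

end Quantizers

theorem integrable_fun_add {Ω : Type*} [MeasurableSpace Ω] {μ : Measure Ω} {f g : Ω → ℝ}
    (hf : Integrable f μ) (hg : Integrable g μ) : Integrable (fun ω => f ω + g ω) μ := hf.add hg

namespace Quantizers

variable {E : Type*} [NormedAddCommGroup E] [InnerProductSpace ℝ E]
  [MeasurableSpace E] [CompleteSpace E] [BorelSpace E] [SecondCountableTopology E]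
  {B : ℕ} {Q : Quantizers E B} {D : Measure (E × ℝ)} [IsProbabilityMeasure D]
  {εp εa εo α σ γ : ℝ} {w₀ : E}

theorem inner_noiselessStep_sub (a u : E) (d : Fin B → Q.Sample) :
    ⟪a, Q.noiselessStep γ w₀ u d - w₀⟫ =
      ⟪a, u - w₀⟫ + -(γ * (1 / (B : ℝ))) * ∑ i, ⟪a, Q.xq (d i)⟫ * ⟪Q.xq (d i), u - w₀⟫ := by
  simp only [noiselessStep, inner_sub_right, inner_add_right, inner_smul_right, inner_sum]
  have : ∑ i, (⟪Q.xq (d i), w₀⟫ - ⟪Q.xq (d i), u⟫) * ⟪a, Q.xq (d i)⟫ =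
      - ∑ i, ⟪a, Q.xq (d i)⟫ * (⟪Q.xq (d i), u⟫ - ⟪Q.xq (d i), w₀⟫) := by
    rw [← Finset.sum_neg_distrib]
    exact Finset.sum_congr rfl fun i _ => by ring
  rw [this]
  ring

/-- One noiseless iteration. -/
theorem momentsLE_noiselessStep (hB : 0 < B) (hS : Q.SampleMoments D w₀ α σ) (a u : E) :
    MomentsLE (fun z : Q.Step => ⟪a, Q.noiselessStep γ w₀ u z.1 - w₀⟫) (Q.stepLaw D)
      (⟪a, u - w₀⟫ - γ * ⟪a, Q.covHq D (u - w₀)⟫)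
      ((⟪a, u - w₀⟫ - γ * ⟪a, Q.covHq D (u - w₀)⟫) ^ 2 +
        γ ^ 2 * (α * (⟪a, Q.covHq D a⟫ * ⟪u - w₀, Q.covHq D (u - w₀)⟫))) := by
  have hB' : (1 : ℝ) ≤ B := by exact_mod_cast hB
  have hB0 : (B : ℝ) ≠ 0 := by positivity
  have hf := hS.feature a (u - w₀)
  have h := hf.pi_sum B ⟪a, u - w₀⟫ (-(γ * (1 / (B : ℝ))))
  simp_rw [← inner_noiselessStep_sub] at h
  have e1 : ⟪a, u - w₀⟫ + -(γ * (1 / (B : ℝ))) * (B * ⟪a, Q.covHq D (u - w₀)⟫) =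
      ⟪a, u - w₀⟫ - γ * ⟪a, Q.covHq D (u - w₀)⟫ := by
    field_simp
    ring
  rw [e1] at h
  have hpos : 0 ≤ α * (⟪a, Q.covHq D a⟫ * ⟪u - w₀, Q.covHq D (u - w₀)⟫) :=
    (integral_nonneg fun _ => sq_nonneg _).trans hf.sq_le
  set R := α * (⟪a, Q.covHq D a⟫ * ⟪u - w₀, Q.covHq D (u - w₀)⟫)
  -- The gain 1/B from averaging is discarded here; it is kept only for the noise ξ.
  have h2 : (-(γ * (1 / (B : ℝ)))) ^ 2 * (B * R) ≤ γ ^ 2 * R := by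
    have : (-(γ * (1 / (B : ℝ)))) ^ 2 * (B * R) = γ ^ 2 * R / B := by
      field_simp
    rw [this]
    exact div_le_self (by positivity) hB'
  have h3 := h.mono (add_le_add_right h2 _)
  have hp : MeasurePreserving Prod.fst (Q.stepLaw D) (Measure.pi fun _ : Fin B => Q.sampleLaw D) :=
    measurePreserving_fst
  have hm : AEStronglyMeasurable (fun d : Fin B → Q.Sample => ⟪a, Q.noiselessStep γ w₀ u d - w₀⟫)
      (Measure.pi fun _ : Fin B => Q.sampleLaw D) := h3.memLp.aestronglyMeasurable
  have hi1 := integral_map (μ := Q.stepLaw D) hp.measurable.aemeasurable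
    (by rw [hp.map_eq]; exact hm)
  have hi2 := integral_map (μ := Q.stepLaw D) hp.measurable.aemeasurable
    (by rw [hp.map_eq]; exact hm.pow 2)
  rw [hp.map_eq] at hi1 hi2
  exact ⟨h3.memLp.comp_measurePreserving hp, hi1.symm.trans h3.mean,
    (le_of_eq hi2.symm).trans h3.sq_le⟩

theorem inner_sgdStep_sub_noiselessStep (a w u : E) (z : Q.Step) :
    ⟪a, Q.sgdStep γ w z - Q.noiselessStep γ w₀ u z.1⟫ =
      (⟪a, w - u⟫ + γ * (1 / (B : ℝ)) * ∑ i, ⟪a, Q.xq (z.1 i)⟫ * ⟪Q.xq (z.1 i), u - w₀⟫) +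
        γ * (1 / (B : ℝ)) * ∑ i, ⟪a, Q.xq (z.1 i)⟫ *
          Q.o.toFun z.2.2.2 (Q.outputGradient w z) i := by
  simp only [noiselessStep, sgdStep, inner_sub_right, inner_add_right, inner_smul_right, inner_sum]
  have : ∑ i, (⟪Q.xq (z.1 i), w₀⟫ - ⟪Q.xq (z.1 i), u⟫) * ⟪a, Q.xq (z.1 i)⟫ =
      - ∑ i, ⟪a, Q.xq (z.1 i)⟫ * (⟪Q.xq (z.1 i), u⟫ - ⟪Q.xq (z.1 i), w₀⟫) := by
    rw [← Finset.sum_neg_distrib]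
    exact Finset.sum_congr rfl fun i _ => by ring
  rw [this]
  simp_rw [mul_comm ⟪a, Q.xq (z.1 _)⟫]
  ring

/-- The part of the quantization noise that is amplified by the parameter. -/
def activationNoise (εp εa εo : ℝ) : ℝ := (1 + εo) * (εp + εa * (1 + εp))

/-- The part of the noise of one iteration that does not depend on the variance iterate. -/
noncomputable def noiseLevel (Q : Quantizers E B) (D : Measure (E × ℝ)) (w₀ : E)
    (εp εa εo α σ : ℝ) (b : E) : ℝ :=
  (1 + 4 * εo) * (σ ^ 2 / B) +
    α * ((4 * εo + 4 * activationNoise εp εa εo) * ⟪b, Q.covHq D b⟫ +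
      4 * activationNoise εp εa εo * ⟪w₀, Q.covHq D w₀⟫)

/-- P, V, U, W are the contributions of the noise, the variance part, the bias part and w₀: the
residual is P - V - U and the prediction is V + U + W. The weights are uneven because the
coefficient of V² has to fit into C_ε, whereas the others only affect the final constant. -/
theorem quantization_noise_le {εo κ : ℝ} (hεo : 0 ≤ εo) (hκ : 0 ≤ κ) (P V U W : ℝ) :
    εo * (P - V - U) ^ 2 + κ * (V + U + W) ^ 2 ≤
      (2 * εo + 2 * κ) * V ^ 2 + 4 * εo * P ^ 2 + (4 * εo + 4 * κ) * U ^ 2 + 4 * κ * W ^ 2 := by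
  have h1 : (P - V - U) ^ 2 ≤ 2 * V ^ 2 + 4 * P ^ 2 + 4 * U ^ 2 := by
    nlinarith [sq_nonneg (P - U + V), sq_nonneg (P + U)]
  have h2 : (V + U + W) ^ 2 ≤ 2 * V ^ 2 + 4 * U ^ 2 + 4 * W ^ 2 := by
    nlinarith [sq_nonneg (V - U - W), sq_nonneg (U - W)]
  have h3 := mul_le_mul_of_nonneg_left h1 hεo
  have h4 := mul_le_mul_of_nonneg_left h2 hκ
  linarith

/-- One iteration of quantized SGD, relative to the noiseless iteration. -/
theorem momentsLE_sgdStep (hB : 0 < B) (hS : Q.SampleMoments D w₀ α σ)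
    (hpu : Q.p.IsUnbiased) (hpm : Q.p.IsMultiplicative εp)
    (hau : Q.a.IsUnbiased) (ham : Q.a.IsMultiplicative εa)
    (hou : Q.o.IsUnbiased) (hom : Q.o.IsMultiplicative εo)
    (hεp : 0 ≤ εp) (hεa : 0 ≤ εa) (hεo : 0 ≤ εo) (a : E) :
    ∃ g : E, ∀ w u : E,
      MomentsLE (fun z : Q.Step => ⟪a, Q.sgdStep γ w z - Q.noiselessStep γ w₀ u z.1⟫)
        (Q.stepLaw D) (⟪a, w - u⟫ - γ * ⟪a, Q.covHq D (w - u)⟫)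
        ((⟪a, w - u⟫ - γ * ⟪a, Q.covHq D (w - u)⟫) ^ 2 + ⟪g, w - u⟫ +
          γ ^ 2 * (⟪a, Q.covHq D a⟫ *
            (α * (1 + 2 * εo + 2 * activationNoise εp εa εo) * ⟪w - u, Q.covHq D (w - u)⟫ +
              Q.noiseLevel D w₀ εp εa εo α σ (u - w₀)))) := by
  have hB' : (1 : ℝ) ≤ B := by exact_mod_cast hB
  have hB0 : (B : ℝ) ≠ 0 := by positivity
  obtain ⟨g, hg⟩ := hS.correlation a
  refine ⟨(-(2 * γ ^ 2 / B)) • g, fun w u => ?_⟩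
  set κ := activationNoise εp εa εo with hκ
  have hκ0 : 0 ≤ κ := by unfold κ activationNoise; positivity
  set c := γ * (1 / (B : ℝ)) with hc
  have hm : Measurable fun z : Q.Step => ⟪a, Q.sgdStep γ w z - Q.noiselessStep γ w₀ u z.1⟫ :=
    measurable_const.inner
      (((Q.measurable_sgdStep γ).comp (measurable_const.prodMk measurable_id)).sub
        ((Q.measurable_noiselessStep γ w₀).comp (measurable_const.prodMk measurable_fst)))
  -- the sums over the batch
  have hN := hS.noise a
  have hV := hS.feature a (w - u)
  have hU := hS.feature a (u - w₀)
  have hW := hS.feature a w₀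
  -- Per-sample increment without the extra quantization noise. The correlation of ξ with the
  -- features is kept exactly, as the linear term in g, instead of being estimated.
  have hmain : MomentsLE (fun z => (Q.yq z - ⟪w₀, Q.xq z⟫) * ⟪a, Q.xq z⟫ -
      ⟪a, Q.xq z⟫ * ⟪Q.xq z, w - u⟫) (Q.sampleLaw D) (-⟪a, Q.covHq D (w - u)⟫)
      (σ ^ 2 * ⟪a, Q.covHq D a⟫ - 2 * ⟪g, w - u⟫ +
        α * (⟪a, Q.covHq D a⟫ * ⟪w - u, Q.covHq D (w - u)⟫)) := by
    refine ⟨hN.memLp.sub hV.memLp, ?_, ?_⟩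
    · rw [integral_sub hN.integrable hV.integrable, hN.mean, hV.mean, zero_sub]
    · have hx := integrable_mul_of_memLp hN.memLp hV.memLp
      have hx2 : Integrable (fun z => ((Q.yq z - ⟪w₀, Q.xq z⟫) * ⟪a, Q.xq z⟫) ^ 2 -
          2 * (((Q.yq z - ⟪w₀, Q.xq z⟫) * ⟪a, Q.xq z⟫) * (⟪a, Q.xq z⟫ * ⟪Q.xq z, w - u⟫)))
          (Q.sampleLaw D) := hN.memLp.integrable_sq.sub (hx.const_mul 2)
      simp_rw [sub_sq, mul_assoc (2 : ℝ)]
      rw [integral_add hx2 hV.memLp.integrable_sq,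
        integral_sub hN.memLp.integrable_sq (hx.const_mul 2), integral_const_mul, hg]
      linarith [hN.sq_le, hV.sq_le]
  have bM := hmain.pi_sum B ⟪a, w - u⟫ c
  have bV := hV.pi_sum_sq_le B
  have bN := hN.pi_sum B 0 1
  have bU := hU.pi_sum_sq_le B
  have bW := hW.pi_sum_sq_le B
  simp only [zero_add, one_mul, mul_zero, ne_eq, OfNat.ofNat_ne_zero, not_false_eq_true, zero_pow,
    one_pow] at bN
  have key := MomentsLE.prod (μ := Measure.pi fun _ : Fin B => Q.sampleLaw D)
    (ν := Q.p.law.prod (Q.a.law.prod Q.o.law)) hm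
    (ψ := fun d => ⟪a, w - u⟫ + c * ∑ i, ((Q.yq (d i) - ⟪w₀, Q.xq (d i)⟫) * ⟪a, Q.xq (d i)⟫ -
      ⟪a, Q.xq (d i)⟫ * ⟪Q.xq (d i), w - u⟫))
    (φ := fun d => (⟪a, w - u⟫ + c * ∑ i, ((Q.yq (d i) - ⟪w₀, Q.xq (d i)⟫) * ⟪a, Q.xq (d i)⟫ -
      ⟪a, Q.xq (d i)⟫ * ⟪Q.xq (d i), w - u⟫)) ^ 2 + (c ^ 2 * (2 * εo + 2 * κ) *
        (∑ i, ⟪a, Q.xq (d i)⟫ * ⟪Q.xq (d i), w - u⟫) ^ 2 + (c ^ 2 * (4 * εo) *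
        (∑ i, (Q.yq (d i) - ⟪w₀, Q.xq (d i)⟫) * ⟪a, Q.xq (d i)⟫) ^ 2 +
        (c ^ 2 * (4 * εo + 4 * κ) * (∑ i, ⟪a, Q.xq (d i)⟫ * ⟪Q.xq (d i), u - w₀⟫) ^ 2 +
        c ^ 2 * (4 * κ) * (∑ i, ⟪a, Q.xq (d i)⟫ * ⟪Q.xq (d i), w₀⟫) ^ 2))))
    (fun d => by
      have hT := momentsLE_sum_outputGradient hpu hpm hau ham hou hom hεa hεo w d
        fun i => ⟪a, Q.xq (d i)⟫
      set P := ∑ i, (Q.yq (d i) - ⟪w₀, Q.xq (d i)⟫) * ⟪a, Q.xq (d i)⟫ with hP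
      set V := ∑ i, ⟪a, Q.xq (d i)⟫ * ⟪Q.xq (d i), w - u⟫ with hV
      set U := ∑ i, ⟪a, Q.xq (d i)⟫ * ⟪Q.xq (d i), u - w₀⟫ with hU
      set W := ∑ i, ⟪a, Q.xq (d i)⟫ * ⟪Q.xq (d i), w₀⟫ with hW
      have e1 : ∑ i, ⟪a, Q.xq (d i)⟫ * (Q.yq (d i) - ⟪Q.xq (d i), w⟫) = P - V - U := by
        rw [hP, hV, hU, ← Finset.sum_sub_distrib, ← Finset.sum_sub_distrib]
        refine Finset.sum_congr rfl fun i _ => ?_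
        rw [inner_sub_right, inner_sub_right, real_inner_comm (Q.xq (d i)) w₀]
        ring
      have e2 : ∑ i, ⟪a, Q.xq (d i)⟫ * ⟪Q.xq (d i), w⟫ = V + U + W := by
        rw [hV, hU, hW, ← Finset.sum_add_distrib, ← Finset.sum_add_distrib]
        refine Finset.sum_congr rfl fun i _ => ?_
        rw [inner_sub_right, inner_sub_right]
        ring
      rw [e1, e2] at hT
      -- The U subtracted by the noiseless step cancels the U in the residual: given the batch, the
      -- mean is ⟨a, w - u⟩ + c (P - V), independent of the bias part.
      have h := hT.affine (⟪a, w - u⟫ + c * U) c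
      rw [Finset.sum_sub_distrib, ← hP, ← hV]
      refine ⟨?_, ?_, ?_⟩
      · convert h.memLp using 2 with s
        exact inner_sgdStep_sub_noiselessStep a w u (d, s)
      · rw [show ⟪a, w - u⟫ + c * (P - V) = (⟪a, w - u⟫ + c * U) + c * (P - V - U) by ring,
          ← h.mean]
        congr with s
        exact inner_sgdStep_sub_noiselessStep a w u (d, s)
      · refine le_trans (le_of_eq ?_) (h.sq_le.trans ?_)
        · congr with s
          congr 1
          exact inner_sgdStep_sub_noiselessStep a w u (d, s)
        · have hq := mul_le_mul_of_nonneg_left (quantization_noise_le hεo hκ0 P V U W)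
            (sq_nonneg c)
          have hκ' : (1 + εo) * (εp + εa * (1 + εp)) = κ := rfl
          have : (1 + εo) * ((P - V - U) ^ 2 + (εp + εa * (1 + εp)) * (V + U + W) ^ 2) =
              (1 + εo) * (P - V - U) ^ 2 + κ * (V + U + W) ^ 2 := by
            rw [← hκ']
            ring
          rw [this]
          linarith)
    (bM.memLp.integrable_sq.add ((bV.memLp.integrable_sq.const_mul _).add
      ((bN.memLp.integrable_sq.const_mul _).add ((bU.memLp.integrable_sq.const_mul _).add
        (bW.memLp.integrable_sq.const_mul _)))))
  refine ⟨key.memLp, ?_, key.sq_le.trans ?_⟩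
  · rw [show Q.stepLaw D = (Measure.pi fun _ : Fin B => Q.sampleLaw D).prod
      (Q.p.law.prod (Q.a.law.prod Q.o.law)) from rfl, key.mean, bM.mean, hc]
    field_simp
    ring
  · have i5 := bW.memLp.integrable_sq.const_mul (c ^ 2 * (4 * κ))
    have i4 := bU.memLp.integrable_sq.const_mul (c ^ 2 * (4 * εo + 4 * κ))
    have i3 := bN.memLp.integrable_sq.const_mul (c ^ 2 * (4 * εo))
    have i2 := bV.memLp.integrable_sq.const_mul (c ^ 2 * (2 * εo + 2 * κ))
    have i45 := integrable_fun_add i4 i5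
    have i345 := integrable_fun_add i3 i45
    have i2345 := integrable_fun_add i2 i345
    rw [integral_add bM.memLp.integrable_sq i2345, integral_add i2 i345, integral_add i3 i45,
      integral_add i4 i5]
    simp only [integral_const_mul]
    have hcB : c * B = γ := by rw [hc]; field_simp
    have hc2B : c ^ 2 * B = γ ^ 2 / B := by rw [hc]; field_simp
    have hc2 : c ^ 2 * B ^ 2 = γ ^ 2 := by rw [← mul_pow, hcB]
    have q2 := mul_le_mul_of_nonneg_left bV.sq_le (show 0 ≤ c ^ 2 * (2 * εo + 2 * κ) by positivity)
    have q3 := mul_le_mul_of_nonneg_left bN.sq_le (show 0 ≤ c ^ 2 * (4 * εo) by positivity)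
    have q4 := mul_le_mul_of_nonneg_left bU.sq_le (show 0 ≤ c ^ 2 * (4 * εo + 4 * κ) by positivity)
    have q5 := mul_le_mul_of_nonneg_left bW.sq_le (show 0 ≤ c ^ 2 * (4 * κ) by positivity)
    have q1 := bM.sq_le
    have hVpos : 0 ≤ α * (⟪a, Q.covHq D a⟫ * ⟪w - u, Q.covHq D (w - u)⟫) :=
      (integral_nonneg fun _ => sq_nonneg _).trans hV.sq_le
    rw [inner_smul_left, conj_trivial, noiseLevel]
    set qa := ⟪a, Q.covHq D a⟫
    set qv := ⟪w - u, Q.covHq D (w - u)⟫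
    set qb := ⟪u - w₀, Q.covHq D (u - w₀)⟫
    set qw := ⟪w₀, Q.covHq D w₀⟫
    set av := ⟪a, Q.covHq D (w - u)⟫
    set r := ⟪a, w - u⟫
    set gv := ⟪g, w - u⟫
    have e1 : (r + c * (B * -av)) ^ 2 + c ^ 2 * (B * (σ ^ 2 * qa - 2 * gv + α * (qa * qv))) =
        (r - γ * av) ^ 2 + γ ^ 2 * (σ ^ 2 / B) * qa - 2 * γ ^ 2 / B * gv +
          γ ^ 2 * (α * (qa * qv)) / B := by
      rw [← hcB]
      field_simp
      ring
    have e2 : c ^ 2 * (2 * εo + 2 * κ) * (B ^ 2 * (α * (qa * qv))) =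
        γ ^ 2 * (2 * εo + 2 * κ) * (α * (qa * qv)) := by rw [← hc2]; ring
    have e3 : c ^ 2 * (4 * εo) * (B * (σ ^ 2 * qa)) = γ ^ 2 * (4 * εo) * (σ ^ 2 / B) * qa := by
      rw [← hcB]
      field_simp
    have e4 : c ^ 2 * (4 * εo + 4 * κ) * (B ^ 2 * (α * (qa * qb))) =
        γ ^ 2 * (4 * εo + 4 * κ) * (α * (qa * qb)) := by rw [← hc2]; ring
    have e5 : c ^ 2 * (4 * κ) * (B ^ 2 * (α * (qa * qw))) =
        γ ^ 2 * (4 * κ) * (α * (qa * qw)) := by rw [← hc2]; ring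
    have e6 : γ ^ 2 * (α * (qa * qv)) / B ≤ γ ^ 2 * (α * (qa * qv)) :=
      div_le_self (by positivity) hB'
    rw [e1] at q1
    rw [e2] at q2
    rw [e3] at q3
    rw [e4] at q4
    rw [e5] at q5
    refine (add_le_add q1 (add_le_add q2 (add_le_add q3 (add_le_add q4 q5)))).trans ?_
    have : (r - γ * av) ^ 2 + -(2 * γ ^ 2 / B) * gv +
        γ ^ 2 * (qa * (α * (1 + 2 * εo + 2 * κ) * qv + ((1 + 4 * εo) * (σ ^ 2 / B) +
          α * ((4 * εo + 4 * κ) * qb + 4 * κ * qw)))) -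
        ((r - γ * av) ^ 2 + γ ^ 2 * (σ ^ 2 / B) * qa - 2 * γ ^ 2 / B * gv +
          γ ^ 2 * (α * (qa * qv)) + (γ ^ 2 * (2 * εo + 2 * κ) * (α * (qa * qv)) +
          (γ ^ 2 * (4 * εo) * (σ ^ 2 / B) * qa + (γ ^ 2 * (4 * εo + 4 * κ) * (α * (qa * qb)) +
            γ ^ 2 * (4 * κ) * (α * (qa * qw)))))) = 0 := by ring
    linarith

end Quantizers

/-! ### Processes with linear drift, along the eigenvectors -/

variable {E : Type*} [NormedAddCommGroup E] [InnerProductSpace ℝ E]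

/-- The properties of a summable eigendecomposition `A = ∑ᵢ μᵢ vᵢ vᵢᵀ`, with `∑ᵢ μᵢ ≤ T`. -/
structure TraceDecomposition (A : E →L[ℝ] E) (μ : ℕ → ℝ) (v : ℕ → E) (T : ℝ) : Prop where
  nonneg : ∀ i, 0 ≤ μ i
  norm_eq_one : ∀ i, μ i ≠ 0 → ‖v i‖ = 1
  inner_apply : ∀ i, μ i ≠ 0 → ∀ w, ⟪v i, A w⟫ = μ i * ⟪v i, w⟫
  hasSum_sq : ∀ w, HasSum (fun i => μ i * ⟪v i, w⟫ ^ 2) ⟪w, A w⟫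
  symm : ∀ a b, ⟪a, A b⟫ = ⟪A a, b⟫
  summable : Summable μ
  tsum_le : ∑' i, μ i ≤ T

/-- All marginals of the random vector `X` are square integrable, with a uniform bound. -/
def WeakBound {Ω : Type*} [MeasurableSpace Ω] (P : Measure Ω) (X : Ω → E) (C : ℝ) : Prop :=
  AEStronglyMeasurable X P ∧
    ∀ a, MemLp (fun ω => ⟪a, X ω⟫) 2 P ∧ ∫ ω, ⟪a, X ω⟫ ^ 2 ∂P ≤ C * ‖a‖ ^ 2

namespace TraceDecomposition

variable {A : E →L[ℝ] E} {μ : ℕ → ℝ} {v : ℕ → E} {T : ℝ}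

theorem quadratic_nonneg (h : TraceDecomposition A μ v T) (w : E) : 0 ≤ ⟪w, A w⟫ :=
  (h.hasSum_sq w).nonneg fun i => mul_nonneg (h.nonneg i) (sq_nonneg _)

theorem quadratic_eigenvector (h : TraceDecomposition A μ v T) {i : ℕ} (hi : μ i ≠ 0) :
    ⟪v i, A (v i)⟫ = μ i := by
  rw [h.inner_apply i hi, real_inner_self_eq_norm_sq, h.norm_eq_one i hi]
  simp

variable {Ω : Type*} [MeasurableSpace Ω] {P : Measure Ω}

/-- Sum and integral are exchanged for nonnegative terms. A uniform bound on the marginals suffices,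
since it is weighted by the summable eigenvalues. -/
theorem integral_quadratic (h : TraceDecomposition A μ v T) {X : Ω → E} {C : ℝ}
    (hX : WeakBound P X C) :
    Integrable (fun ω => ⟪X ω, A (X ω)⟫) P ∧
      HasSum (fun i => μ i * ∫ ω, ⟪v i, X ω⟫ ^ 2 ∂P) (∫ ω, ⟪X ω, A (X ω)⟫ ∂P) := by
  have hF : ∀ i, Integrable (fun ω => μ i * ⟪v i, X ω⟫ ^ 2) P := fun i =>
    (hX.2 (v i)).1.integrable_sq.const_mul _
  have hF0 : ∀ i ω, 0 ≤ μ i * ⟪v i, X ω⟫ ^ 2 := fun i ω => mul_nonneg (h.nonneg i) (sq_nonneg _)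
  have hS : Summable fun i => ∫ ω, μ i * ⟪v i, X ω⟫ ^ 2 ∂P := by
    refine Summable.of_nonneg_of_le (fun i => integral_nonneg (hF0 i)) (fun i => ?_)
      (h.summable.mul_right C)
    rw [integral_const_mul]
    by_cases hi : μ i = 0
    · simp [hi]
    · have := (hX.2 (v i)).2
      rw [h.norm_eq_one i hi] at this
      exact mul_le_mul_of_nonneg_left (by simpa using this) (h.nonneg i)
  have heq : ∀ ω, ∑' i, μ i * ⟪v i, X ω⟫ ^ 2 = ⟪X ω, A (X ω)⟫ := fun ω =>
    (h.hasSum_sq (X ω)).tsum_eq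
  have hsum := hasSum_integral_of_summable_integral_norm hF
    (by simpa only [Real.norm_of_nonneg (hF0 _ _)] using hS)
  simp only [heq] at hsum
  refine ⟨⟨hX.1.inner (A.continuous.comp_aestronglyMeasurable hX.1), ?_⟩, ?_⟩
  · rw [hasFiniteIntegral_iff_ofReal (.of_forall fun ω => h.quadratic_nonneg _)]
    simp_rw [← heq, ENNReal.ofReal_tsum_of_nonneg (fun i => hF0 i _) (h.hasSum_sq (X _)).summable]
    rw [lintegral_tsum fun i => (hF i).1.aemeasurable.ennreal_ofReal]
    simp_rw [← ofReal_integral_eq_lintegral_ofReal (hF _) (.of_forall (hF0 _))]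
    exact lt_top_iff_ne_top.2 hS.tsum_ofReal_ne_top
  · simpa only [integral_const_mul] using hsum

end TraceDecomposition

/-- A random process `V` whose conditional mean contracts by `I - γ A` in every step, with
conditional variance at most `γ² s_t ⟨a, A a⟩` in every direction `a`. -/
structure DriftProcess {Ω : Type*} [MeasurableSpace Ω] (P : Measure Ω) (A : E →L[ℝ] E) (γ : ℝ)
    (V : ℕ → Ω → E) (x₀ : E) (s : ℕ → ℝ) : Prop where
  zero : ∀ ω, V 0 ω = x₀
  weak : ∀ t, ∃ C, WeakBound P (V t) C
  nonneg : ∀ t, 0 ≤ s t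
  sq_le : ∀ t a, ∫ ω, ⟪a, V (t + 1) ω⟫ ^ 2 ∂P ≤
    ∫ ω, (⟪a, V t ω⟫ - γ * ⟪a, A (V t ω)⟫) ^ 2 ∂P + γ ^ 2 * (⟪a, A a⟫ * s t)
  cross : ∀ t a, ∫ ω, ⟪a, ∑ j ∈ Finset.range (t + 1), V j ω⟫ * ⟪a, V (t + 1) ω⟫ ∂P =
    ∫ ω, ⟪a, ∑ j ∈ Finset.range (t + 1), V j ω⟫ * (⟪a, V t ω⟫ - γ * ⟪a, A (V t ω)⟫) ∂P

theorem WeakBound.add {Ω : Type*} [MeasurableSpace Ω] {P : Measure Ω} {X Y : Ω → E} {C C' : ℝ}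
    (hX : WeakBound P X C) (hY : WeakBound P Y C') :
    WeakBound P (fun ω => X ω + Y ω) (2 * C + 2 * C') := by
  refine ⟨hX.1.add hY.1, fun a => ?_⟩
  obtain ⟨hX1, hX2⟩ := hX.2 a
  obtain ⟨hY1, hY2⟩ := hY.2 a
  simp only [inner_add_right]
  have hm : MemLp (fun ω => ⟪a, X ω⟫ + ⟪a, Y ω⟫) 2 P := hX1.add hY1
  refine ⟨hm, ?_⟩
  calc ∫ ω, (⟪a, X ω⟫ + ⟪a, Y ω⟫) ^ 2 ∂P
      ≤ ∫ ω, (2 * ⟪a, X ω⟫ ^ 2 + 2 * ⟪a, Y ω⟫ ^ 2) ∂P := by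
        refine integral_mono hm.integrable_sq (integrable_fun_add (hX1.integrable_sq.const_mul 2)
          (hY1.integrable_sq.const_mul 2)) fun ω => ?_
        dsimp only
        nlinarith [sq_nonneg (⟪a, X ω⟫ - ⟪a, Y ω⟫)]
    _ = 2 * ∫ ω, ⟪a, X ω⟫ ^ 2 ∂P + 2 * ∫ ω, ⟪a, Y ω⟫ ^ 2 ∂P := by
        rw [integral_add (hX1.integrable_sq.const_mul 2) (hY1.integrable_sq.const_mul 2),
          integral_const_mul, integral_const_mul]
    _ ≤ _ := by linarith

theorem WeakBound.const {Ω : Type*} [MeasurableSpace Ω] {P : Measure Ω} [IsProbabilityMeasure P]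
    (x : E) : WeakBound P (fun _ => x) (‖x‖ ^ 2) := by
  refine ⟨aestronglyMeasurable_const, fun a => ⟨memLp_const _, ?_⟩⟩
  simp only [integral_const, probReal_univ, one_smul]
  rw [← mul_pow, mul_comm, ← sq_abs]
  exact pow_le_pow_left₀ (abs_nonneg _) (abs_real_inner_le_norm a x) 2

theorem exists_weakBound_sum {Ω : Type*} [MeasurableSpace Ω] {P : Measure Ω}
    [IsProbabilityMeasure P] {V : ℕ → Ω → E} (h : ∀ t, ∃ C, WeakBound P (V t) C) (n : ℕ) :
    ∃ C, WeakBound P (fun ω => ∑ j ∈ Finset.range n, V j ω) C := by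
  induction n with
  | zero => exact ⟨_, by simpa using WeakBound.const (0 : E)⟩
  | succ n ih =>
    obtain ⟨C, hC⟩ := ih
    obtain ⟨C', hC'⟩ := h n
    exact ⟨_, by simpa only [Finset.sum_range_succ] using hC.add hC'⟩

namespace DriftProcess

variable {A : E →L[ℝ] E} {μ : ℕ → ℝ} {v : ℕ → E} {T γ : ℝ} {Ω : Type*} [MeasurableSpace Ω]
  {P : Measure Ω} [IsProbabilityMeasure P] {V : ℕ → Ω → E} {x₀ : E} {s : ℕ → ℝ}

/-- The geometric sum `∑_{s < N} (1 - γ μ)^s`. -/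
def geom (γ μ : ℝ) (N : ℕ) : ℝ := ∑ s ∈ Finset.range N, (1 - γ * μ) ^ s

theorem geom_nonneg {γ μ : ℝ} (h1 : γ * μ ≤ 1) (N : ℕ) : 0 ≤ geom γ μ N :=
  Finset.sum_nonneg fun _ _ => pow_nonneg (by linarith) _

theorem geom_le {γ μ : ℝ} (h0 : 0 ≤ γ * μ) (h1 : γ * μ ≤ 1) (N : ℕ) : geom γ μ N ≤ N := by
  refine (Finset.sum_le_card_nsmul _ _ 1 fun s _ => pow_le_one₀ (by linarith) (by linarith)).trans ?_
  simp

theorem mul_geom_le {γ μ : ℝ} (h1 : γ * μ ≤ 1) (N : ℕ) : γ * μ * geom γ μ N ≤ 1 := by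
  have := mul_neg_geom_sum (1 - γ * μ) N
  rw [sub_sub_cancel] at this
  rw [geom, this]
  linarith [pow_nonneg (show 0 ≤ 1 - γ * μ by linarith) N]

variable (hA : TraceDecomposition A μ v T) (hV : DriftProcess P A γ V x₀ s)
  (hγ : 0 < γ) (hγμ : ∀ i, γ * μ i ≤ 1)

include hA hV hγ hγμ

/-- Along v i the drift is multiplication by 1 - γ μ i, so the second moments obey the scalar
recursion. -/
theorem sum_sq_eigenvector_le {i : ℕ} (hi : μ i ≠ 0) (N : ℕ) :
    ∑ t ∈ Finset.range N, ∫ ω, ⟪v i, V t ω⟫ ^ 2 ∂P ≤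
      geom γ (μ i) N * (⟪v i, x₀⟫ ^ 2 + γ ^ 2 * μ i * ∑ t ∈ Finset.range N, s t) := by
  have hμ := hA.nonneg i
  have hρ : 0 ≤ 1 - γ * μ i := by linarith [hγμ i]
  have hρ1 : 1 - γ * μ i ≤ 1 := by linarith [mul_nonneg hγ.le hμ]
  let h : ℕ → ℝ := fun t => Nat.casesOn t (⟪v i, x₀⟫ ^ 2) fun t => γ ^ 2 * μ i * s t
  have hh : ∀ t, 0 ≤ h t := by
    rintro (_ | t)
    · exact sq_nonneg _
    · exact mul_nonneg (mul_nonneg (sq_nonneg _) hμ) (hV.nonneg t)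
  have key := sum_le_geom_mul_sum hρ N (fun t => ∫ ω, ⟪v i, V t ω⟫ ^ 2 ∂P) h hh
    (by simp [hV.zero, h]) (fun t => by
      refine (hV.sq_le t (v i)).trans ?_
      rw [hA.quadratic_eigenvector hi]
      have e : ∀ ω, (⟪v i, V t ω⟫ - γ * ⟪v i, A (V t ω)⟫) ^ 2 =
          (1 - γ * μ i) ^ 2 * ⟪v i, V t ω⟫ ^ 2 := fun ω => by
        rw [hA.inner_apply i hi]
        ring
      simp_rw [e, integral_const_mul]
      -- The squared contraction is weakened to the contraction itself, so that the energies and the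
      -- correlations involve the same geometric sum.
      have h2 : (1 - γ * μ i) ^ 2 ≤ 1 - γ * μ i := by nlinarith
      have h3 := mul_le_mul_of_nonneg_right h2
        (integral_nonneg fun ω => sq_nonneg ⟪v i, V t ω⟫ : 0 ≤ ∫ ω, ⟪v i, V t ω⟫ ^ 2 ∂P)
      have h4 : h (t + 1) = γ ^ 2 * (μ i * s t) := by simp [h, mul_assoc]
      linarith)
  refine key.trans (mul_le_mul_of_nonneg_left ?_ (geom_nonneg (hγμ i) N))
  cases N with
  | zero => simpa using sq_nonneg _
  | succ N =>
    rw [Finset.sum_range_succ', Finset.sum_range_succ]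
    have := mul_nonneg (mul_nonneg (sq_nonneg γ) hμ) (hV.nonneg N)
    have h0 : h 0 = ⟪v i, x₀⟫ ^ 2 := rfl
    have h1 : ∀ t, h (t + 1) = γ ^ 2 * μ i * s t := fun _ => rfl
    simp only [h0, h1, ← Finset.mul_sum]
    linarith

/-- Expanding the square gives ∑ (2 c t + a t), with the energies a t and the correlations c t of V
t with the sum of its predecessors. By the drift, c (t + 1) = (1 - γ μ i) (c t + a t), so a + c
satisfies the scalar recursion with source a; this second pass supplies the second factor `geom`. -/
theorem sq_sum_eigenvector_le {i : ℕ} (hi : μ i ≠ 0) (N : ℕ) :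
    ∫ ω, ⟪v i, ∑ j ∈ Finset.range N, V j ω⟫ ^ 2 ∂P ≤
      2 * geom γ (μ i) N ^ 2 *
        (⟪v i, x₀⟫ ^ 2 + γ ^ 2 * μ i * ∑ t ∈ Finset.range N, s t) := by
  have hρ : 0 ≤ 1 - γ * μ i := by linarith [hγμ i]
  have hL : ∀ t, MemLp (fun ω => ⟪v i, V t ω⟫) 2 P := fun t => ((hV.weak t).choose_spec.2 _).1
  have hSL : ∀ t, MemLp (fun ω => ⟪v i, ∑ j ∈ Finset.range t, V j ω⟫) 2 P := fun t =>
    ((exists_weakBound_sum hV.weak t).choose_spec.2 _).1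
  set a : ℕ → ℝ := fun t => ∫ ω, ⟪v i, V t ω⟫ ^ 2 ∂P with ha
  set c : ℕ → ℝ := fun t => ∫ ω, ⟪v i, ∑ j ∈ Finset.range t, V j ω⟫ * ⟪v i, V t ω⟫ ∂P with hc
  have ha0 : ∀ t, 0 ≤ a t := fun t => integral_nonneg fun _ => sq_nonneg _
  have hcI : ∀ t, Integrable (fun ω => ⟪v i, ∑ j ∈ Finset.range t, V j ω⟫ * ⟪v i, V t ω⟫) P :=
    fun t => integrable_mul_of_memLp (hSL t) (hL t)
  have hcs : ∀ t, c (t + 1) = (1 - γ * μ i) * (c t + a t) := fun t => by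
    simp only [hc, ha]
    rw [hV.cross t, ← integral_add (hcI t) (hL t).integrable_sq, ← integral_const_mul]
    congr with ω
    rw [hA.inner_apply i hi, Finset.sum_range_succ, inner_add_right]
    ring
  have key := sum_le_geom_mul_sum hρ N (fun t => a t + c t) a ha0 (by simp [hc])
    (fun t => by rw [hcs]; linarith)
  have hsq : ∀ N, ∫ ω, ⟪v i, ∑ j ∈ Finset.range N, V j ω⟫ ^ 2 ∂P =
      ∑ t ∈ Finset.range N, (2 * c t + a t) := by
    intro N
    induction N with
    | zero => simp
    | succ N ih =>
      rw [Finset.sum_range_succ, ← ih]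
      simp only [hc, ha]
      rw [← integral_const_mul, ← integral_add ((hcI N).const_mul 2) (hL N).integrable_sq,
        ← integral_add (hSL N).integrable_sq
          (integrable_fun_add ((hcI N).const_mul 2) (hL N).integrable_sq)]
      congr with ω
      rw [Finset.sum_range_succ, inner_add_right]
      ring
  have h1 : ∑ t ∈ Finset.range N, (2 * c t + a t) ≤ 2 * ∑ t ∈ Finset.range N, (a t + c t) := by
    rw [Finset.mul_sum]
    exact Finset.sum_le_sum fun t _ => by linarith [ha0 t]
  have h2 := hV.sum_sq_eigenvector_le hA hγ hγμ hi N
  have h3 := mul_le_mul_of_nonneg_left h2 (geom_nonneg (hγμ i) N)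
  rw [hsq N]
  calc _ ≤ 2 * ∑ t ∈ Finset.range N, (a t + c t) := h1
    _ ≤ 2 * (geom γ (μ i) N * ∑ t ∈ Finset.range N, a t) := by
      simpa [geom] using key
    _ ≤ 2 * (geom γ (μ i) N * (geom γ (μ i) N *
        (⟪v i, x₀⟫ ^ 2 + γ ^ 2 * μ i * ∑ t ∈ Finset.range N, s t))) := by linarith
    _ = _ := by ring

omit hV in
theorem summable_geom (x : E) (N : ℕ) :
    Summable (fun i => μ i * geom γ (μ i) N * ⟪v i, x⟫ ^ 2) ∧
    Summable (fun i => μ i * geom γ (μ i) N ^ 2 * ⟪v i, x⟫ ^ 2) ∧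
    Summable (fun i => (μ i * geom γ (μ i) N) ^ 2) := by
  have h0 : ∀ i, 0 ≤ geom γ (μ i) N := fun i => geom_nonneg (hγμ i) N
  have h1 : ∀ i, geom γ (μ i) N ≤ N := fun i =>
    geom_le (mul_nonneg hγ.le (hA.nonneg i)) (hγμ i) N
  have hs := (hA.hasSum_sq x).summable
  refine ⟨?_, ?_, ?_⟩
  · refine Summable.of_nonneg_of_le (fun i => ?_) (fun i => ?_) (hs.mul_left (N : ℝ))
    · exact mul_nonneg (mul_nonneg (hA.nonneg i) (h0 i)) (sq_nonneg _)
    · have := mul_le_mul_of_nonneg_right (h1 i) (mul_nonneg (hA.nonneg i) (sq_nonneg ⟪v i, x⟫))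
      linarith
  · refine Summable.of_nonneg_of_le (fun i => ?_) (fun i => ?_) (hs.mul_left ((N : ℝ) ^ 2))
    · exact mul_nonneg (mul_nonneg (hA.nonneg i) (sq_nonneg _)) (sq_nonneg _)
    · have := mul_le_mul_of_nonneg_right (pow_le_pow_left₀ (h0 i) (h1 i) 2)
        (mul_nonneg (hA.nonneg i) (sq_nonneg ⟪v i, x⟫))
      linarith
  -- One factor of the square is bounded by 1/γ, the other by N μ i.
  · refine Summable.of_nonneg_of_le (fun i => sq_nonneg _) (fun i => ?_)
      (hA.summable.mul_left (N / γ))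
    have h2 : μ i * geom γ (μ i) N ≤ 1 / γ := by
      rw [le_div_iff₀ hγ]
      linarith [mul_geom_le (hγμ i) N]
    have h3 : μ i * geom γ (μ i) N ≤ μ i * N := mul_le_mul_of_nonneg_left (h1 i) (hA.nonneg i)
    rw [pow_two]
    refine (mul_le_mul h2 h3 (mul_nonneg (hA.nonneg i) (h0 i)) (by positivity)).trans
      (le_of_eq ?_)
    ring

/-- The sum of the expected squared seminorms along the process. -/
theorem sum_quadratic_le (N : ℕ) :
    ∑ t ∈ Finset.range N, ∫ ω, ⟪V t ω, A (V t ω)⟫ ∂P ≤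
      ∑' i, μ i * geom γ (μ i) N * ⟪v i, x₀⟫ ^ 2 + γ * T * ∑ t ∈ Finset.range N, s t := by
  have hS0 : 0 ≤ ∑ t ∈ Finset.range N, s t := Finset.sum_nonneg fun t _ => hV.nonneg t
  have h1 : HasSum (fun i => ∑ t ∈ Finset.range N, μ i * ∫ ω, ⟪v i, V t ω⟫ ^ 2 ∂P)
      (∑ t ∈ Finset.range N, ∫ ω, ⟪V t ω, A (V t ω)⟫ ∂P) :=
    hasSum_sum fun t _ => (hA.integral_quadratic (hV.weak t).choose_spec).2
  have hs1 := (summable_geom hA hγ hγμ x₀ N).1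
  have hs2 : Summable fun i => γ * (∑ t ∈ Finset.range N, s t) * μ i := hA.summable.mul_left _
  rw [← h1.tsum_eq]
  calc _ ≤ ∑' i, (μ i * geom γ (μ i) N * ⟪v i, x₀⟫ ^ 2 +
        γ * (∑ t ∈ Finset.range N, s t) * μ i) := by
        refine h1.summable.tsum_le_tsum (fun i => ?_) (hs1.add hs2)
        by_cases hi : μ i = 0
        · simp [hi]
        · rw [← Finset.mul_sum]
          have h2 := mul_le_mul_of_nonneg_left (hV.sum_sq_eigenvector_le hA hγ hγμ hi N)
            (hA.nonneg i)
          -- Since γ μ i times the geometric sum is at most 1, the noise contributes at most γ μ i ∑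
          -- s t in this direction, and summing over i yields the trace bound T.
          have h3 := mul_le_mul_of_nonneg_left (mul_geom_le (hγμ i) N)
            (mul_nonneg (mul_nonneg hγ.le (hA.nonneg i)) hS0)
          linarith
    _ = ∑' i, μ i * geom γ (μ i) N * ⟪v i, x₀⟫ ^ 2 +
        γ * (∑ t ∈ Finset.range N, s t) * ∑' i, μ i := by
        rw [hs1.tsum_add hs2, tsum_mul_left]
    _ ≤ _ := by
        have := mul_le_mul_of_nonneg_left hA.tsum_le (mul_nonneg hγ.le hS0)
        linarith

/-- The expected squared seminorm of the sum of the process. -/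
theorem quadratic_sum_le (N : ℕ) :
    Integrable (fun ω => ⟪∑ j ∈ Finset.range N, V j ω, A (∑ j ∈ Finset.range N, V j ω)⟫) P ∧
    ∫ ω, ⟪∑ j ∈ Finset.range N, V j ω, A (∑ j ∈ Finset.range N, V j ω)⟫ ∂P ≤
      2 * ∑' i, μ i * geom γ (μ i) N ^ 2 * ⟪v i, x₀⟫ ^ 2 +
        2 * γ ^ 2 * (∑ t ∈ Finset.range N, s t) * ∑' i, (μ i * geom γ (μ i) N) ^ 2 := by
  obtain ⟨hI, h1⟩ := hA.integral_quadratic (exists_weakBound_sum hV.weak N).choose_spec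
  refine ⟨hI, ?_⟩
  obtain ⟨-, hs1, hs2⟩ := summable_geom hA hγ hγμ x₀ N
  rw [← h1.tsum_eq, ← tsum_mul_left, ← tsum_mul_left, ← (hs1.mul_left _).tsum_add (hs2.mul_left _)]
  refine h1.summable.tsum_le_tsum (fun i => ?_) ((hs1.mul_left _).add (hs2.mul_left _))
  by_cases hi : μ i = 0
  · simp [hi]
  · have h2 := mul_le_mul_of_nonneg_left (hV.sq_sum_eigenvector_le hA hγ hγμ hi N) (hA.nonneg i)
    refine h2.trans (le_of_eq ?_)
    ring

end DriftProcess

section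

variable {E : Type*} [NormedAddCommGroup E] [InnerProductSpace ℝ E] {A : E →L[ℝ] E} {μ : ℕ → ℝ}
  {v : ℕ → E} {T C γ : ℝ} {Ω : Type*} [MeasurableSpace Ω] {P : Measure Ω}

theorem WeakBound.memLp_drift (hA : TraceDecomposition A μ v T) {X : Ω → E}
    (hX : WeakBound P X C) (γ : ℝ) (a : E) :
    MemLp (fun ω => ⟪a, X ω⟫ - γ * ⟪a, A (X ω)⟫) 2 P ∧
      ∫ ω, (⟪a, X ω⟫ - γ * ⟪a, A (X ω)⟫) ^ 2 ∂P ≤ C * ‖a - γ • A a‖ ^ 2 := by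
  have e : ∀ ω, ⟪a, X ω⟫ - γ * ⟪a, A (X ω)⟫ = ⟪a - γ • A a, X ω⟫ := fun ω => by
    rw [inner_sub_left, inner_smul_left, hA.symm]
    simp
  simp_rw [e]
  exact hX.2 _

/-- A qualitative statement: it propagates the integrability needed at each time, and its constant
never enters the final estimate. The maximum with 0 is there because C carries no sign. -/
theorem WeakBound.of_step (hA : TraceDecomposition A μ v T) {X Y : Ω → E} {s : ℝ} (hs : 0 ≤ s)
    (hX : WeakBound P X C) (hY : AEStronglyMeasurable Y P)
    (h : ∀ a, ∃ m, MomentsLE (fun ω => ⟪a, Y ω⟫) P m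
      (∫ ω, (⟪a, X ω⟫ - γ * ⟪a, A (X ω)⟫) ^ 2 ∂P + γ ^ 2 * (⟪a, A a⟫ * s))) :
    WeakBound P Y (max C 0 * (1 + |γ| * ‖A‖) ^ 2 + γ ^ 2 * (‖A‖ * s)) := by
  refine ⟨hY, fun a => ?_⟩
  obtain ⟨m, hm⟩ := h a
  refine ⟨hm.memLp, hm.sq_le.trans ?_⟩
  have h1 := (hX.memLp_drift hA γ a).2
  have h2 : ‖a - γ • A a‖ ≤ (1 + |γ| * ‖A‖) * ‖a‖ := by
    refine (norm_sub_le _ _).trans ?_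
    rw [norm_smul, Real.norm_eq_abs]
    have := mul_le_mul_of_nonneg_left (A.le_opNorm a) (abs_nonneg γ)
    linarith
  have h3 : C * ‖a - γ • A a‖ ^ 2 ≤ max C 0 * ((1 + |γ| * ‖A‖) * ‖a‖) ^ 2 :=
    mul_le_mul (le_max_left _ _) (pow_le_pow_left₀ (norm_nonneg _) h2 2) (sq_nonneg _)
      (le_max_right _ _)
  have h4 : ⟪a, A a⟫ ≤ ‖A‖ * ‖a‖ ^ 2 := by
    refine (real_inner_le_norm _ _).trans ?_
    have := mul_le_mul_of_nonneg_left (A.le_opNorm a) (norm_nonneg a)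
    linarith
  have h5 := mul_le_mul_of_nonneg_left (mul_le_mul_of_nonneg_right h4 hs) (sq_nonneg γ)
  linarith

end

/-! ### The bias and the variance iterates as drift processes -/

namespace Quantizers

variable {E : Type*} [NormedAddCommGroup E] [InnerProductSpace ℝ E] [MeasurableSpace E] {B : ℕ}

/-- The iterates, the noiseless iterates, and the sums of the variance and the bias iterates. -/
noncomputable def augStep (Q : Quantizers E B) (γ : ℝ) (w₀ : E)
    (p : (E × E × E × E) × Q.Step) : E × E × E × E :=
  (Q.sgdStep γ p.1.1 p.2, Q.noiselessStep γ w₀ p.1.2.1 p.2.1,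
    p.1.2.2.1 + (p.1.1 - p.1.2.1), p.1.2.2.2 + (p.1.2.1 - w₀))

/-- The Markov chain generated by `augStep`, started at zero. -/
noncomputable def augIterate (Q : Quantizers E B) (γ : ℝ) (w₀ : E) (z : ℕ → Q.Step) :
    ℕ → E × E × E × E
  | 0 => 0
  | t + 1 => Q.augStep γ w₀ (augIterate Q γ w₀ z t, z t)

/-- The variance part of the error. -/
noncomputable def variancePart (Q : Quantizers E B) (γ : ℝ) (w₀ : E) (z : ℕ → Q.Step) (t : ℕ) : E :=
  (Q.augIterate γ w₀ z t).1 - (Q.augIterate γ w₀ z t).2.1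

/-- The bias part of the error. -/
noncomputable def biasPart (Q : Quantizers E B) (γ : ℝ) (w₀ : E) (z : ℕ → Q.Step) (t : ℕ) : E :=
  (Q.augIterate γ w₀ z t).2.1 - w₀

variable {Q : Quantizers E B} {γ : ℝ} {w₀ : E}

theorem augIterate_fst (z : ℕ → Q.Step) (t : ℕ) :
    (Q.augIterate γ w₀ z t).1 = Q.iterate γ z t := by
  induction t with
  | zero => rfl
  | succ t ih =>
    rw [iterate, ← ih]
    rfl

theorem iterate_eq (z : ℕ → Q.Step) (t : ℕ) :
    Q.iterate γ z t = Q.variancePart γ w₀ z t + Q.biasPart γ w₀ z t + w₀ := by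
  rw [variancePart, biasPart, augIterate_fst]
  abel

theorem augIterate_sum_variancePart (z : ℕ → Q.Step) (t : ℕ) :
    (Q.augIterate γ w₀ z t).2.2.1 = ∑ j ∈ Finset.range t, Q.variancePart γ w₀ z j := by
  induction t with
  | zero => rfl
  | succ t ih =>
    rw [Finset.sum_range_succ, ← ih]
    rfl

theorem augIterate_sum_biasPart (z : ℕ → Q.Step) (t : ℕ) :
    (Q.augIterate γ w₀ z t).2.2.2 = ∑ j ∈ Finset.range t, Q.biasPart γ w₀ z j := by
  induction t with
  | zero => rfl
  | succ t ih =>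
    rw [Finset.sum_range_succ, ← ih]
    rfl

variable [CompleteSpace E] [BorelSpace E] [SecondCountableTopology E]
  {D : Measure (E × ℝ)} [IsProbabilityMeasure D] {εp εa εo α σ T : ℝ} {μ : ℕ → ℝ} {v : ℕ → E}
  {Ω : Type*} [MeasurableSpace Ω] {P : Measure Ω} [IsProbabilityMeasure P] {Z : ℕ → Ω → Q.Step}

variable (Q) in
theorem measurable_augStep (γ : ℝ) (w₀ : E) : Measurable (Q.augStep γ w₀) := by
  refine Measurable.prodMk ?_ (Measurable.prodMk ?_ (Measurable.prodMk ?_ ?_))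
  · exact (Q.measurable_sgdStep γ).comp (measurable_fst.fst.prodMk measurable_snd)
  · exact (Q.measurable_noiselessStep γ w₀).comp (measurable_fst.snd.fst.prodMk measurable_snd.fst)
  · exact measurable_fst.snd.snd.fst.add (measurable_fst.fst.sub measurable_fst.snd.fst)
  · exact measurable_fst.snd.snd.snd.add (measurable_fst.snd.fst.sub measurable_const)

theorem augIterate_measurable_indepFun (hZ : ∀ t, Measurable (Z t)) (hind : iIndepFun Z P)
    (t : ℕ) : Measurable (fun ω => Q.augIterate γ w₀ (fun j => Z j ω) t) ∧
      IndepFun (fun ω => Q.augIterate γ w₀ (fun j => Z j ω) t) (Z t) P :=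
  chain_measurable_indepFun (Q.measurable_augStep γ w₀) hZ hind
    (X := fun t ω => Q.augIterate γ w₀ (fun j => Z j ω) t) 0 (fun _ => rfl) (fun _ _ => rfl) t

section Iteration

variable (hB : 0 < B) (hα : 0 ≤ α) (hS : Q.SampleMoments D w₀ α σ)
  (hA : TraceDecomposition (Q.covHq D) μ v T)
  (hZ : ∀ t, Measurable (Z t)) (hlaw : ∀ t, HasLaw (Z t) (Q.stepLaw D) P) (hind : iIndepFun Z P)

include hB hα hS hA hZ hlaw hind

/-- The one-step moments for a fixed state are integrated over the current state, which is
independent of the fresh randomness. The second claim allows tests by any function of the augmented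
state, as the correlations with the running sum require. -/
theorem momentsLE_biasPart {C : ℝ} {t : ℕ}
    (hC : WeakBound P (fun ω => Q.biasPart γ w₀ (fun j => Z j ω) t) C) (a : E) :
    MomentsLE (fun ω => ⟪a, Q.biasPart γ w₀ (fun j => Z j ω) (t + 1)⟫) P
      (∫ ω, (⟪a, Q.biasPart γ w₀ (fun j => Z j ω) t⟫ -
        γ * ⟪a, Q.covHq D (Q.biasPart γ w₀ (fun j => Z j ω) t)⟫) ∂P)
      (∫ ω, (⟪a, Q.biasPart γ w₀ (fun j => Z j ω) t⟫ -
        γ * ⟪a, Q.covHq D (Q.biasPart γ w₀ (fun j => Z j ω) t)⟫) ^ 2 ∂P +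
        γ ^ 2 * (⟪a, Q.covHq D a⟫ * (α * ∫ ω, ⟪Q.biasPart γ w₀ (fun j => Z j ω) t,
          Q.covHq D (Q.biasPart γ w₀ (fun j => Z j ω) t)⟫ ∂P))) ∧
    ∀ G : E × E × E × E → ℝ, Measurable G →
      MemLp (fun ω => G (Q.augIterate γ w₀ (fun j => Z j ω) t)) 2 P →
      ∫ ω, G (Q.augIterate γ w₀ (fun j => Z j ω) t) *
          ⟪a, Q.biasPart γ w₀ (fun j => Z j ω) (t + 1)⟫ ∂P =
        ∫ ω, G (Q.augIterate γ w₀ (fun j => Z j ω) t) *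
          (⟪a, Q.biasPart γ w₀ (fun j => Z j ω) t⟫ -
            γ * ⟪a, Q.covHq D (Q.biasPart γ w₀ (fun j => Z j ω) t)⟫) ∂P := by
  obtain ⟨hXm, hXi⟩ := augIterate_measurable_indepFun (γ := γ) (w₀ := w₀) hZ hind t
  have hf : Measurable fun p : (E × E × E × E) × Q.Step =>
      ⟪a, Q.noiselessStep γ w₀ p.1.2.1 p.2.1 - w₀⟫ :=
    measurable_const.inner ((measurable_snd.fst.comp
      (Q.measurable_augStep γ w₀)).sub measurable_const)
  have hψ : Measurable fun s : E × E × E × E =>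
      ⟪a, s.2.1 - w₀⟫ - γ * ⟪a, Q.covHq D (s.2.1 - w₀)⟫ := Continuous.measurable (by fun_prop)
  have hφ : Measurable fun s : E × E × E × E =>
      (⟪a, s.2.1 - w₀⟫ - γ * ⟪a, Q.covHq D (s.2.1 - w₀)⟫) ^ 2 +
        γ ^ 2 * (α * (⟪a, Q.covHq D a⟫ * ⟪s.2.1 - w₀, Q.covHq D (s.2.1 - w₀)⟫)) :=
    Continuous.measurable (by fun_prop)
  have hI1 := (hC.memLp_drift hA γ a).1.integrable_sq
  have hI2 := (((hA.integral_quadratic hC).1.const_mul ⟪a, Q.covHq D a⟫).const_mul α).const_mul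
    (γ ^ 2)
  have hstep := fun s : E × E × E × E => momentsLE_noiselessStep (γ := γ) hB hS a s.2.1
  have key := MomentsLE.comp_indep hXm (hlaw t) hXi hf hstep hψ hφ (hI1.add hI2)
  refine ⟨⟨key.memLp, key.mean, key.sq_le.trans (le_of_eq ?_)⟩, fun G hGm hG => ?_⟩
  · have := integral_add hI1 hI2
    refine this.trans ?_
    rw [integral_const_mul, integral_const_mul, integral_const_mul]
    ring
  · exact MomentsLE.integral_mul_comp_indep hXm (hlaw t) hXi hf hstep hψ hφ (hI1.add hI2) hGm hG

theorem aestronglyMeasurable_biasPart (t : ℕ) :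
    AEStronglyMeasurable (fun ω => Q.biasPart γ w₀ (fun j => Z j ω) t) P :=
  (((augIterate_measurable_indepFun (γ := γ) (w₀ := w₀) hZ hind t).1.snd.fst).sub
    measurable_const).aestronglyMeasurable

theorem exists_weakBound_biasPart (t : ℕ) :
    ∃ C, WeakBound P (fun ω => Q.biasPart γ w₀ (fun j => Z j ω) t) C := by
  induction t with
  | zero =>
    have h := WeakBound.const (P := P) (0 - w₀)
    exact ⟨_, h⟩
  | succ t ih =>
    obtain ⟨C, hC⟩ := ih
    exact ⟨_, WeakBound.of_step hA
      (mul_nonneg hα (integral_nonneg fun _ => hA.quadratic_nonneg _)) hC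
      (aestronglyMeasurable_biasPart hB hα hS hA hZ hlaw hind _)
      fun a => ⟨_, (momentsLE_biasPart hB hα hS hA hZ hlaw hind hC a).1⟩⟩

theorem driftProcess_biasPart :
    DriftProcess P (Q.covHq D) γ (fun t ω => Q.biasPart γ w₀ (fun j => Z j ω) t) (-w₀)
      (fun t => α * ∫ ω, ⟪Q.biasPart γ w₀ (fun j => Z j ω) t,
          Q.covHq D (Q.biasPart γ w₀ (fun j => Z j ω) t)⟫ ∂P) where
  zero ω := zero_sub _
  weak := exists_weakBound_biasPart hB hα hS hA hZ hlaw hind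
  nonneg t := mul_nonneg hα (integral_nonneg fun _ => hA.quadratic_nonneg _)
  sq_le t a := by
    obtain ⟨C, hC⟩ := exists_weakBound_biasPart (γ := γ) hB hα hS hA hZ hlaw hind t
    exact (momentsLE_biasPart hB hα hS hA hZ hlaw hind hC a).1.sq_le
  cross t a := by
    have hw := exists_weakBound_biasPart (γ := γ) hB hα hS hA hZ hlaw hind
    obtain ⟨C, hC⟩ := hw t
    -- The stored sum stops before time t, so the current bias part is added to obtain the sum over
    -- j ≤ t.
    have h := (momentsLE_biasPart hB hα hS hA hZ hlaw hind hC a).2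
      (fun s => ⟪a, s.2.2.2 + (s.2.1 - w₀)⟫) (Continuous.measurable (by fun_prop))
    simp only [augIterate_sum_biasPart, ← biasPart.eq_def, ← Finset.sum_range_succ] at h
    exact h ((exists_weakBound_sum hw (t + 1)).choose_spec.2 a).1

variable (hpu : Q.p.IsUnbiased) (hpm : Q.p.IsMultiplicative εp)
  (hau : Q.a.IsUnbiased) (ham : Q.a.IsMultiplicative εa)
  (hou : Q.o.IsUnbiased) (hom : Q.o.IsMultiplicative εo)
  (hεp : 0 ≤ εp) (hεa : 0 ≤ εa) (hεo : 0 ≤ εo)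

variable (Q) in
/-- The conditional variance of the variance iterate in one step. -/
noncomputable def varianceNoise (D : Measure (E × ℝ)) (P : Measure Ω) (Z : ℕ → Ω → Q.Step) (γ : ℝ)
    (w₀ : E) (εp εa εo α σ : ℝ) (t : ℕ) : ℝ :=
  α * (1 + 2 * εo + 2 * activationNoise εp εa εo) *
      ∫ ω, ⟪Q.variancePart γ w₀ (fun j => Z j ω) t,
        Q.covHq D (Q.variancePart γ w₀ (fun j => Z j ω) t)⟫ ∂P +
    ((1 + 4 * εo) * (σ ^ 2 / B) + α * ((4 * εo + 4 * activationNoise εp εa εo) *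
      ∫ ω, ⟪Q.biasPart γ w₀ (fun j => Z j ω) t,
        Q.covHq D (Q.biasPart γ w₀ (fun j => Z j ω) t)⟫ ∂P +
      4 * activationNoise εp εa εo * ⟪w₀, Q.covHq D w₀⟫))

include hpu hpm hau ham hou hom hεp hεa hεo

theorem varianceNoise_nonneg (t : ℕ) : 0 ≤ Q.varianceNoise D P Z γ w₀ εp εa εo α σ t := by
  have h1 : 0 ≤ ∫ ω, ⟪Q.variancePart γ w₀ (fun j => Z j ω) t,
      Q.covHq D (Q.variancePart γ w₀ (fun j => Z j ω) t)⟫ ∂P :=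
    integral_nonneg fun _ => hA.quadratic_nonneg _
  have h2 : 0 ≤ ∫ ω, ⟪Q.biasPart γ w₀ (fun j => Z j ω) t,
      Q.covHq D (Q.biasPart γ w₀ (fun j => Z j ω) t)⟫ ∂P :=
    integral_nonneg fun _ => hA.quadratic_nonneg _
  have h3 := hA.quadratic_nonneg w₀
  unfold varianceNoise activationNoise
  positivity

/-- The one-step second moment contains the signed term ⟨g, w - u⟩ from the correlation of ξ with
the features. Integrating over the state removes it because of `hmean`, with no independence between
ξ and x. -/
theorem momentsLE_variancePart {C : ℝ} {t : ℕ}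
    (hC : WeakBound P (fun ω => Q.variancePart γ w₀ (fun j => Z j ω) t) C)
    (hmean : ∀ c, ∫ ω, ⟪c, Q.variancePart γ w₀ (fun j => Z j ω) t⟫ ∂P = 0) (a : E) :
    MomentsLE (fun ω => ⟪a, Q.variancePart γ w₀ (fun j => Z j ω) (t + 1)⟫) P 0
      (∫ ω, (⟪a, Q.variancePart γ w₀ (fun j => Z j ω) t⟫ -
        γ * ⟪a, Q.covHq D (Q.variancePart γ w₀ (fun j => Z j ω) t)⟫) ^ 2 ∂P +
        γ ^ 2 * (⟪a, Q.covHq D a⟫ * Q.varianceNoise D P Z γ w₀ εp εa εo α σ t)) ∧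
    ∀ G : E × E × E × E → ℝ, Measurable G →
      MemLp (fun ω => G (Q.augIterate γ w₀ (fun j => Z j ω) t)) 2 P →
      ∫ ω, G (Q.augIterate γ w₀ (fun j => Z j ω) t) *
          ⟪a, Q.variancePart γ w₀ (fun j => Z j ω) (t + 1)⟫ ∂P =
        ∫ ω, G (Q.augIterate γ w₀ (fun j => Z j ω) t) *
          (⟪a, Q.variancePart γ w₀ (fun j => Z j ω) t⟫ -
            γ * ⟪a, Q.covHq D (Q.variancePart γ w₀ (fun j => Z j ω) t)⟫) ∂P := by
  obtain ⟨hXm, hXi⟩ := augIterate_measurable_indepFun (γ := γ) (w₀ := w₀) hZ hind t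
  obtain ⟨C', hC'⟩ := exists_weakBound_biasPart (γ := γ) hB hα hS hA hZ hlaw hind t
  obtain ⟨g, hg⟩ := momentsLE_sgdStep (γ := γ) hB hS hpu hpm hau ham hou hom hεp hεa hεo a
  have hf : Measurable fun p : (E × E × E × E) × Q.Step =>
      ⟪a, Q.sgdStep γ p.1.1 p.2 - Q.noiselessStep γ w₀ p.1.2.1 p.2.1⟫ :=
    measurable_const.inner ((measurable_fst.comp (Q.measurable_augStep γ w₀)).sub
      (measurable_snd.fst.comp (Q.measurable_augStep γ w₀)))
  have hψ : Measurable fun s : E × E × E × E =>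
      ⟪a, s.1 - s.2.1⟫ - γ * ⟪a, Q.covHq D (s.1 - s.2.1)⟫ := Continuous.measurable (by fun_prop)
  have hφ : Measurable fun s : E × E × E × E =>
      (⟪a, s.1 - s.2.1⟫ - γ * ⟪a, Q.covHq D (s.1 - s.2.1)⟫) ^ 2 + ⟪g, s.1 - s.2.1⟫ +
        γ ^ 2 * (⟪a, Q.covHq D a⟫ *
          (α * (1 + 2 * εo + 2 * activationNoise εp εa εo) *
            ⟪s.1 - s.2.1, Q.covHq D (s.1 - s.2.1)⟫ +
              Q.noiseLevel D w₀ εp εa εo α σ (s.2.1 - w₀))) := by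
    unfold noiseLevel
    exact Continuous.measurable (by fun_prop)
  have hI1 := (hC.memLp_drift hA γ a).1.integrable_sq
  have hI2 := (hC.2 g).1.integrable (by norm_num)
  have hI3 := (hA.integral_quadratic hC).1.const_mul
    (α * (1 + 2 * εo + 2 * activationNoise εp εa εo))
  have hb := (hA.integral_quadratic hC').1.const_mul (4 * εo + 4 * activationNoise εp εa εo)
  have hb1 := integrable_fun_add hb
    (integrable_const (4 * activationNoise εp εa εo * ⟪w₀, Q.covHq D w₀⟫))
  have hI4 : Integrable (fun ω => Q.noiseLevel D w₀ εp εa εo α σ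
      (Q.biasPart γ w₀ (fun j => Z j ω) t)) P :=
    integrable_fun_add (integrable_const ((1 + 4 * εo) * (σ ^ 2 / B))) (hb1.const_mul α)
  have hI34 := ((integrable_fun_add hI3 hI4).const_mul ⟪a, Q.covHq D a⟫).const_mul (γ ^ 2)
  have hI12 := integrable_fun_add hI1 hI2
  have hstep := fun s : E × E × E × E => hg s.1 s.2.1
  have key := MomentsLE.comp_indep hXm (hlaw t) hXi hf hstep hψ hφ (integrable_fun_add hI12 hI34)
  refine ⟨⟨key.memLp, key.mean.trans ?_, key.sq_le.trans (le_of_eq ?_)⟩, fun G hGm hG => ?_⟩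
  · refine Eq.trans (integral_congr_ae (.of_forall fun ω => ?_)) (hmean (a - γ • Q.covHq D a))
    simp only [inner_sub_left, inner_smul_left, ← hA.symm]
    rfl
  · refine (integral_add hI12 hI34).trans ?_
    rw [integral_add hI1 hI2, hmean, integral_const_mul, integral_const_mul, integral_add hI3 hI4,
      integral_const_mul]
    have : ∫ ω, Q.noiseLevel D w₀ εp εa εo α σ (Q.biasPart γ w₀ (fun j => Z j ω) t) ∂P =
        (1 + 4 * εo) * (σ ^ 2 / B) + α * ((4 * εo + 4 * activationNoise εp εa εo) *
          ∫ ω, ⟪Q.biasPart γ w₀ (fun j => Z j ω) t,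
            Q.covHq D (Q.biasPart γ w₀ (fun j => Z j ω) t)⟫ ∂P +
          4 * activationNoise εp εa εo * ⟪w₀, Q.covHq D w₀⟫) := by
      refine (integral_add (integrable_const ((1 + 4 * εo) * (σ ^ 2 / B)))
        (hb1.const_mul α)).trans ?_
      rw [integral_const_mul α, integral_add hb (integrable_const _),
        integral_const_mul (4 * εo + 4 * activationNoise εp εa εo)]
      simp only [integral_const, probReal_univ, one_smul]
    rw [this, varianceNoise, add_zero]
  · exact MomentsLE.integral_mul_comp_indep hXm (hlaw t) hXi hf hstep hψ hφ
      (integrable_fun_add hI12 hI34) hGm hG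

/-- Square integrability and mean zero are proved in one induction, since the second moment bound at
time t + 1 uses the vanishing mean at time t. -/
theorem weakBound_variancePart (t : ℕ) :
    (∃ C, WeakBound P (fun ω => Q.variancePart γ w₀ (fun j => Z j ω) t) C) ∧
      ∀ c, ∫ ω, ⟪c, Q.variancePart γ w₀ (fun j => Z j ω) t⟫ ∂P = 0 := by
  induction t with
  | zero =>
    have h := WeakBound.const (P := P) ((0 : E) - 0)
    refine ⟨⟨_, h⟩, fun c => ?_⟩
    simp [variancePart, augIterate]
  | succ t ih =>
    obtain ⟨⟨C, hC⟩, hmean⟩ := ih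
    have h := momentsLE_variancePart hB hα hS hA hZ hlaw hind hpu hpm hau ham hou hom hεp hεa hεo
      hC hmean
    have hm := (augIterate_measurable_indepFun (γ := γ) (w₀ := w₀) hZ hind (t + 1)).1
    refine ⟨⟨_, WeakBound.of_step hA (varianceNoise_nonneg hB hα hS hA hZ hlaw hind hpu hpm hau ham
      hou hom hεp hεa hεo t) hC (hm.fst.sub hm.snd.fst).aestronglyMeasurable
      fun a => ⟨_, (h a).1⟩⟩, fun c => (h c).1.mean⟩

theorem driftProcess_variancePart :
    DriftProcess P (Q.covHq D) γ (fun t ω => Q.variancePart γ w₀ (fun j => Z j ω) t) 0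
      (Q.varianceNoise D P Z γ w₀ εp εa εo α σ) where
  zero ω := sub_self _
  weak t := (weakBound_variancePart hB hα hS hA hZ hlaw hind hpu hpm hau ham hou hom hεp hεa
    hεo t).1
  nonneg := varianceNoise_nonneg hB hα hS hA hZ hlaw hind hpu hpm hau ham hou hom hεp hεa hεo
  sq_le t a := by
    obtain ⟨⟨C, hC⟩, hmean⟩ := weakBound_variancePart (γ := γ) hB hα hS hA hZ hlaw hind hpu hpm hau
      ham hou hom hεp hεa hεo t
    exact (momentsLE_variancePart hB hα hS hA hZ hlaw hind hpu hpm hau ham hou hom hεp hεa hεo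
      hC hmean a).1.sq_le
  cross t a := by
    have hw := weakBound_variancePart (γ := γ) hB hα hS hA hZ hlaw hind hpu hpm hau
      ham hou hom hεp hεa hεo
    obtain ⟨⟨C, hC⟩, hmean⟩ := hw t
    have h := (momentsLE_variancePart hB hα hS hA hZ hlaw hind hpu hpm hau ham hou hom hεp hεa hεo
      hC hmean a).2 (fun s => ⟪a, s.2.2.1 + (s.1 - s.2.1)⟫) (Continuous.measurable (by fun_prop))
    simp only [augIterate_sum_variancePart, ← variancePart.eq_def, ← Finset.sum_range_succ] at h
    exact h ((exists_weakBound_sum (fun t => (hw t).1) (t + 1)).choose_spec.2 a).1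

end Iteration

end Quantizers

/-! ### Eigendecompositions -/

theorem hasSum_of_eq {ι : Type*} {f g : ι → ℝ} {a : ℝ} (h : HasSum g a) (e : ∀ i, f i = g i) :
    HasSum f a := by
  rwa [funext e]

section Eigendecomposition

variable {E : Type*} [NormedAddCommGroup E] [InnerProductSpace ℝ E] {A : E →L[ℝ] E}
  {lam : ℕ → ℝ} {v : ℕ → E}

namespace IsEigendecomposition

theorem norm_eq_one (h : IsEigendecomposition A lam v) {i : ℕ} (hi : lam i ≠ 0) : ‖v i‖ = 1 :=
  h.orthonormal.1 ⟨i, hi⟩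

theorem inner_apply (h : IsEigendecomposition A lam v) {i : ℕ} (hi : lam i ≠ 0) (w : E) :
    ⟪v i, A w⟫ = lam i * ⟪v i, w⟫ := by
  have h1 := (h.hasSum w).mapL (innerSL ℝ (v i))
  have h2 : HasSum (fun j => innerSL ℝ (v i) ((lam j * ⟪v j, w⟫) • v j))
      (innerSL ℝ (v i) ((lam i * ⟪v i, w⟫) • v i)) := by
    refine hasSum_single i fun j hj => ?_
    by_cases hlj : lam j = 0
    · simp [hlj]
    · have : ⟪v i, v j⟫ = 0 :=
        h.orthonormal.2 (i := ⟨i, hi⟩) (j := ⟨j, hlj⟩) fun e => hj (congrArg Subtype.val e).symm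
      simp [this]
  have h3 := h1.unique h2
  simpa [inner_smul_right, real_inner_self_eq_norm_sq, h.norm_eq_one hi] using h3

theorem hasSum_sq (h : IsEigendecomposition A lam v) (w : E) :
    HasSum (fun i => lam i * ⟪v i, w⟫ ^ 2) ⟪w, A w⟫ := by
  have h1 := (h.hasSum w).mapL (innerSL ℝ w)
  simp only [innerSL_apply_apply, inner_smul_right] at h1
  refine hasSum_of_eq h1 fun i => ?_
  rw [real_inner_comm w]
  ring

end IsEigendecomposition

theorem sqNorm_headOp (c : ℕ → ℝ) (v : ℕ → E) (k : ℕ) (w : E) :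
    sqNorm (headOp c v k) w = ∑ i ∈ Finset.range k, c i * ⟪v i, w⟫ ^ 2 := by
  simp only [sqNorm, headOp, sum_apply, smul_apply, rankOne_apply, inner_sum, inner_smul_right]
  refine Finset.sum_congr rfl fun i _ => ?_
  rw [real_inner_comm w]
  ring

theorem sqNorm_headOp_nonneg {c : ℕ → ℝ} (hc : ∀ i, 0 ≤ c i) (v : ℕ → E) (k : ℕ) (w : E) :
    0 ≤ sqNorm (headOp c v k) w := by
  rw [sqNorm_headOp]
  exact Finset.sum_nonneg fun i _ => mul_nonneg (hc i) (sq_nonneg _)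

/-- Summability of the eigenvalues makes the series defining `tailOp` converge in operator norm, so
that its `tsum` is not the default value and can be evaluated termwise. -/
theorem sqNorm_tailOp [CompleteSpace E] (h : IsEigendecomposition A lam v) (hs : Summable lam)
    (k : ℕ) (w : E) :
    HasSum (fun i => lam (k + i) * ⟪v (k + i), w⟫ ^ 2) (sqNorm (tailOp lam v k) w) := by
  have hsum : Summable fun i => lam (k + i) • rankOne ℝ (v (k + i)) (v (k + i)) := by
    refine Summable.of_norm_bounded (g := fun i => lam (k + i))
      (hs.comp_injective (add_right_injective k)) fun i => ?_
    rw [norm_smul, norm_rankOne, Real.norm_of_nonneg (h.nonneg _)]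
    by_cases hi : lam (k + i) = 0
    · simp [hi]
    · simp [h.norm_eq_one hi]
  have h1 := (hsum.hasSum.mapL (ContinuousLinearMap.apply ℝ E w)).mapL (innerSL ℝ w)
  refine hasSum_of_eq h1 fun i => ?_
  simp only [ContinuousLinearMap.apply_apply, smul_apply, rankOne_apply, innerSL_apply_apply,
    inner_smul_right]
  rw [real_inner_comm w]
  ring

variable [CompleteSpace E]

/-- The trace of a second moment operator bounds the sum of its eigenvalues. -/
theorem summable_eigenvalues {Ω : Type*} [MeasurableSpace Ω] {P : Measure Ω} {X : Ω → E}
    (hX : MemLp X 2 P) (h : IsEigendecomposition (secondMoment P X) lam v) :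
    Summable lam ∧ ∑' i, lam i ≤ opTrace (secondMoment P X) := by
  set S := secondMoment P X
  set b := stdBasis E
  have hnn : ∀ i, 0 ≤ ⟪b i, S (b i)⟫ := fun i => inner_secondMoment_self_nonneg hX _
  -- Bessel's inequality bounds every finite partial trace by 𝔼‖X‖².
  have hsb : Summable fun i => ⟪b i, S (b i)⟫ := by
    refine summable_of_sum_le (c := ∫ ω, ‖X ω‖ ^ 2 ∂P) hnn fun F => ?_
    simp_rw [S, inner_secondMoment_self hX]
    rw [← integral_finsetSum _ fun i _ => (memLp_inner hX (b i)).integrable_sq]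
    refine integral_mono (integrable_finsetSum _ fun i _ => (memLp_inner hX (b i)).integrable_sq)
      (hX.integrable_norm_pow (by norm_num)) fun ω => ?_
    have := b.orthonormal.sum_inner_products_le (X ω) (s := F)
    simpa using this
  -- Each λ_j with λ_j ≠ 0 is distributed over the basis by Parseval's identity for v j; at each b i
  -- the finite sum is then part of the expansion of ⟨b i, S (b i)⟩.
  have hF : ∀ F : Finset ℕ, ∑ j ∈ F, lam j ≤ opTrace S := fun F => by
    have h1 : HasSum (fun i => ∑ j ∈ F, lam j * ⟪v j, b i⟫ ^ 2) (∑ j ∈ F, lam j) := by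
      refine hasSum_sum fun j _ => ?_
      by_cases hj : lam j = 0
      · simp [hj]
      · have h2 := (b.hasSum_inner_mul_inner (v j) (v j)).mul_left (lam j)
        rw [real_inner_self_eq_norm_sq, h.norm_eq_one hj, one_pow, mul_one] at h2
        refine hasSum_of_eq h2 fun i => ?_
        rw [real_inner_comm (v j), pow_two]
    refine hasSum_le (fun i => ?_) h1 hsb.hasSum
    exact sum_le_hasSum F (fun j _ => mul_nonneg (h.nonneg j) (sq_nonneg _)) (h.hasSum_sq (b i))
  exact ⟨summable_of_sum_le h.nonneg hF, Real.tsum_le_of_sum_le h.nonneg hF⟩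

theorem traceDecomposition_smul {Ω : Type*} [MeasurableSpace Ω] {P : Measure Ω} {X : Ω → E}
    (hX : MemLp X 2 P) (h : IsEigendecomposition (secondMoment P X) lam v) {c : ℝ} (hc : 0 ≤ c) :
    TraceDecomposition (c • secondMoment P X) (fun i => c * lam i) v
      (c * opTrace (secondMoment P X)) where
  nonneg i := mul_nonneg hc (h.nonneg i)
  norm_eq_one i hi := h.norm_eq_one (right_ne_zero_of_mul hi)
  inner_apply i hi w := by
    rw [smul_apply, inner_smul_right, h.inner_apply (right_ne_zero_of_mul hi)]
    ring
  hasSum_sq w := by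
    simpa [inner_smul_right, mul_assoc] using (h.hasSum_sq w).mul_left c
  symm a b := by
    rw [smul_apply, smul_apply, inner_smul_right, inner_smul_left, inner_secondMoment_comm hX]
    simp
  summable := (summable_eigenvalues hX h).1.mul_left c
  tsum_le := by
    rw [tsum_mul_left]
    exact mul_le_mul_of_nonneg_left (summable_eigenvalues hX h).2 hc

end Eigendecomposition

/-! ### Head and tail bounds -/

theorem tsum_le_head_add_tail {f a b : ℕ → ℝ} {β : ℝ} (hf : Summable f) (k : ℕ)
    (ha : ∀ i, f i ≤ a i) (hb : ∀ i, f (k + i) ≤ b i) (hβ : HasSum b β) :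
    ∑' i, f i ≤ ∑ i ∈ Finset.range k, a i + β := by
  rw [← hf.sum_add_tsum_nat_add k, ← hβ.tsum_eq]
  refine add_le_add (Finset.sum_le_sum fun i _ => ha i) ?_
  refine ((summable_nat_add_iff k).2 hf).tsum_le_tsum (fun i => ?_) hβ.summable
  rw [add_comm]
  exact hb i

/-- The combination of the bounds on the bias and the variance processes. `Qs` and `Rs` stand for
the sums of the expected squared seminorms of the bias and the variance iterates, and `Θ` for the
sum of the noise levels. -/
theorem noise_le {α γ T K κ κ₁ s₂ q W Qs Rs Θ n : ℝ} (hα : 0 ≤ α) (hT : 0 ≤ γ * T)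
    (hK : 1 ≤ K) (hκ₁ : κ₁ ≤ K - 1) (hΔ : 0 ≤ 1 - γ * α * K * T)
    (hQ0 : 0 ≤ Qs) (hR0 : 0 ≤ Rs) (hQ : Qs ≤ W + γ * T * (α * Qs)) (hR : Rs ≤ γ * T * Θ)
    (hΘ : Θ = α * (1 + κ₁) * Rs + n * s₂ + α * (2 * κ₁ * Qs + 4 * κ * n * q)) :
    (α * Qs + Θ) * (1 - γ * α * K * T) ≤ α * (1 + 2 * K) * W + n * s₂ + 4 * κ * n * (α * q) := by
  have hαT : 0 ≤ α * (γ * T) := mul_nonneg hα hT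
  have h1 : α * (γ * T) ≤ α * (γ * T) * K := le_mul_of_one_le_right hαT hK
  -- The slack K - 1 ≤ K (1 - α γ T) bounds this multiple of the bias energy without dividing by 1 -
  -- γ α K T. Otherwise that factor would appear squared in the final denominator.
  have h2 : (K - 1) * Qs ≤ K * W := by
    have h3 : (K - 1) * Qs ≤ (K * (1 - α * (γ * T))) * Qs :=
      mul_le_mul_of_nonneg_right (by linarith) hQ0
    have h4 : K * Qs ≤ K * (W + γ * T * (α * Qs)) :=
      mul_le_mul_of_nonneg_left hQ (by linarith)
    linarith
  have h5 : α * Qs * (1 - γ * α * K * T) ≤ α * W := by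
    have h6 : (1 - γ * α * K * T) * Qs ≤ (1 - α * (γ * T)) * Qs :=
      mul_le_mul_of_nonneg_right (by linarith) hQ0
    have h7 : (1 - γ * α * K * T) * Qs ≤ W := by linarith
    have := mul_le_mul_of_nonneg_left h7 hα
    linarith
  have h8 : α * (1 + κ₁) * Rs ≤ α * K * (γ * T * Θ) := by
    have h9 : α * (1 + κ₁) * Rs ≤ α * K * Rs :=
      mul_le_mul_of_nonneg_right (mul_le_mul_of_nonneg_left (by linarith) hα) hR0
    exact h9.trans (mul_le_mul_of_nonneg_left hR (mul_nonneg hα (by linarith)))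
  have h10 : α * (2 * κ₁ * Qs) ≤ α * (2 * (K * W)) := by
    refine mul_le_mul_of_nonneg_left ?_ hα
    have := mul_le_mul_of_nonneg_right hκ₁ hQ0
    linarith
  linarith

/-- The difference of the two sides is the sum of the forms at x - y, y - z and x - z. -/
theorem quadratic_add_le {E : Type*} [NormedAddCommGroup E] [InnerProductSpace ℝ E]
    {A : E →L[ℝ] E} (hs : ∀ a b, ⟪a, A b⟫ = ⟪A a, b⟫) (h0 : ∀ a, 0 ≤ ⟪a, A a⟫) (x y z : E) :
    ⟪x + y + z, A (x + y + z)⟫ ≤ 3 * (⟪x, A x⟫ + ⟪y, A y⟫ + ⟪z, A z⟫) := by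
  have h1 := h0 (x - y)
  have h2 := h0 (y - z)
  have h3 := h0 (x - z)
  have c : ∀ a b, ⟪b, A a⟫ = ⟪a, A b⟫ := fun a b => by rw [hs a b, real_inner_comm]
  simp only [map_add, map_sub, inner_add_left, inner_add_right, inner_sub_left,
    inner_sub_right] at h1 h2 h3 ⊢
  rw [c x y] at h1 ⊢
  rw [c y z] at h2 ⊢
  rw [c x z] at h3 ⊢
  linarith

/-- The relation of two optima `w`, `w'` with `(1 + ε) A w' = A w`. -/
theorem optimum_relations {E : Type*} [NormedAddCommGroup E] [InnerProductSpace ℝ E]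
    {A : E →L[ℝ] E} (hs : ∀ a b, ⟪a, A b⟫ = ⟪A a, b⟫)
    (h0 : ∀ a, 0 ≤ ⟪a, A a⟫) {ε : ℝ} (hε : 0 ≤ ε) {w w' : E} (h : (1 + ε) • A w' = A w) :
    ⟪w', A w⟫ ≤ ⟪w, A w⟫ ∧ ⟪w' - w, A (w' - w)⟫ ≤ ⟪w, A w⟫ * ε := by
  -- With a = ⟨w', A w'⟩, every form is a multiple of a: ⟨w', A w⟩ is (1 + ε) a, ⟨w, A w⟩ is (1 +
  -- ε)² a, and the form at w' - w is ε² a.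
  have e1 : ⟪w', A w⟫ = (1 + ε) * ⟪w', A w'⟫ := by rw [← h, inner_smul_right]
  have e2 : ⟪w, A w'⟫ = ⟪w', A w⟫ := by rw [hs, real_inner_comm]
  have e3 : ⟪w, A w⟫ = (1 + ε) * ⟪w', A w⟫ := by
    rw [← e2, ← inner_smul_right, h]
  have h1 := h0 w'
  rw [map_sub, inner_sub_left, inner_sub_right, inner_sub_right, e2, e3, e1]
  generalize ⟪w', A w'⟫ = a at *
  constructor
  · nlinarith only [h1, hε, mul_nonneg hε h1, mul_nonneg hε (mul_nonneg hε h1)]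
  · nlinarith only [h1, hε, mul_nonneg hε h1, mul_nonneg hε (mul_nonneg hε h1),
      mul_nonneg hε (mul_nonneg hε (mul_nonneg hε h1))]

open DriftProcess in
/-- The geometric sums of the bias and the variance processes, split into head and tail. -/
theorem geom_head_tail {lam p x : ℕ → ℝ} {ε γ m : ℝ} (hlam : ∀ i, 0 ≤ lam i) (hε : 0 ≤ ε)
    (hεm : ε ≤ m) (hγ : 0 < γ) (hγμ : ∀ i, γ * ((1 + ε) * lam i) ≤ 1)
    (hp : ∀ i, lam i ≠ 0 → p i = (1 + ε) * x i) (N i : ℕ) :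
    ((1 + ε) * lam i * geom γ ((1 + ε) * lam i) N * x i ^ 2 ≤ γ⁻¹ * (1 * p i ^ 2) ∧
      (1 + ε) * lam i * geom γ ((1 + ε) * lam i) N * x i ^ 2 ≤ N * (lam i * p i ^ 2)) ∧
    ((1 + ε) * lam i * geom γ ((1 + ε) * lam i) N ^ 2 * x i ^ 2 ≤
        (γ ^ 2)⁻¹ * ((lam i)⁻¹ * p i ^ 2) ∧
      (1 + ε) * lam i * geom γ ((1 + ε) * lam i) N ^ 2 * x i ^ 2 ≤
        N ^ 2 * (lam i * p i ^ 2)) ∧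
    (((1 + ε) * lam i * geom γ ((1 + ε) * lam i) N) ^ 2 ≤ (γ ^ 2)⁻¹ ∧
      ((1 + ε) * lam i * geom γ ((1 + ε) * lam i) N) ^ 2 ≤
        N ^ 2 * (1 + m) ^ 2 * lam i ^ 2) := by
  -- On the kernel all left sides vanish, also with the convention 0⁻¹ = 0, and no relation between
  -- p i and x i is needed.
  by_cases hi : lam i = 0
  · refine ⟨⟨?_, ?_⟩, ⟨?_, ?_⟩, ?_, ?_⟩ <;>
    simp only [hi, mul_zero, zero_mul, ne_eq, OfNat.ofNat_ne_zero, not_false_eq_true, zero_pow,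
      inv_zero] <;>
    positivity
  have hl : 0 < lam i := lt_of_le_of_ne (hlam i) (Ne.symm hi)
  have hμ : 0 < (1 + ε) * lam i := by positivity
  rw [hp i hi]
  set G := geom γ ((1 + ε) * lam i) N
  have hG0 : 0 ≤ G := geom_nonneg (hγμ i) N
  have hGN : G ≤ N := geom_le (mul_pos hγ hμ).le (hγμ i) N
  have hG1 : (1 + ε) * lam i * G ≤ γ⁻¹ := by
    rw [inv_eq_one_div, le_div_iff₀ hγ]
    linarith [mul_geom_le (hγμ i) N]
  have hμG0 : 0 ≤ (1 + ε) * lam i * G := mul_nonneg hμ.le hG0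
  have hx := sq_nonneg (x i)
  have h1ε : 1 ≤ (1 + ε) ^ 2 := by nlinarith
  have hxp : x i ^ 2 ≤ ((1 + ε) * x i) ^ 2 := by
    rw [mul_pow]
    exact le_mul_of_one_le_left hx h1ε
  have hμx : (1 + ε) * lam i * x i ^ 2 ≤ lam i * ((1 + ε) * x i) ^ 2 := by
    have : (1 + ε) * (lam i * x i ^ 2) ≤ (1 + ε) ^ 2 * (lam i * x i ^ 2) :=
      mul_le_mul_of_nonneg_right (by nlinarith) (by positivity)
    linarith
  have hμG2 : ((1 + ε) * lam i * G) ^ 2 ≤ (γ ^ 2)⁻¹ := by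
    rw [← inv_pow]
    exact pow_le_pow_left₀ hμG0 hG1 2
  refine ⟨⟨?_, ?_⟩, ⟨?_, ?_⟩, hμG2, ?_⟩
  · rw [one_mul]
    exact mul_le_mul hG1 hxp hx (by positivity)
  · calc _ = G * ((1 + ε) * lam i * x i ^ 2) := by ring
      _ ≤ _ := mul_le_mul hGN hμx (by positivity) (by positivity)
  · calc _ = ((1 + ε) * lam i * G) ^ 2 * ((lam i)⁻¹ * ((1 + ε) * x i ^ 2 / (1 + ε) ^ 2)) := by
          field_simp
      _ ≤ _ := by
        refine mul_le_mul hμG2 (mul_le_mul_of_nonneg_left ?_ (by positivity)) (by positivity)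
          (by positivity)
        refine (div_le_self (by positivity) h1ε).trans ?_
        rw [mul_pow]
        exact mul_le_mul_of_nonneg_right (by nlinarith) hx
  · calc _ = G ^ 2 * ((1 + ε) * lam i * x i ^ 2) := by ring
      _ ≤ _ := mul_le_mul (pow_le_pow_left₀ hG0 hGN 2) hμx (by positivity) (by positivity)
  · calc _ = G ^ 2 * (1 + ε) ^ 2 * lam i ^ 2 := by ring
      _ ≤ _ := by gcongr

/-- The accumulated noise of `n` iterations. -/
theorem total_noise_le {α γ K κ C₁ c Δ s₂ q h W X I tl n εp εa εo : ℝ}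
    (hn : 0 < n) (hγ : 0 < γ) (hα : 0 ≤ α) (hΔ : 0 < Δ) (hK : 1 ≤ K)
    (hs₂ : 0 ≤ s₂) (hh : 0 ≤ h) (hI : 0 ≤ I) (htl : 0 ≤ tl) (hεp : 0 ≤ εp) (hεa : 0 ≤ εa)
    (hεo : 0 ≤ εo) (hC₁0 : 0 ≤ C₁) (hC₁K : 1 + 2 * K ≤ C₁) (hC₁o : 1 + 4 * εo ≤ C₁)
    (hC₁c : 4 * c ≤ C₁) (hκ : κ ≤ c * (εp + εa)) (hκ0 : 0 ≤ κ) (hq : q ≤ h)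
    (hW : W ≤ γ⁻¹ * I + n * tl)
    (hX : X * Δ ≤ α * (1 + 2 * K) * W + n * ((1 + 4 * εo) * s₂) + 4 * κ * n * (α * q)) :
    X ≤ n * C₁ * ((s₂ + α * ((εo + εa + εp) * h + I / (n * γ) + tl)) / Δ) := by
  rw [mul_div_assoc', le_div_iff₀ hΔ]
  have e1 : γ⁻¹ * I + n * tl = n * (I / (n * γ) + tl) := by field_simp
  have a1 : α * (1 + 2 * K) * W ≤ α * C₁ * (n * (I / (n * γ) + tl)) := by
    rw [← e1]
    have hb : 0 ≤ γ⁻¹ * I + n * tl := by positivity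
    calc α * (1 + 2 * K) * W ≤ α * (1 + 2 * K) * (γ⁻¹ * I + n * tl) :=
          mul_le_mul_of_nonneg_left hW (by positivity)
      _ ≤ _ := mul_le_mul_of_nonneg_right (mul_le_mul_of_nonneg_left hC₁K hα) hb
  have a2 : n * ((1 + 4 * εo) * s₂) ≤ n * (C₁ * s₂) :=
    mul_le_mul_of_nonneg_left (mul_le_mul_of_nonneg_right hC₁o hs₂) hn.le
  have a3 : 4 * κ * n * (α * q) ≤ C₁ * n * α * ((εo + εa + εp) * h) := by
    have b1 : 4 * κ ≤ C₁ * (εo + εa + εp) := by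
      have b2 : 4 * c * (εp + εa) ≤ C₁ * (εp + εa) :=
        mul_le_mul_of_nonneg_right hC₁c (by positivity)
      have b3 : 0 ≤ C₁ * εo := by positivity
      linarith
    calc 4 * κ * n * (α * q) ≤ 4 * κ * n * (α * h) :=
          mul_le_mul_of_nonneg_left (mul_le_mul_of_nonneg_left hq hα) (by positivity)
      _ ≤ C₁ * (εo + εa + εp) * n * (α * h) :=
          mul_le_mul_of_nonneg_right (mul_le_mul_of_nonneg_right b1 hn.le) (by positivity)
      _ = _ := by ring
  refine hX.trans ((add_le_add (add_le_add a1 a2) a3).trans (le_of_eq ?_))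
  ring

/-- The total error in terms of the accumulated noise. -/
theorem total_error_le {E' dh γ m C₁ R h W Y X Hinv tl S n k εd εl : ℝ}
    (hn : 0 < n) (hγ : 0 < γ) (hm : 1 ≤ m) (hC₁ : 0 ≤ C₁) (hR : 0 ≤ R) (hh : 0 ≤ h)
    (hHinv : 0 ≤ Hinv) (htl : 0 ≤ tl) (hS : 0 ≤ S) (hk : 0 ≤ k) (hX0 : 0 ≤ X)
    (hεd : 0 ≤ εd) (hεl : 0 ≤ εl) (hE : E' ≤ 2 * W + 2 * γ ^ 2 * X * Y) (hdh : dh ≤ h * εd)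
    (hW : W ≤ (γ ^ 2)⁻¹ * Hinv + n ^ 2 * tl)
    (hY : Y ≤ k * (γ ^ 2)⁻¹ + n ^ 2 * m * S) (hX : X ≤ n * C₁ * R) :
    3 / 2 * (1 / n ^ 2 * E' + dh) ≤
      (3 + 3 * m * C₁) * (h * εd + εl + (k / n + n * γ ^ 2 * S) * R +
        (1 / (γ ^ 2 * n ^ 2) * Hinv + tl)) := by
  -- Up to m n, γ² Y is the effective dimension factor k / n + n γ² S of the variance error.
  have hYF : γ ^ 2 * Y ≤ m * (n * (k / n + n * γ ^ 2 * S)) := by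
    have e2 : γ ^ 2 * (k * (γ ^ 2)⁻¹ + n ^ 2 * m * S) = k + m * (n ^ 2 * γ ^ 2 * S) := by
      field_simp
    have e3 : m * (n * (k / n + n * γ ^ 2 * S)) = m * k + m * (n ^ 2 * γ ^ 2 * S) := by
      field_simp
    have h2 : k ≤ m * k := le_mul_of_one_le_left hk hm
    have h3 := mul_le_mul_of_nonneg_left hY (sq_nonneg γ)
    rw [e2] at h3
    rw [e3]
    linarith
  have hF0 : 0 ≤ k / n + n * γ ^ 2 * S := by positivity
  have hm0 : 0 ≤ m := by linarith
  have hW' : W ≤ n ^ 2 * (1 / (γ ^ 2 * n ^ 2) * Hinv + tl) := by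
    refine hW.trans (le_of_eq ?_)
    field_simp
  have hb0 : 0 ≤ 1 / (γ ^ 2 * n ^ 2) * Hinv + tl := by positivity
  generalize k / n + n * γ ^ 2 * S = F at *
  generalize 1 / (γ ^ 2 * n ^ 2) * Hinv + tl = b at *
  have hXY : γ ^ 2 * X * Y ≤ n ^ 2 * (m * C₁ * (F * R)) := by
    calc γ ^ 2 * X * Y = X * (γ ^ 2 * Y) := by ring
      _ ≤ X * (m * (n * F)) := mul_le_mul_of_nonneg_left hYF hX0
      _ ≤ n * C₁ * R * (m * (n * F)) := mul_le_mul_of_nonneg_right hX (by positivity)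
      _ = _ := by ring
  have hE' : 1 / n ^ 2 * E' ≤ 2 * b + 2 * (m * C₁ * (F * R)) := by
    rw [one_div, inv_mul_le_iff₀ (by positivity)]
    linarith
  have hV0 : 0 ≤ F * R := by positivity
  have hc : 0 ≤ 3 * m * C₁ := by positivity
  have hd : 0 ≤ h * εd := by positivity
  have t1 := mul_nonneg hc hb0
  have t2 := mul_nonneg hc hd
  have t3 := mul_nonneg hc hεl
  linarith

/-! ### Assembly of the excess risk bound -/

namespace Quantizers

variable {E : Type*} [NormedAddCommGroup E] [InnerProductSpace ℝ E] [MeasurableSpace E] {B : ℕ}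

theorem average_eq {Q : Quantizers E B} {γ : ℝ} (w₀ : E) {N : ℕ} (hN : 0 < N) (z : ℕ → Q.Step) :
    Q.average γ N z = (1 / (N : ℝ)) • ∑ t ∈ Finset.range N, Q.variancePart γ w₀ z t +
      (1 / (N : ℝ)) • ∑ t ∈ Finset.range N, Q.biasPart γ w₀ z t + w₀ := by
  have hN' : (N : ℝ) ≠ 0 := by positivity
  simp_rw [average, iterate_eq (w₀ := w₀) z, Finset.sum_add_distrib, smul_add]
  simp [← Nat.cast_smul_eq_nsmul ℝ, smul_smul, hN']

end Quantizers

namespace Quantizers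

variable {E : Type*} [NormedAddCommGroup E] [InnerProductSpace ℝ E] [CompleteSpace E]
  [MeasurableSpace E] [BorelSpace E] [SecondCountableTopology E] {B N : ℕ} {Q : Quantizers E B}
  {D : Measure (E × ℝ)} [IsProbabilityMeasure D] {Ω : Type*} [MeasurableSpace Ω] {P : Measure Ω}
  [IsProbabilityMeasure P] {Z : ℕ → Ω → Q.Step}
  {εd εl εp εa εo α σ γ : ℝ} {wstar w₀ : E} {lam : ℕ → ℝ} {v : ℕ → E}

/-- A fourth moment constant is at least one, so that `γ μᵢ ≤ 1` for all eigenvalues. -/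
theorem one_le_of_sampleMoments (hS : Q.SampleMoments D w₀ α σ) {a : E}
    (ha : 0 < ⟪a, Q.covHq D a⟫) : 1 ≤ α := by
  have h := hS.feature a a
  -- Jensen's inequality: ⟨a, H_q a⟩² = (𝔼⟨a, x⟩²)² ≤ 𝔼⟨a, x⟩⁴ ≤ α ⟨a, H_q a⟩².
  have h1 := variance_nonneg (fun z => ⟪a, Q.xq z⟫ * ⟪Q.xq z, a⟫) (Q.sampleLaw D)
  rw [variance_eq_sub h.memLp, h.mean] at h1
  simp only [Pi.pow_apply] at h1
  have h2 := h.sq_le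
  have h3 : ⟪a, Q.covHq D a⟫ ^ 2 * 1 ≤ ⟪a, Q.covHq D a⟫ ^ 2 * α := by linarith
  exact le_of_mul_le_mul_left h3 (by positivity)

variable (Q) in
/-- The excess risk bound in terms of the quadratic forms of the two processes. -/
theorem excessRisk_le (hN : 0 < N) (hD : Q.FiniteCovariance D) (hεd : 0 ≤ εd)
    (hcov : Q.covHq D = (1 + εd) • covH D) (hmin : ∀ w, risk D wstar ≤ risk D w) (w₀ : E)
    (z : ℕ → Q.Step) :
    risk D (Q.average γ N z) - risk D wstar ≤
      3 / 2 * (1 / (N : ℝ) ^ 2 *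
        (⟪∑ t ∈ Finset.range N, Q.variancePart γ w₀ z t,
            Q.covHq D (∑ t ∈ Finset.range N, Q.variancePart γ w₀ z t)⟫ +
          ⟪∑ t ∈ Finset.range N, Q.biasPart γ w₀ z t,
            Q.covHq D (∑ t ∈ Finset.range N, Q.biasPart γ w₀ z t)⟫) +
        ⟪w₀ - wstar, covH D (w₀ - wstar)⟫) := by
  rw [risk_sub_risk hD hmin, average_eq w₀ hN, add_sub_assoc]
  have h0 : ∀ a, 0 ≤ ⟪a, covH D a⟫ := inner_secondMoment_self_nonneg hD.1
  have h1 := quadratic_add_le (inner_secondMoment_comm hD.1) h0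
    ((1 / (N : ℝ)) • ∑ t ∈ Finset.range N, Q.variancePart γ w₀ z t)
    ((1 / (N : ℝ)) • ∑ t ∈ Finset.range N, Q.biasPart γ w₀ z t) (w₀ - wstar)
  change _ ≤ 3 * (⟪_, covH D _⟫ + ⟪_, covH D _⟫ + ⟪_, covH D _⟫) at h1
  have h2 : ∀ x, ⟪(1 / (N : ℝ)) • x, covH D ((1 / (N : ℝ)) • x)⟫ ≤
      1 / (N : ℝ) ^ 2 * ⟪x, Q.covHq D x⟫ := fun x => by
    rw [hcov, map_smul, smul_apply, inner_smul_left, inner_smul_right, inner_smul_right]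
    have := mul_nonneg hεd (h0 x)
    have h3 : ⟪x, covH D x⟫ ≤ (1 + εd) * ⟪x, covH D x⟫ := by linarith
    have h4 := mul_le_mul_of_nonneg_left h3 (show 0 ≤ 1 / (N : ℝ) ^ 2 by positivity)
    refine le_trans (le_of_eq ?_) h4
    simp only [conj_trivial]
    ring
  have h3 := h2 (∑ t ∈ Finset.range N, Q.variancePart γ w₀ z t)
  have h4 := h2 (∑ t ∈ Finset.range N, Q.biasPart γ w₀ z t)
  change 1 / 2 * ⟪_, secondMoment D (fun z => z.1) _⟫ ≤ _
  linarith

/-- The factor 1 + ε_d is absorbed into the trace, turning C_ε tr H into K tr H_q with K free of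
ε_d. -/
theorem stepConst_eq (εd εp εa εo : ℝ) :
    stepConst εd εp εa εo = (1 + εd) * stepConst 0 εp εa εo := by
  unfold stepConst
  ring

theorem one_le_stepConst (hεp : 0 ≤ εp) (hεa : 0 ≤ εa) (hεo : 0 ≤ εo) :
    1 ≤ stepConst 0 εp εa εo := by
  have : 0 ≤ 2 * εp + 4 * εo * (1 + εa) * (1 + εp) + 2 * εa * (1 + εp) := by positivity
  unfold stepConst
  linarith

/-- The trace in the condition on the stepsize is positive, since `1 / 0 = 0`. -/
theorem trace_pos_of_lt_inv {γ α C t : ℝ} (hα : 0 < α) (hC : 0 < C) (hγ : 0 < γ)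
    (h : γ < 1 / (α * C * t)) : 0 < t ∧ γ * α * C * t < 1 := by
  have h1 := hγ.trans h
  rw [one_div_pos] at h1
  have ht : 0 < t := pos_of_mul_pos_right h1 (mul_pos hα hC).le
  refine ⟨ht, ?_⟩
  rw [lt_div_iff₀ h1] at h
  linarith

theorem mul_eigenvalue_le_one (hS : Q.SampleMoments D w₀ α σ) {μ : ℕ → ℝ} {T K : ℝ}
    (hA : TraceDecomposition (Q.covHq D) μ v T) (hT : 0 ≤ T) (hγ : 0 < γ) (hK : 1 ≤ K)
    (h : γ * α * K * T ≤ 1) (i : ℕ) : γ * μ i ≤ 1 := by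
  by_cases hi : μ i = 0
  · simp [hi]
  have hμ : 0 < μ i := lt_of_le_of_ne (hA.nonneg i) (Ne.symm hi)
  have hα1 : 1 ≤ α := one_le_of_sampleMoments hS (a := v i)
    (by rw [hA.quadratic_eigenvector (i := i) hμ.ne']; exact hμ)
  have h1 : μ i ≤ T := (hA.summable.le_tsum i fun j _ => hA.nonneg j).trans hA.tsum_le
  have h2 : γ * T ≤ γ * T * (α * K) :=
    le_mul_of_one_le_right (by positivity) (one_le_mul_of_one_le_of_one_le hα1 hK)
  have h3 := mul_le_mul_of_nonneg_left h1 hγ.le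
  linarith only [h, h2, h3]

open DriftProcess in
/-- The bias and the variance processes together, in terms of the geometric sums. -/
theorem exists_noise_le {μ : ℕ → ℝ} {T : ℝ} (hB : 0 < B)
    (hpu : Q.p.IsUnbiased) (hpm : Q.p.IsMultiplicative εp)
    (hau : Q.a.IsUnbiased) (ham : Q.a.IsMultiplicative εa)
    (hou : Q.o.IsUnbiased) (hom : Q.o.IsMultiplicative εo)
    (hεp : 0 ≤ εp) (hεa : 0 ≤ εa) (hεo : 0 ≤ εo) (hα : 0 ≤ α) (hS : Q.SampleMoments D w₀ α σ)
    (hA : TraceDecomposition (Q.covHq D) μ v T) (hT : 0 ≤ T) (hγ : 0 < γ)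
    (hΔ : γ * α * stepConst 0 εp εa εo * T ≤ 1) (hZ : ∀ t, Measurable (Z t))
    (hlaw : ∀ t, HasLaw (Z t) (Q.stepLaw D) P) (hind : iIndepFun Z P) (N : ℕ) :
    ∃ X, 0 ≤ X ∧
      X * (1 - γ * α * stepConst 0 εp εa εo * T) ≤
        α * (1 + 2 * stepConst 0 εp εa εo) * (∑' i, μ i * geom γ (μ i) N * ⟪v i, w₀⟫ ^ 2) +
          N * ((1 + 4 * εo) * (σ ^ 2 / B)) +
          4 * activationNoise εp εa εo * N * (α * ⟪w₀, Q.covHq D w₀⟫) ∧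
      Integrable (fun ω => ⟪∑ t ∈ Finset.range N, Q.variancePart γ w₀ (fun j => Z j ω) t,
        Q.covHq D (∑ t ∈ Finset.range N, Q.variancePart γ w₀ (fun j => Z j ω) t)⟫) P ∧
      Integrable (fun ω => ⟪∑ t ∈ Finset.range N, Q.biasPart γ w₀ (fun j => Z j ω) t,
        Q.covHq D (∑ t ∈ Finset.range N, Q.biasPart γ w₀ (fun j => Z j ω) t)⟫) P ∧
      ∫ ω, ⟪∑ t ∈ Finset.range N, Q.variancePart γ w₀ (fun j => Z j ω) t,
          Q.covHq D (∑ t ∈ Finset.range N, Q.variancePart γ w₀ (fun j => Z j ω) t)⟫ ∂P +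
        ∫ ω, ⟪∑ t ∈ Finset.range N, Q.biasPart γ w₀ (fun j => Z j ω) t,
          Q.covHq D (∑ t ∈ Finset.range N, Q.biasPart γ w₀ (fun j => Z j ω) t)⟫ ∂P ≤
        2 * (∑' i, μ i * geom γ (μ i) N ^ 2 * ⟪v i, w₀⟫ ^ 2) +
          2 * γ ^ 2 * X * ∑' i, (μ i * geom γ (μ i) N) ^ 2 := by
  have hK1 := one_le_stepConst hεp hεa hεo
  have hγμ := mul_eigenvalue_le_one hS hA hT hγ hK1 hΔ
  have hb := driftProcess_biasPart (γ := γ) hB hα hS hA hZ hlaw hind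
  have hv := driftProcess_variancePart (γ := γ) hB hα hS hA hZ hlaw hind hpu hpm hau ham hou hom
    hεp hεa hεo
  have hbq := hb.sum_quadratic_le hA hγ hγμ N
  have hvq := hv.sum_quadratic_le hA hγ hγμ N
  obtain ⟨hbI, hbs⟩ := hb.quadratic_sum_le hA hγ hγμ N
  obtain ⟨hvI, hvs⟩ := hv.quadratic_sum_le hA hγ hγμ N
  simp only [inner_neg_right, neg_sq, inner_zero_right, ne_eq, OfNat.ofNat_ne_zero,
    not_false_eq_true, zero_pow, mul_zero, tsum_zero, zero_add, ← Finset.mul_sum] at hbq hvq hbs hvs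
  have hQ0 : 0 ≤ ∑ t ∈ Finset.range N, ∫ ω, ⟪Q.biasPart γ w₀ (fun j => Z j ω) t,
      Q.covHq D (Q.biasPart γ w₀ (fun j => Z j ω) t)⟫ ∂P :=
    Finset.sum_nonneg fun t _ => integral_nonneg fun _ => hA.quadratic_nonneg _
  have hR0 : 0 ≤ ∑ t ∈ Finset.range N, ∫ ω, ⟪Q.variancePart γ w₀ (fun j => Z j ω) t,
      Q.covHq D (Q.variancePart γ w₀ (fun j => Z j ω) t)⟫ ∂P :=
    Finset.sum_nonneg fun t _ => integral_nonneg fun _ => hA.quadratic_nonneg _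
  have hΘ0 : 0 ≤ ∑ t ∈ Finset.range N, Q.varianceNoise D P Z γ w₀ εp εa εo α σ t :=
    Finset.sum_nonneg fun t _ => hv.nonneg t
  have hΘ : ∑ t ∈ Finset.range N, Q.varianceNoise D P Z γ w₀ εp εa εo α σ t =
      α * (1 + 2 * εo + 2 * activationNoise εp εa εo) *
        (∑ t ∈ Finset.range N, ∫ ω, ⟪Q.variancePart γ w₀ (fun j => Z j ω) t,
          Q.covHq D (Q.variancePart γ w₀ (fun j => Z j ω) t)⟫ ∂P) +
      N * ((1 + 4 * εo) * (σ ^ 2 / B)) + α * ((4 * εo + 4 * activationNoise εp εa εo) *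
        (∑ t ∈ Finset.range N, ∫ ω, ⟪Q.biasPart γ w₀ (fun j => Z j ω) t,
          Q.covHq D (Q.biasPart γ w₀ (fun j => Z j ω) t)⟫ ∂P) +
        4 * activationNoise εp εa εo * N * ⟪w₀, Q.covHq D w₀⟫) := by
    simp only [varianceNoise, Finset.sum_add_distrib, ← Finset.mul_sum,
      Finset.sum_const, Finset.card_range, nsmul_eq_mul]
    ring
  generalize ∑ t ∈ Finset.range N, Q.varianceNoise D P Z γ w₀ εp εa εo α σ t = Θ at *
  generalize ∑ t ∈ Finset.range N, ∫ ω, ⟪Q.biasPart γ w₀ (fun j => Z j ω) t,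
      Q.covHq D (Q.biasPart γ w₀ (fun j => Z j ω) t)⟫ ∂P = Qs at *
  generalize ∑ t ∈ Finset.range N, ∫ ω, ⟪Q.variancePart γ w₀ (fun j => Z j ω) t,
      Q.covHq D (Q.variancePart γ w₀ (fun j => Z j ω) t)⟫ ∂P = Rs at *
  -- The left side expands to 2ε_p + 2ε_a(1 + ε_p) + 2ε_o(1 + ε_a)(1 + ε_p); C_ε leaves room for
  -- another copy of the last term.
  have hκ1 : 2 * εo + 2 * activationNoise εp εa εo ≤ stepConst 0 εp εa εo - 1 := by
    have : 0 ≤ εo * (1 + εa) * (1 + εp) := by positivity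
    simp only [activationNoise, stepConst]
    linarith only [this, hεo, hεp, hεa, mul_nonneg hεo hεp, mul_nonneg hεo hεa,
      mul_nonneg (mul_nonneg hεo hεa) hεp]
  -- The witness is the total noise level of both processes.
  refine ⟨α * Qs + Θ, add_nonneg (mul_nonneg hα hQ0) hΘ0, ?_, hvI, hbI, ?_⟩
  · refine noise_le (s₂ := (1 + 4 * εo) * (σ ^ 2 / B)) hα (mul_nonneg hγ.le hT) hK1 hκ1
      (sub_nonneg.2 hΔ) hQ0 hR0 hbq hvq ?_
    rw [hΘ]
    ring
  · refine (add_le_add hvs hbs).trans (le_of_eq ?_)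
    ring

theorem activationNoise_le {M : ℝ} (hεp : 0 ≤ εp) (hεa : 0 ≤ εa) (hεo : 0 ≤ εo) (hpM : εp ≤ M)
    (hoM : εo ≤ M) : activationNoise εp εa εo ≤ (1 + M) ^ 2 * (εp + εa) := by
  have hM : 0 ≤ M := hεo.trans hoM
  have h1 : εp + εa * (1 + εp) ≤ (1 + M) * (εp + εa) := by
    have h2 : εa * (1 + εp) ≤ εa * (1 + M) := by gcongr
    have h3 := mul_nonneg hM hεp
    linarith only [h2, h3]
  calc activationNoise εp εa εo ≤ (1 + M) * ((1 + M) * (εp + εa)) := by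
        unfold activationNoise
        gcongr
    _ = _ := by ring

open DriftProcess in
/-- The geometric sums in terms of the first `k` and of the remaining eigenvalues. -/
theorem tsum_geom_le {A : E →L[ℝ] E} (hH : IsEigendecomposition A lam v) (hs : Summable lam)
    {T M : ℝ} {A' : E →L[ℝ] E} (hA : TraceDecomposition A' (fun i => (1 + εd) * lam i) v T)
    (hεd : 0 ≤ εd) (hdM : εd ≤ M)
    (hγ : 0 < γ) (hγμ : ∀ i, γ * ((1 + εd) * lam i) ≤ 1) (h : (1 + εd) • A w₀ = A wstar)
    (N k : ℕ) :
    ∑' i, (1 + εd) * lam i * geom γ ((1 + εd) * lam i) N * ⟪v i, w₀⟫ ^ 2 ≤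
      γ⁻¹ * sqNorm (headOp (fun _ => 1) v k) wstar + N * sqNorm (tailOp lam v k) wstar ∧
    ∑' i, (1 + εd) * lam i * geom γ ((1 + εd) * lam i) N ^ 2 * ⟪v i, w₀⟫ ^ 2 ≤
      (γ ^ 2)⁻¹ * sqNorm (headOp (fun i => (lam i)⁻¹) v k) wstar +
        (N : ℝ) ^ 2 * sqNorm (tailOp lam v k) wstar ∧
    ∑' i, ((1 + εd) * lam i * geom γ ((1 + εd) * lam i) N) ^ 2 ≤
      k * (γ ^ 2)⁻¹ + (N : ℝ) ^ 2 * (1 + M) ^ 2 * ∑' i, lam (k + i) ^ 2 := by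
  -- On eigenvectors outside the kernel, the two optima differ exactly by the factor 1 + ε_d.
  have hp : ∀ i, lam i ≠ 0 → ⟪v i, wstar⟫ = (1 + εd) * ⟪v i, w₀⟫ := fun i hi => by
    have h1 := hH.inner_apply hi wstar
    rw [← h, inner_smul_right, hH.inner_apply hi] at h1
    have h2 : lam i * ⟪v i, wstar⟫ = lam i * ((1 + εd) * ⟪v i, w₀⟫) := by linarith only [h1]
    exact mul_left_cancel₀ hi h2
  have hgeo := geom_head_tail hH.nonneg hεd hdM hγ hγμ hp N
  have htail := sqNorm_tailOp hH hs k wstar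
  have hlam2 : Summable fun i => lam (k + i) ^ 2 := by
    refine Summable.of_nonneg_of_le (fun i => sq_nonneg _) (fun i => ?_)
      ((hs.comp_injective (add_right_injective k)).mul_left (lam 0))
    rw [pow_two]
    exact mul_le_mul_of_nonneg_right (hH.antitone (Nat.zero_le _)) (hH.nonneg _)
  obtain ⟨hs1, hs2, hs3⟩ := DriftProcess.summable_geom hA hγ hγμ w₀ N
  have hW1 := tsum_le_head_add_tail hs1 k (fun i => (hgeo i).1.1) (fun i => (hgeo (k + i)).1.2)
    (htail.mul_left _)
  have hW2 := tsum_le_head_add_tail hs2 k (fun i => (hgeo i).2.1.1)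
    (fun i => (hgeo (k + i)).2.1.2) (htail.mul_left _)
  have hY := tsum_le_head_add_tail hs3 k (fun i => (hgeo i).2.2.1)
    (fun i => (hgeo (k + i)).2.2.2) (hlam2.hasSum.mul_left _)
  rw [← Finset.mul_sum, ← sqNorm_headOp] at hW1 hW2
  rw [Finset.sum_const, Finset.card_range, nsmul_eq_mul] at hY
  exact ⟨hW1, hW2, hY⟩

/-- The excess risk bound for measurable randomness, with the head of an arbitrary dimension `k`. -/
theorem integrable_excessRisk_and_integral_le {M : ℝ} (hB : 0 < B) (hN : 0 < N)
    (hu : Q.IsUnbiased) (hdm : Q.d.IsMultiplicative εd) (hlm : Q.l.IsMultiplicative εl)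
    (hpm : Q.p.IsMultiplicative εp) (ham : Q.a.IsMultiplicative εa)
    (hom : Q.o.IsMultiplicative εo) (hεd : 0 ≤ εd) (hεl : 0 ≤ εl) (hεp : 0 ≤ εp) (hεa : 0 ≤ εa)
    (hεo : 0 ≤ εo) (hdM : εd ≤ M) (hpM : εp ≤ M) (haM : εa ≤ M) (hoM : εo ≤ M)
    (hD : Q.FiniteCovariance D) (hmin : ∀ w, risk D wstar ≤ risk D w)
    (hminq : ∀ w, Q.riskq D w₀ ≤ Q.riskq D w) (hα : 0 < α) (h4 : Q.FourthMoment D α)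
    (hσ : Q.NoiseCondition D w₀ σ) (hH : IsEigendecomposition (covH D) lam v)
    (hγ : 0 < γ) (hγlt : γ < 1 / (α * stepConst εd εp εa εo * opTrace (covH D)))
    (hZ : ∀ t, Measurable (Z t)) (hlaw : ∀ t, HasLaw (Z t) (Q.stepLaw D) P)
    (hind : iIndepFun Z P) (k : ℕ) :
    Integrable (fun ω => risk D (Q.average γ N fun t => Z t ω) - risk D wstar) P ∧
    ∫ ω, (risk D (Q.average γ N fun t => Z t ω) - risk D wstar) ∂P ≤
      (3 + 3 * (1 + M) ^ 2 * (1 + 2 * stepConst 0 M M M + 4 * M + 4 * (1 + M) ^ 2)) *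
        (sqNorm (covH D) wstar * εd + εl +
          ((k : ℝ) / N + N * γ ^ 2 * ∑' i, lam (k + i) ^ 2) *
            ((σ ^ 2 / B + α * ((εo + εa + εp) * sqNorm (covH D) wstar +
              sqNorm (headOp (fun _ => 1) v k) wstar / (N * γ) + sqNorm (tailOp lam v k) wstar)) /
            (1 - γ * α * stepConst εd εp εa εo * opTrace (covH D))) +
          (1 / (γ ^ 2 * (N : ℝ) ^ 2) * sqNorm (headOp (fun i => (lam i)⁻¹) v k) wstar +
            sqNorm (tailOp lam v k) wstar)) := by
  obtain ⟨hdu, hlu, hpu, hau, hou⟩ := hu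
  have hM : 0 ≤ M := hεd.trans hdM
  have hN' : (0 : ℝ) < N := by exact_mod_cast hN
  have hy := memLp_yq hlu hlm hD.2.2
  have hS : Q.SampleMoments D w₀ α σ := sampleMoments hD hy hminq h4 hσ
  have hcov := covHq_eq_smul hD hdu hdm
  have hopt := covHq_optimum hD hy hdu hlu hmin hminq
  have hopt' : (1 + εd) • covH D w₀ = covH D wstar := by
    rw [← hopt, hcov, smul_apply]
  have hA : TraceDecomposition (Q.covHq D) (fun i => (1 + εd) * lam i) v
      ((1 + εd) * opTrace (covH D)) := by
    rw [hcov]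
    exact traceDecomposition_smul hD.1 hH (by positivity)
  have hlamS := (summable_eigenvalues hD.1 hH).1
  have hK1 := one_le_stepConst hεp hεa hεo
  have hKM : stepConst 0 εp εa εo ≤ stepConst 0 M M M := by
    unfold stepConst
    gcongr
  have hKT : γ * α * stepConst 0 εp εa εo * ((1 + εd) * opTrace (covH D)) =
      γ * α * stepConst εd εp εa εo * opTrace (covH D) := by
    rw [stepConst_eq εd]
    ring
  obtain ⟨htr, hγ1⟩ := trace_pos_of_lt_inv hα
    (by rw [stepConst_eq]; positivity) hγ hγlt
  rw [← hKT] at hγ1 ⊢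
  have hT0 : 0 ≤ (1 + εd) * opTrace (covH D) := by positivity
  have hγμ := mul_eigenvalue_le_one hS hA hT0 hγ hK1 hγ1.le
  obtain ⟨hq, hdh⟩ := optimum_relations (inner_secondMoment_comm hD.1)
    (inner_secondMoment_self_nonneg hD.1) hεd hopt'
  replace hq : ⟪w₀, Q.covHq D w₀⟫ ≤ sqNorm (covH D) wstar := by
    rw [hopt]
    exact hq
  obtain ⟨X, hX0, hXle, hvI, hbI, hE⟩ := exists_noise_le hB hpu hpm hau ham hou hom hεp hεa hεo hα.le
    hS hA hT0 hγ hγ1.le hZ hlaw hind N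
  obtain ⟨hW1, hW2, hY⟩ := tsum_geom_le hH hlamS hA hεd hdM hγ hγμ hopt' N k
  have hh0 : 0 ≤ sqNorm (covH D) wstar := inner_secondMoment_self_nonneg hD.1 wstar
  have htl0 : 0 ≤ sqNorm (tailOp lam v k) wstar :=
    (sqNorm_tailOp hH hlamS k wstar).nonneg fun i => mul_nonneg (hH.nonneg _) (sq_nonneg _)
  have hI0 : 0 ≤ sqNorm (headOp (fun _ => 1) v k) wstar :=
    sqNorm_headOp_nonneg (fun _ => zero_le_one) v k wstar
  have hHinv0 : 0 ≤ sqNorm (headOp (fun i => (lam i)⁻¹) v k) wstar :=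
    sqNorm_headOp_nonneg (fun i => inv_nonneg.2 (hH.nonneg i)) v k wstar
  have hκ0 : 0 ≤ activationNoise εp εa εo := by
    unfold activationNoise
    positivity
  have hκM := activationNoise_le hεp hεa hεo hpM hoM
  have hΔ := sub_pos.2 hγ1
  have hsq := sq_nonneg (1 + M)
  have hm1 : 1 ≤ (1 + M) ^ 2 := one_le_pow₀ (by linarith only [hM])
  have hC1K : 1 + 2 * stepConst 0 εp εa εo ≤
      1 + 2 * stepConst 0 M M M + 4 * M + 4 * (1 + M) ^ 2 := by
    linarith only [hsq, hM, hKM]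
  have hC1 : 0 ≤ 1 + 2 * stepConst 0 M M M + 4 * M + 4 * (1 + M) ^ 2 := by
    linarith only [hC1K, hK1]
  have hC1o : 1 + 4 * εo ≤ 1 + 2 * stepConst 0 M M M + 4 * M + 4 * (1 + M) ^ 2 := by
    linarith only [hsq, hKM, hoM, hK1]
  have hC1c : 4 * (1 + M) ^ 2 ≤ 1 + 2 * stepConst 0 M M M + 4 * M + 4 * (1 + M) ^ 2 := by
    linarith only [hKM, hM, hK1]
  have hs₂ : 0 ≤ σ ^ 2 / B := by positivity
  have hXN := total_noise_le hN' hγ hα.le hΔ hK1 hs₂ hh0 hI0 htl0 hεp hεa hεo hC1 hC1K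
    hC1o hC1c hκM hκ0 hq hW1 hXle
  have hR0 : 0 ≤ (σ ^ 2 / B + α * ((εo + εa + εp) * sqNorm (covH D) wstar +
      sqNorm (headOp (fun _ => 1) v k) wstar / (N * γ) + sqNorm (tailOp lam v k) wstar)) /
      (1 - γ * α * stepConst 0 εp εa εo * ((1 + εd) * opTrace (covH D))) := by
    refine div_nonneg ?_ hΔ.le
    positivity
  have htot := total_error_le hN' hγ hm1 hC1 hR0 hh0 hHinv0 htl0
    (tsum_nonneg fun i => sq_nonneg (lam (k + i))) (Nat.cast_nonneg k) hX0 hεd hεl hE hdh hW2 hY hXN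
  have hbound := fun ω => excessRisk_le (γ := γ) Q hN hD hεd hcov hmin w₀ (fun j => Z j ω)
  have hdomI := (integrable_fun_add ((integrable_fun_add hvI hbI).const_mul (1 / (N : ℝ) ^ 2))
    (integrable_const ⟪w₀ - wstar, covH D (w₀ - wstar)⟫)).const_mul (3 / 2)
  have hmeas : AEStronglyMeasurable
      (fun ω => risk D (Q.average γ N fun t => Z t ω) - risk D wstar) P := by
    have hb := driftProcess_biasPart (γ := γ) hB hα.le hS hA hZ hlaw hind
    have hv := driftProcess_variancePart (γ := γ) hB hα.le hS hA hZ hlaw hind hpu hpm hau ham hou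
      hom hεp hεa hεo
    have h1 := (exists_weakBound_sum hb.weak N).choose_spec.1
    have h2 := (exists_weakBound_sum hv.weak N).choose_spec.1
    have h3 := ((((h2.const_smul (1 / (N : ℝ))).add (h1.const_smul (1 / (N : ℝ)))).add
      (aestronglyMeasurable_const (b := w₀))).sub (aestronglyMeasurable_const (b := wstar)))
    have h4 := (h3.inner (𝕜 := ℝ) ((covH D).continuous.comp_aestronglyMeasurable h3)).const_mul (1 / 2 : ℝ)
    simp_rw [risk_sub_risk hD hmin, average_eq w₀ hN]
    exact h4
  have hEI : Integrable (fun ω => risk D (Q.average γ N fun t => Z t ω) - risk D wstar) P :=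
    hdomI.mono' hmeas (.of_forall fun ω => by
      rw [Real.norm_of_nonneg (sub_nonneg.2 (hmin _))]
      exact hbound ω)
  refine ⟨hEI, (integral_mono hEI hdomI hbound).trans (le_trans (le_of_eq ?_) htot)⟩
  rw [integral_const_mul, integral_add ((integrable_fun_add hvI hbI).const_mul (1 / (N : ℝ) ^ 2))
    (integrable_const _), integral_const_mul, integral_add hvI hbI, integral_const, probReal_univ,
    one_smul, covH]

end Quantizers

end QuantizedSGD

theorem theorem2 (M : ℝ) :
    ∃ C : ℝ, 0 < C ∧
      ∀ (E : Type u) [NormedAddCommGroup E] [InnerProductSpace ℝ E] [CompleteSpace E]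
        [TopologicalSpace.SeparableSpace E] [MeasurableSpace E] [BorelSpace E]
        (D : Measure (E × ℝ)) [IsProbabilityMeasure D]
        (B N : ℕ) (_ : 0 < B) (_ : 0 < N)
        (Q : Quantizers E B) (εd εl εp εa εo αB σ γ : ℝ)
        (wstar wqstar : E) (lam lamq : ℕ → ℝ) (v vq : ℕ → E)
        (Ω : Type v) [MeasurableSpace Ω] (P : Measure Ω) [IsProbabilityMeasure P]
        (Z : ℕ → Ω → Q.Step),
        -- unbiased, multiplicative quantizers with bounded errors
        Q.IsUnbiased →
        Q.d.IsMultiplicative εd → Q.l.IsMultiplicative εl → Q.p.IsMultiplicative εp →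
        Q.a.IsMultiplicative εa → Q.o.IsMultiplicative εo →
        0 ≤ εd → 0 ≤ εl → 0 ≤ εp → 0 ≤ εa → 0 ≤ εo →
        εd ≤ M → εl ≤ M → εp ≤ M → εa ≤ M → εo ≤ M →
        -- the data model; `wstar` and `wqstar` are the optima on raw and on quantized data
        Q.FiniteCovariance D →
        (∀ w, risk D wstar ≤ risk D w) →
        (∀ w, Q.riskq D wqstar ≤ Q.riskq D w) →
        0 < αB → Q.FourthMoment D αB →
        0 < σ → Q.NoiseCondition D wqstar σ →
        IsEigendecomposition (covH D) lam v →
        IsEigendecomposition (Q.covHq D) lamq vq →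
        -- the stepsize
        0 < γ → γ < 1 / (αB * stepConst εd εp εa εo * opTrace (covH D)) →
        -- the iterations use independent copies of the randomness of one iteration
        (∀ t, HasLaw (Z t) (Q.stepLaw D) P) → iIndepFun Z P →
        let k := effectiveDim lamq (1 / (N * γ))
        let approxErr := sqNorm (covH D) wstar * εd + εl
        let biasErr := 1 / (γ ^ 2 * (N : ℝ) ^ 2) * sqNorm (headOp (fun i => (lam i)⁻¹) v k) wstar +
          sqNorm (tailOp lam v k) wstar
        let varErr := ((k : ℝ) / N + N * γ ^ 2 * ∑' i, lam (k + i) ^ 2) *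
          ((σ ^ 2 / B + αB * ((εo + εa + εp) * sqNorm (covH D) wstar +
              sqNorm (headOp (fun _ => 1) v k) wstar / (N * γ) + sqNorm (tailOp lam v k) wstar)) /
            (1 - γ * αB * stepConst εd εp εa εo * opTrace (covH D)))
        let excessRisk := fun ω => risk D (Q.average γ N fun t => Z t ω) - risk D wstar
        Integrable excessRisk P ∧ ∫ ω, excessRisk ω ∂P ≤ C * (approxErr + varErr + biasErr) := by
  have hK : 0 ≤ stepConst 0 |M| |M| |M| := by
    unfold stepConst
    positivity
  -- |M| keeps the constant positive even for negative M.
  refine ⟨3 + 3 * (1 + |M|) ^ 2 * (1 + 2 * stepConst 0 |M| |M| |M| + 4 * |M| + 4 * (1 + |M|) ^ 2),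
    by positivity, ?_⟩
  intro E _ _ _ _ _ _ D _ B N hB hN Q εd εl εp εa εo αB σ γ wstar wqstar lam lamq v vq Ω _ P _ Z
    hu hdm hlm hpm ham hom hεd hεl hεp hεa hεo hdM _ hpM haM hoM hD hmin hminq hα h4 _ hσ hH _ hγ
    hγlt hlaw hind k approxErr biasErr varErr excessRisk
  have : SecondCountableTopology E := UniformSpace.secondCountable_of_separable E
  have hM := le_abs_self M
  -- A law gives only almost everywhere measurability; measurable versions keep laws and
  -- independence and change the excess risk on a null set only.
  have hmk := fun t => (hlaw t).aemeasurable.ae_eq_mk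
  obtain ⟨h1, h2⟩ := Quantizers.integrable_excessRisk_and_integral_le hB hN hu hdm hlm hpm ham hom
    hεd hεl hεp hεa hεo (hdM.trans hM) (hpM.trans hM) (haM.trans hM) (hoM.trans hM) hD hmin hminq
    hα h4 hσ hH hγ hγlt (fun t => (hlaw t).aemeasurable.measurable_mk)
    (fun t => (hlaw t).congr (hmk t).symm) (hind.congr hmk) k
  have he : (fun ω => risk D (Q.average γ N fun t => (hlaw t).aemeasurable.mk (Z t) ω) -
      risk D wstar) =ᵐ[P] excessRisk := by
    filter_upwards [ae_all_iff.2 hmk] with ω hω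
    simp only [excessRisk, hω]
  refine ⟨h1.congr he, ?_⟩
  rw [← integral_congr_ae he]
  exact h2
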